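/- Let $N\ge 2$, $\omega=e^{2\pi i/N}$, $\varepsilon=(-1)^N$. Consider a chain of $n\ge1$ sites with state space $(\mathbb C^N)^{\otimes n}$, basis $|\gamma_1,\dots,\gamma_n\rangle$, $\gamma_k\in\mathbb Z_N$, dual basis $\langle\gamma|$ with $\langle\gamma'|\gamma\rangle=\delta_{\gamma',\gamma}$, and Weyl operators $u_k|\gamma\rangle=\omega^{\gamma_k}|\gamma\rangle$, $v_k|\gamma\rangle=|\gamma+e_k\rangle$. For parameters $a_k,b_k,c_k,d_k,\varkappa_k\in\mathbb C\setminus\{0\}$ let $$L_k(\lambda)=\begin{pmatrix}1+\lambda\varkappa_kv_k&\lambda u_k^{-1}(a_k-b_kv_k)\\ u_k(c_k-d_kv_k)&\lambda a_kc_k+v_kb_kd_k/\varkappa_k\end{pmatrix},\qquad L_1(\lambda)\cdots L_n(\lambda)=\begin{pmatrix}A_n(\lambda)&B_n(\lambda)\\C_n(\lambda)&D_n(\lambda)\end{pmatrix}.$$ **Cyclic functions.** For $p=(x,y)$ with $x^N+y^N=1$, $y\neq0$, let $w_p:\mathbb Z_N\to\mathbb C$ be given by $w_p(0)=1$, $w_p(\gamma)/w_p(\gamma-1)=y/(1-\omega^\gamma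 x)$. **Amplitudes.** Let $r_k\ne0$, $r_k^N=a_k^N-b_k^N$. Let $\mathcal B_m(\Lambda)$ be the upper right entry of $\mathcal L_1\cdots\mathcal L_m$, where $$\mathcal L_k(\Lambda)=\begin{pmatrix}1-\varepsilon\varkappa_k^N\Lambda&-\varepsilon(a_k^N-b_k^N)\Lambda\\ c_k^N-d_k^N&(b_kd_k/\varkappa_k)^N-\varepsilon a_k^Nc_k^N\Lambda\end{pmatrix}.$$ For $1\le m\le n$ choose $r_{m,0},\dots,r_{m,m-1}$ with $\mathcal B_m(\Lambda)=-\varepsilon\, r_{m,0}^N\,\Lambda\prod_{k=1}^{m-1}(r_{m,k}^N-\varepsilon\Lambda)$ and $r_{1,0}=r_1$. Put $\tilde r_m=\prod_{k=0}^{m-1}r_{m,k}$. Assume that for each $m\le n$ the functions $\lambda\mapsto\lambda r_{m,0}\omega^{-\rho_0}\prod_{k=1}^{m-1}(\lambda+r_{m,k}\omega^{-\rho_k})$, $\rho\in\mathbb Z_N^m$, are pairwise different. **Fermat points.** Let $x_k=r_k/a_k$, $y_k=b_k/a_k$; for $2\le m\le n$ let $p_{m,0}=(x_{m,0},y_{m,0})=\left(\frac{r_{m-1,0}a_mc_m}{r_{m,0}},\frac{\varkappa_1\cdots\varkappa_{m-1}r_m}{r_{m,0}}\right)$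 and $\tilde p_m=(\tilde x_m,\tilde y_m)=\left(\frac{r_m}{\tilde r_m},\frac{b_md_m\tilde r_{m-1}}{\varkappa_m\tilde r_m}\right)$. For $2\le m<n$ and $1\le l\le m-1$ choose points $p=(x,y)$ with $x^N+y^N=1$, $y\ne0$ (assumed possible), as follows: $p_{m,l}^{m+1,k}$ ($1\le k\le m$) with $x=r_{m+1,k}/r_{m,l}$; $p_{m,l}^{m,j}$ ($1\le j\le m-1$, $j\ne l$) with $x=r_{m,j}/r_{m,l}$; $p_{m,l}$ with $x=a_m\varkappa_mr_{m,l}/b_m$; $\tilde p_{m,l}$ with $x=d_m/(\varkappa_mc_mr_{m,l})$. Their second coordinates are denoted by $y$ with the same indices, $\tilde y$ for $\tilde p$, and their phases are chosen such that $$r_{m+1}\tilde r_{m-1}r_{m,0}b_mc_m\,y_{m,l}\tilde y_{m,l}\prod_{s=1}^{m-2}y_{m-1,s}^{m,l}\prod_{j\ne l}\frac{y_{m,l}^{m,j}}{y_{m,j}^{m,l}}=r_m r_{m+1,0}\tilde r_m\prod_{k=1}^{m}y_{m,l}^{m+1,k}.$$ **Vectors.** One-site vectors: $|\psi_\rho\rangle_k=\sum_\gamma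 w_{(x_k,y_k)}(\gamma-\rho)|\gamma\rangle_k$, ${}_k\langle\psi_\rho|=\sum_\gamma w_{(x_k,y_k/\omega)}(\gamma-\rho-1)^{-1}{}_k\langle\gamma|$. Let $|\Psi_{\rho_1}\rangle=|\psi_{\rho_{1,0}}\rangle_1$, $\langle\Psi_{\rho_1}|={}_1\langle\psi_{\rho_{1,0}}|$, and, for length $m\ge2$ and $\boldsymbol\rho_m=(\rho_{m,0},\dots,\rho_{m,m-1})\in\mathbb Z_N^m$ with $\tilde\rho_m=\sum_k\rho_{m,k}$, $$|\Psi_{\boldsymbol\rho_m}\rangle=\sum_{\boldsymbol\rho_{m-1},\,\rho_m}Q^R\,|\Psi_{\boldsymbol\rho_{m-1}}\rangle\otimes|\psi_{\rho_m}\rangle_m,\qquad\langle\Psi_{\boldsymbol\rho_m}|=\sum_{\boldsymbol\rho_{m-1},\,\rho_m}Q^L\,\langle\Psi_{\boldsymbol\rho_{m-1}}|\otimes{}_m\langle\psi_{\rho_m}|,$$ the sums running over $\boldsymbol\rho_{m-1}\in\mathbb Z_N^{m-1}$, $\rho_m\in\mathbb Z_N$, where $$Q^R=\frac{\omega^{(\tilde\rho_m-\tilde\rho_{m-1})(\rho_m-\rho_{m,0})}}{w_{p_{m,0}}(\rho_{m,0}-\rho_{m-1,0}-1)\,w_{\tilde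 p_m}(\tilde\rho_m-\rho_m-1)}\cdot\frac{\prod_{l=1}^{m-2}\prod_{k=1}^{m-1}w_{p_{m-1,l}^{m,k}}(\rho_{m-1,l}-\rho_{m,k})}{\prod_{j\ne l}^{m-2}w_{p_{m-1,j}^{m-1,l}}(\rho_{m-1,j}-\rho_{m-1,l})}\prod_{l=1}^{m-2}\frac{w_{p_{m-1,l}}(-\rho_{m-1,l})}{w_{\tilde p_{m-1,l}}(\rho_{m-1,l})},$$ $$Q^L=\omega^{-(\tilde\rho_m-\tilde\rho_{m-1})(\rho_m-\rho_{m,0})+\tilde\rho_{m-1}-\rho_{m-1,0}}\prod_{j\ne l}^{m-2}w_{p_{m-1,j}^{m-1,l}}(\rho_{m-1,j}-\rho_{m-1,l}-1)\cdot\frac{w_{p_{m,0}}(\rho_{m,0}-\rho_{m-1,0})\,w_{\tilde p_m}(\tilde\rho_m-\rho_m)}{\prod_{l=1}^{m-2}\prod_{k=1}^{m-1}w_{p_{m-1,l}^{m,k}}(\rho_{m-1,l}-\rho_{m,k}-1)}\prod_{l=1}^{m-2}\frac{w_{\tilde p_{m-1,l}}(\rho_{m-1,l})}{w_{p_{m-1,l}}(-\rho_{m-1,l})}.$$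 **Theorem.** For every $\boldsymbol\rho=\boldsymbol\rho_n\in\mathbb Z_N^n$, $|\Psi_{\boldsymbol\rho}\rangle$ is a right and $\langle\Psi_{\boldsymbol\rho}|$ a left eigenvector of $B_n(\lambda)$, for all $\lambda$, with eigenvalue $\lambda r_{n,0}\omega^{-\rho_{n,0}}\prod_{k=1}^{n-1}(\lambda-\lambda_{n,k})$, $\lambda_{n,k}=-r_{n,k}\omega^{-\rho_{n,k}}$. The overlap $\langle\Psi_{\boldsymbol\rho}|\Psi_{\boldsymbol\rho}\rangle$ does not depend on $\rho_{n,0}$, and $$\langle\Psi_{\boldsymbol\rho}|\Psi_{\boldsymbol\rho}\rangle=\frac{C_n}{\prod_{1\le l<m\le n-1}(\lambda_{n,l}-\lambda_{n,m})}=\frac{C_n}{\prod_{1\le l<m\le n-1}(r_{n,m}\omega^{-\rho_{n,m}}-r_{n,l}\omega^{-\rho_{n,l}})},$$ where the numbers $C_n$ do not depend on $\boldsymbol\rho$ and are given by $$C_1=\frac N\omega\Big(\frac{x_1}{y_1}\Big)^{N-1},\qquad C_2=C_1\frac{N^3}{\omega}\Big(\frac{x_2}{y_2\tilde y_2y_{2,0}}\Big)^{N-1},$$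 and, for $n\ge3$, $$C_n=C_{n-1}\,\mathcal N_n\,N^{n-2}\,\frac{\prod_{1\le k<k'\le n-1}(r_{n,k'}^N-r_{n,k}^N)\prod_{1\le l<l'\le n-2}(r_{n-1,l}^N-r_{n-1,l'}^N)}{\prod_{k=1}^{n-1}\prod_{l=1}^{n-2}(r_{n,k}^N-r_{n-1,l}^N)}\prod_{l=1}^{n-2}r_{n-1,l}^{N+1},$$ $$\mathcal N_n=\frac{N^3}{\omega}\Big(\frac{x_n}{y_ny_{n,0}\tilde y_n}\Big)^{N-1}\prod_{l=1}^{n-2}\frac{\prod_{k=1}^{n-1}y_{n-1,l}^{n,k}}{\prod_{j\ne l}^{n-2}y_{n-1,l}^{n-1,j}}.$$ -/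

import Mathlib

open scoped Matrix Polynomial

namespace BBS

noncomputable section

/-- The phase `ω ^ γ` for `γ ∈ ℤ/N`, where `ω = exp (2 π i / N)`; in particular `phase 1 = ω`. -/
def phase {N : ℕ} [NeZero N] (γ : ZMod N) : ℂ := ZMod.stdAddChar γ

/-- `(x, y)` lies on the Fermat curve `x ^ N + y ^ N = 1`, with `y ≠ 0`, so that the values of the
cyclic function at this point are finite and nonzero. -/
def IsFermat (N : ℕ) (x y : ℂ) : Prop := x ^ N + y ^ N = 1 ∧ y ≠ 0

/-- The cyclic function `w_p` of the point `p = (x, y)`: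
`w_p 0 = 1` and `w_p γ / w_p (γ - 1) = y / (1 - ω ^ γ x)`. -/
def cyc {N : ℕ} [NeZero N] (x y : ℂ) (γ : ZMod N) : ℂ :=
  ∏ j ∈ Finset.range γ.val, y / (1 - phase ((j + 1 : ℕ) : ZMod N) * x)

/-- The parameters of the chain (sites are numbered `1, 2, …`), together with the choices of roots
that enter the construction of the eigenvectors. The equations that these have to satisfy are
collected in `Data.Admissible`. -/
structure Data where
  /-- parameters of the `L`-operators -/
  (a b c d κ : ℕ → ℂ)
  /-- `r k` is the one-site amplitude `r_k` -/
  r : ℕ → ℂ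
  /-- `R n k` is the amplitude `r_{n,k}`, `0 ≤ k ≤ n - 1` -/
  R : ℕ → ℕ → ℂ
  /-- `y n l n' k` is the second coordinate of the Fermat point `p_{n,l}^{n',k}`, whose first
  coordinate is `r_{n',k} / r_{n,l}` -/
  y : ℕ → ℕ → ℕ → ℕ → ℂ
  /-- `yp n l` is the second coordinate of the Fermat point `p_{n,l}`, whose first coordinate is
  `a_n κ_n r_{n,l} / b_n` -/
  yp : ℕ → ℕ → ℂ
  /-- `yt n l` is the second coordinate of the Fermat point `p̃_{n,l}`, whose first coordinate is
  `d_n / (κ_n c_n r_{n,l})` -/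
  yt : ℕ → ℕ → ℂ

/-! ### The quantum chain -/

/-- The Weyl element `u_k`: `u_k |γ⟩ = ω ^ γ_k |γ⟩`. -/
def weylU {N : ℕ} [NeZero N] {n : ℕ} (k : Fin n) :
    Matrix (Fin n → ZMod N) (Fin n → ZMod N) ℂ :=
  Matrix.diagonal fun γ => phase (γ k)

/-- The Weyl element `v_k`: `v_k |γ⟩ = |γ + e_k⟩`. -/
def weylV {N : ℕ} [NeZero N] {n : ℕ} (k : Fin n) :
    Matrix (Fin n → ZMod N) (Fin n → ZMod N) ℂ :=
  Matrix.of fun γ' γ => if γ' = γ + Pi.single k 1 then 1 else 0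

namespace Data

variable (D : Data)

/-- The `L`-operator of the site number `k + 1` in a chain of `n` sites. -/
def lOp (N : ℕ) [NeZero N] {n : ℕ} (k : Fin n) (lam : ℂ) :
    Matrix (Fin 2) (Fin 2) (Matrix (Fin n → ZMod N) (Fin n → ZMod N) ℂ) :=
  let s : ℕ := k + 1
  !![1 + (lam * D.κ s) • weylV k,
      lam • ((weylU k)⁻¹ * (D.a s • (1 : Matrix _ _ ℂ) - D.b s • weylV k));
    weylU k * (D.c s • (1 : Matrix _ _ ℂ) - D.d s • weylV k),
      (lam * D.a s * D.c s) • (1 : Matrix _ _ ℂ) + (D.b s * D.d s / D.κ s) • weylV k]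

/-- The monodromy matrix `T_n(λ) = L_1(λ) ⋯ L_n(λ)`. -/
def monodromy (N : ℕ) [NeZero N] (n : ℕ) (lam : ℂ) :
    Matrix (Fin 2) (Fin 2) (Matrix (Fin n → ZMod N) (Fin n → ZMod N) ℂ) :=
  (List.ofFn fun k : Fin n => D.lOp N k lam).prod

/-- The operator `B_n(λ)`, the upper right entry of the monodromy matrix. -/
def bOp (N : ℕ) [NeZero N] (n : ℕ) (lam : ℂ) : Matrix (Fin n → ZMod N) (Fin n → ZMod N) ℂ :=
  D.monodromy N n lam 0 1

/-! ### The averaged chain, which determines the amplitudes -/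

/-- The averaged `L`-operator of the site `k`, a polynomial in `Λ = λ ^ N`; its entries are the
averages of the entries of the `L`-operator (replace `λ` by `ω ^ s λ` and multiply over
`s ∈ ℤ/N`). -/
def avgL (N k : ℕ) : Matrix (Fin 2) (Fin 2) ℂ[X] :=
  let ε : ℂ := (-1) ^ N
  !![1 - Polynomial.C (ε * D.κ k ^ N) * Polynomial.X,
      -(Polynomial.C (ε * (D.a k ^ N - D.b k ^ N)) * Polynomial.X);
    Polynomial.C (D.c k ^ N - D.d k ^ N),
      Polynomial.C ((D.b k * D.d k / D.κ k) ^ N)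
        - Polynomial.C (ε * (D.a k * D.c k) ^ N) * Polynomial.X]

/-- The averaged monodromy matrix of the first `n` sites. -/
def avgMonodromy (N : ℕ) : ℕ → Matrix (Fin 2) (Fin 2) ℂ[X]
  | 0 => 1
  | n + 1 => avgMonodromy N n * D.avgL N (n + 1)

/-- `r̃_n = r_{n,0} r_{n,1} ⋯ r_{n,n-1}`. -/
def Rt (n : ℕ) : ℂ := ∏ k ∈ Finset.range n, D.R n k

/-! ### Coordinates of the Fermat points -/

/-- `x_k = r_k / a_k` -/
def x1 (k : ℕ) : ℂ := D.r k / D.a k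

/-- `y_k = b_k / a_k` -/
def y1 (k : ℕ) : ℂ := D.b k / D.a k

/-- `x_{n,0}`, first coordinate of `p_{n,0}` -/
def x0 (n : ℕ) : ℂ := D.R (n - 1) 0 * D.a n * D.c n / D.R n 0

/-- `y_{n,0}`, second coordinate of `p_{n,0}` -/
def y0 (n : ℕ) : ℂ := (∏ s ∈ Finset.Ico 1 n, D.κ s) * D.r n / D.R n 0

/-- `x̃_n`, first coordinate of `p̃_n` -/
def xt1 (n : ℕ) : ℂ := D.r n / D.Rt n

/-- `ỹ_n`, second coordinate of `p̃_n` -/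
def yt1 (n : ℕ) : ℂ := D.b n * D.d n * D.Rt (n - 1) / (D.κ n * D.Rt n)

/-- `x_{n,l}`, first coordinate of `p_{n,l}`, `l ≥ 1` -/
def xp (n l : ℕ) : ℂ := D.a n * D.κ n * D.R n l / D.b n

/-- `x̃_{n,l}`, first coordinate of `p̃_{n,l}`, `l ≥ 1` -/
def xt (n l : ℕ) : ℂ := D.d n / (D.κ n * D.c n * D.R n l)

/-- `w_{p_{n,l}^{n',k}}` -/
def wR {N : ℕ} [NeZero N] (n l n' k : ℕ) (γ : ZMod N) : ℂ :=
  cyc (D.R n' k / D.R n l) (D.y n l n' k) γ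

/-! ### Eigenvalues and eigenvectors of `B_n(λ)` -/

/-- `λ_{n,k} = - r_{n,k} ω ^ (-ρ_{n,k})`; for `k ≥ 1` these are the nontrivial zeros of the
eigenvalue polynomial of `B_n(λ)`. -/
def zeroB {N : ℕ} [NeZero N] {n : ℕ} (ρ : Fin n → ZMod N) (k : Fin n) : ℂ :=
  -(D.R n k * phase (-ρ k))

/-- The eigenvalue `λ r_{n,0} ω ^ (-ρ_{n,0}) ∏_{k=1}^{n-1} (λ + r_{n,k} ω ^ (-ρ_{n,k}))`. -/
def eigB {N : ℕ} [NeZero N] {n : ℕ} [NeZero n] (ρ : Fin n → ZMod N) (lam : ℂ) : ℂ :=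
  lam * D.R n 0 * phase (-ρ 0) *
    ∏ k ∈ Finset.univ.erase (0 : Fin n), (lam + D.R n k * phase (-ρ k))

/-- Components `⟨γ|ψ_ρ⟩` of the right one-site vector at the site `k`. -/
def psiR {N : ℕ} [NeZero N] (k : ℕ) (ρ γ : ZMod N) : ℂ := cyc (D.x1 k) (D.y1 k) (γ - ρ)

/-- Components `⟨ψ_ρ|γ⟩` of the left one-site vector at the site `k`. -/
def psiL {N : ℕ} [NeZero N] (k : ℕ) (ρ γ : ZMod N) : ℂ :=
  1 / cyc (D.x1 k) (D.b k / (phase (1 : ZMod N) * D.a k)) (γ - ρ - 1)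

/-- The kernel `Q^R(σ, q | ρ)` of the step from `n - 1 = m + 1` to `n = m + 2` sites, where
`σ = ρ_{n-1}`, `q = ρ_n` and `ρ = ρ_{n}` (the vector). An index `l : Fin m` stands for the number
`l + 1 ∈ {1, …, n-2}`, an index `k : Fin (m + 1)` for `k + 1 ∈ {1, …, n-1}`. -/
def QR {N : ℕ} [NeZero N] {m : ℕ} (σ : Fin (m + 1) → ZMod N) (q : ZMod N)
    (ρ : Fin (m + 2) → ZMod N) : ℂ :=
  phase ((∑ k, ρ k - ∑ k, σ k) * (q - ρ 0))
    / (cyc (D.x0 (m + 2)) (D.y0 (m + 2)) (ρ 0 - σ 0 - 1)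
        * cyc (D.xt1 (m + 2)) (D.yt1 (m + 2)) (∑ k, ρ k - q - 1))
  * ((∏ l : Fin m, ∏ k : Fin (m + 1), D.wR (m + 1) (l + 1) (m + 2) (k + 1) (σ l.succ - ρ k.succ))
    / ∏ j : Fin m, ∏ l ∈ Finset.univ.erase j,
        D.wR (m + 1) (j + 1) (m + 1) (l + 1) (σ j.succ - σ l.succ))
  * ∏ l : Fin m,
      cyc (D.xp (m + 1) (l + 1)) (D.yp (m + 1) (l + 1)) (-σ l.succ)
        / cyc (D.xt (m + 1) (l + 1)) (D.yt (m + 1) (l + 1)) (σ l.succ)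

/-- The kernel `Q^L(σ, q | ρ)`, with the same conventions as for `QR`. -/
def QL {N : ℕ} [NeZero N] {m : ℕ} (σ : Fin (m + 1) → ZMod N) (q : ZMod N)
    (ρ : Fin (m + 2) → ZMod N) : ℂ :=
  phase (-((∑ k, ρ k - ∑ k, σ k) * (q - ρ 0)) + ∑ k, σ k - σ 0)
  * (∏ j : Fin m, ∏ l ∈ Finset.univ.erase j,
        D.wR (m + 1) (j + 1) (m + 1) (l + 1) (σ j.succ - σ l.succ - 1))
  * ((cyc (D.x0 (m + 2)) (D.y0 (m + 2)) (ρ 0 - σ 0)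
        * cyc (D.xt1 (m + 2)) (D.yt1 (m + 2)) (∑ k, ρ k - q))
    / ∏ l : Fin m, ∏ k : Fin (m + 1),
        D.wR (m + 1) (l + 1) (m + 2) (k + 1) (σ l.succ - ρ k.succ - 1))
  * ∏ l : Fin m,
      cyc (D.xt (m + 1) (l + 1)) (D.yt (m + 1) (l + 1)) (σ l.succ)
        / cyc (D.xp (m + 1) (l + 1)) (D.yp (m + 1) (l + 1)) (-σ l.succ)

/-- Components `⟨γ|Ψ_ρ⟩` of the right vector `|Ψ_ρ⟩` of the chain of `n` sites. -/
def ket {N : ℕ} [NeZero N] : (n : ℕ) → (Fin n → ZMod N) → (Fin n → ZMod N) → ℂ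
  | 0 => fun _ _ => 1
  | 1 => fun ρ γ => D.psiR 1 (ρ 0) (γ 0)
  | m + 2 => fun ρ γ => ∑ σ : Fin (m + 1) → ZMod N, ∑ q : ZMod N,
      D.QR σ q ρ * (ket (m + 1) σ (Fin.init γ) * D.psiR (m + 2) q (γ (Fin.last (m + 1))))

/-- Components `⟨Ψ_ρ|γ⟩` of the left vector `⟨Ψ_ρ|` of the chain of `n` sites. -/
def bra {N : ℕ} [NeZero N] : (n : ℕ) → (Fin n → ZMod N) → (Fin n → ZMod N) → ℂ
  | 0 => fun _ _ => 1
  | 1 => fun ρ γ => D.psiL 1 (ρ 0) (γ 0)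
  | m + 2 => fun ρ γ => ∑ σ : Fin (m + 1) → ZMod N, ∑ q : ZMod N,
      D.QL σ q ρ * (bra (m + 1) σ (Fin.init γ) * D.psiL (m + 2) q (γ (Fin.last (m + 1))))

/-- The left-right overlap `⟨Ψ_ρ|Ψ_ρ⟩`, for the natural pairing `⟨γ'|γ⟩ = δ_{γ',γ}`. -/
def overlap {N : ℕ} [NeZero N] (n : ℕ) (ρ : Fin n → ZMod N) : ℂ := D.bra n ρ ⬝ᵥ D.ket n ρ

/-! ### The normalizing constants -/

/-- The factor `𝒩_n`. -/
def calN (N : ℕ) [NeZero N] (n : ℕ) : ℂ :=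
  (N : ℂ) ^ 3 / phase (1 : ZMod N)
    * (D.x1 n / (D.y1 n * D.y0 n * D.yt1 n)) ^ (N - 1)
    * ∏ l ∈ Finset.Icc 1 (n - 2),
        (∏ k ∈ Finset.Icc 1 (n - 1), D.y (n - 1) l n k)
          / ∏ j ∈ (Finset.Icc 1 (n - 2)).erase l, D.y (n - 1) l (n - 1) j

/-- The constants `C_n`: explicit values for `n = 1, 2`, and a recursion for `n = m + 3 ≥ 3`. -/
def constC (N : ℕ) [NeZero N] : ℕ → ℂ
  | 0 => 1
  | 1 => (N : ℂ) / phase (1 : ZMod N) * (D.x1 1 / D.y1 1) ^ (N - 1)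
  | 2 => (N : ℂ) / phase (1 : ZMod N) * (D.x1 1 / D.y1 1) ^ (N - 1)
      * ((N : ℂ) ^ 3 / phase (1 : ZMod N)
          * (D.x1 2 / (D.y1 2 * D.yt1 2 * D.y0 2)) ^ (N - 1))
  | m + 3 => constC N (m + 2) * D.calN N (m + 3) * (N : ℂ) ^ (m + 1)
      * ((∏ k ∈ Finset.Icc 1 (m + 2), ∏ k' ∈ Finset.Ioc k (m + 2),
              (D.R (m + 3) k' ^ N - D.R (m + 3) k ^ N))
          * (∏ l ∈ Finset.Icc 1 (m + 1), ∏ l' ∈ Finset.Ioc l (m + 1),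
              (D.R (m + 2) l ^ N - D.R (m + 2) l' ^ N))
        / ∏ k ∈ Finset.Icc 1 (m + 2), ∏ l ∈ Finset.Icc 1 (m + 1),
              (D.R (m + 3) k ^ N - D.R (m + 2) l ^ N))
      * ∏ l ∈ Finset.Icc 1 (m + 1), D.R (m + 2) l ^ (N + 1)

/-- The equations and genericity conditions on the parameters and on the chosen roots, for a chain
of `n` sites. -/
structure Admissible (N : ℕ) [NeZero N] (n : ℕ) : Prop where
  /-- the parameters are nonzero -/
  param_ne : ∀ k, 1 ≤ k → k ≤ n → D.a k ≠ 0 ∧ D.b k ≠ 0 ∧ D.c k ≠ 0 ∧ D.d k ≠ 0 ∧ D.κ k ≠ 0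
  /-- `r_k` is a nonzero root of `r_k ^ N = a_k ^ N - b_k ^ N` -/
  r_pow : ∀ k, 1 ≤ k → k ≤ n → D.r k ^ N = D.a k ^ N - D.b k ^ N ∧ D.r k ≠ 0
  R_one : D.R 1 0 = D.r 1
  /-- the numbers `r_{m,k} ^ N` come from the factorization of the averaged `B_m`, which is the
  product of the eigenvalue polynomial of `B_m` over all `ω ^ s λ`, `s ∈ ℤ/N` -/
  R_avg : ∀ m, 1 ≤ m → m ≤ n →
    D.avgMonodromy N m 0 1 =
      Polynomial.C (-((-1) ^ N * D.R m 0 ^ N)) * Polynomial.X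
        * ∏ k ∈ Finset.Ico 1 m,
            (Polynomial.C (D.R m k ^ N) - Polynomial.C ((-1) ^ N) * Polynomial.X)
  /-- all eigenvalues of `B_m(λ)` (as functions of `λ`) are different -/
  distinct : ∀ m, m + 1 ≤ n →
    Function.Injective fun (ρ : Fin (m + 1) → ZMod N) (lam : ℂ) => D.eigB ρ lam
  /-- `p_{m,l}^{m+1,k}` is a Fermat point -/
  fermat_up : ∀ m l k, m < n → 1 ≤ l → l < m → 1 ≤ k → k ≤ m →
    IsFermat N (D.R (m + 1) k / D.R m l) (D.y m l (m + 1) k)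
  /-- `p_{m,l}^{m,j}` is a Fermat point -/
  fermat_same : ∀ m l j, m < n → 1 ≤ l → l < m → 1 ≤ j → j < m → l ≠ j →
    IsFermat N (D.R m j / D.R m l) (D.y m l m j)
  /-- `p_{m,l}` and `p̃_{m,l}` are Fermat points -/
  fermat_p : ∀ m l, m < n → 1 ≤ l → l < m →
    IsFermat N (D.xp m l) (D.yp m l) ∧ IsFermat N (D.xt m l) (D.yt m l)
  /-- The `N`-th powers of the second coordinates being determined by the Fermat curve, this
  relation correlates the choices of their phases; it can be met for every choice of the other
  phases by the choice of the phase of `y_{m,l}^{m+1,m}`. -/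
  phases : ∀ m l, m < n → 1 ≤ l → l < m →
    D.r (m + 1) * D.Rt (m - 1) * D.R m 0 * D.b m * D.c m * D.yp m l * D.yt m l
        * (∏ s ∈ Finset.Ico 1 (m - 1), D.y (m - 1) s m l)
        * (∏ j ∈ (Finset.Ico 1 m).erase l, D.y m l m j / D.y m j m l)
      = D.r m * D.R (m + 1) 0 * D.Rt m * ∏ k ∈ Finset.Icc 1 m, D.y m l (m + 1) k

end Data

end

end BBS

namespace BBS

noncomputable section

/-! ### Interpolation of polynomials in λ, and tensor products with one more site. -/

section

/-! The operator $B_n$ is diagonalized by adding one site at a time. With $X=u^{-1}(a-bv)$,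
$Y=u(c-dv)$, $\alpha=ac$, $\beta=bd/\varkappa$ at the new site, the longer chain has
$A'=A\otimes(1+\lambda\varkappa v)+B\otimes Y$ and $B'=A\otimes\lambda
X+B\otimes(\lambda\alpha+\beta v)$, and the one-site vectors $\psi_q$ are eigenvectors of $X$. The
induction carries more than the eigenvectors $\Psi_\sigma$ of $B$ (`ShiftFamily`): $v_1\cdots v_m$
raises $\sigma_0$, and $A$, evaluated at the zero of the eigenvalue that belongs to $\sigma_l$,
raises $\sigma_l$ up to a factor. As $A(\lambda)$ is a polynomial with known extreme coefficients,
interpolation at these zeros determines $A(\lambda)\Psi_\sigma$ for all $\lambda$. Hence $\sum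
Q\,\Psi_\sigma\otimes\psi_q$ is an eigenvector of $B'$ once $Q$ solves scalar difference equations
(`IsKernel`, `ShiftFamily.kernel_eigen`). At a zero of the new eigenvalue the vanishing of $B'$
eliminates $A$ in favour of $B$; what remains of $A'$ is the quantum determinant `quad` times a
shift, so that the induction closes (`ShiftFamily.step`).

Products of cyclic functions solve the difference equations (`isKernel_kern`): each equation is the
two-term recursion of some of the factors. The Fermat equations for $p_{m,0}$ and $\tilde p_m$ come
from the extreme coefficients of the averaged $B$; the points $p_{m,l}$, $\tilde p_{m,l}$ match the
two linear factors of the quantum determinant, and the phase condition is the remaining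
compatibility of constants. Transposing the operators, inverting the character and changing the
signs of all indices gives the left vectors by the same argument; `Frame` treats both at once.

For the overlap, distinct eigenvalues make left and right vectors orthogonal, so the overlap for $n$
sites is a single sum of $Q^LQ^R$ times overlaps for $n-1$ sites (`overlap_step`). In $Q^LQ^R$ the
cyclic functions of differences occur only in quotients $w(\gamma)/w(\gamma-1)$, which are rational
in roots of unity (`QL_mul_QR`). The sums over $\sigma_0$ and $q$ are geometric. In the others, one
Vandermonde product is cancelled by the previous overlap, and the summand becomes a Cauchy
determinant (`summand_eq`). Expanding it over permutations separates the variables; every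
one-variable sum replaces its arguments by their $N$-th powers, and Cauchy's formula sums up the
result (`sum_prod_div_prod`). -/

theorem prod_erase_zero {m : ℕ} (f : Fin (m + 1) → ℂ) :
    ∏ k ∈ Finset.univ.erase (0 : Fin (m + 1)), f k = ∏ l : Fin m, f l.succ := by
  have : Finset.univ.erase (0 : Fin (m + 1)) = Finset.univ.map (Fin.succEmb m) := by
    ext k; simp [Fin.exists_succ_eq]
  rw [this, Finset.prod_map]; rfl

theorem prod_erase_succ {m : ℕ} (f : Fin (m + 1) → ℂ) (l : Fin m) :
    ∏ k ∈ Finset.univ.erase l.succ, f k = f 0 * ∏ j ∈ Finset.univ.erase l, f j.succ := by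
  have : Finset.univ.erase l.succ
      = insert 0 ((Finset.univ.erase l).map (Fin.succEmb m)) := by
    ext k
    refine Fin.cases ?_ (fun j => ?_) k
    · simp [(Fin.succ_ne_zero l).symm]
    · simp
  rw [this, Finset.prod_insert (by simp), Finset.prod_map]; rfl

/-- The Lagrange basis function at the node `x l`, for the nodes `x` together with `0`. -/
def lagr {m : ℕ} (x : Fin m → ℂ) (l : Fin m) (lam : ℂ) : ℂ :=
  lam / x l * ∏ j ∈ Finset.univ.erase l, (lam - x j) / (x l - x j)

/-- A polynomial of degree at most `m + 1` from its extreme coefficients and its values at `m`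
nonzero nodes. -/
theorem eval_eq_interpolation {m : ℕ} (P : ℂ[X]) (hP : P.natDegree ≤ m + 1) (x : Fin m → ℂ)
    (hx0 : ∀ l, x l ≠ 0) (hx : Function.Injective x) (lam : ℂ) :
    P.eval lam = P.coeff 0 * ∏ l, ((lam - x l) / (0 - x l))
      + P.coeff (m + 1) * (lam * ∏ l, (lam - x l)) + ∑ l, P.eval (x l) * lagr x l lam := by
  set M : ℂ[X] := ∏ l, (Polynomial.X - Polynomial.C (x l)) with hM
  have hMm : M.Monic := Polynomial.monic_prod_X_sub_C _ _
  have hMd : M.natDegree = m := by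
    rw [hM, Polynomial.natDegree_finsetProd_X_sub_C_eq_card]; simp
  -- The product `X * M` is monic of degree `m + 1` and vanishes at `0` and at all `x l`.
  -- Subtracting it removes the top coefficient and keeps the values at these `m + 1` nodes, so that
  -- Lagrange interpolation becomes exact.
  set P' : ℂ[X] := P - Polynomial.C (P.coeff (m + 1)) * (Polynomial.X * M) with hP'
  have hdeg : P'.degree < (m + 1 : ℕ) := by
    rw [Polynomial.degree_lt_iff_coeff_zero]
    intro k hk
    rcases hk.eq_or_lt with rfl | hk
    · have : M.coeff m = 1 := by rw [← hMd]; exact hMm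
      simp [hP', this]
    · obtain ⟨k, rfl⟩ : ∃ j, k = j + 1 := ⟨k - 1, by omega⟩
      rw [hP', Polynomial.coeff_sub, Polynomial.coeff_C_mul, Polynomial.coeff_X_mul,
        Polynomial.coeff_eq_zero_of_natDegree_lt (hP.trans_lt hk),
        Polynomial.coeff_eq_zero_of_natDegree_lt (hMd.trans_lt (Nat.lt_of_succ_lt_succ hk))]
      ring
  have hinj : Function.Injective (Fin.cons 0 x : Fin (m + 1) → ℂ) :=
    Fin.cons_injective_iff.2 ⟨fun ⟨l, hl⟩ => hx0 l hl, hx⟩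
  have key := congrArg (Polynomial.eval lam) (Lagrange.eq_interpolate
    (s := (Finset.univ : Finset (Fin (m + 1)))) (v := Fin.cons 0 x) hinj.injOn (f := P')
    (by simpa using hdeg))
  have hMe : ∀ t, M.eval t = ∏ l, (t - x l) := by
    intro t; simp [hM, Polynomial.eval_prod]
  have hMx : ∀ l, M.eval (x l) = 0 := fun l => by
    rw [hMe]; exact Finset.prod_eq_zero (Finset.mem_univ l) (sub_self _)
  rw [Lagrange.interpolate_apply, Polynomial.eval_finsetSum, Fin.sum_univ_succ] at key
  simp only [Lagrange.basis, Polynomial.eval_mul, Polynomial.eval_C, Polynomial.eval_prod,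
    Lagrange.basisDivisor, Polynomial.eval_sub, Polynomial.eval_X, Fin.cons_zero,
    Fin.cons_succ, prod_erase_zero, prod_erase_succ, hP', hMx, hMe, mul_zero, sub_zero,
    zero_mul] at key
  rw [sub_eq_iff_eq_add] at key
  rw [key, Polynomial.coeff_zero_eq_eval_zero]
  simp only [lagr, div_eq_mul_inv]
  have e1 : ∀ i, (0 - x i)⁻¹ * (lam - x i) = (lam - x i) * (0 - x i)⁻¹ := fun i => mul_comm _ _
  have e2 : ∀ i j, (x i - x j)⁻¹ * (lam - x j) = (lam - x j) * (x i - x j)⁻¹ :=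
    fun i j => mul_comm _ _
  simp only [e1, e2, mul_comm _ lam]
  ring

/-- Entrywise polynomial dependence on `lam`, of degree at most `n`, with given extreme
coefficients. -/
def PolyDep {ι : Type*} (n : ℕ) (A : ℂ → Matrix ι ι ℂ) (A₀ A₁ : Matrix ι ι ℂ) : Prop :=
  ∀ i j, ∃ P : ℂ[X], P.natDegree ≤ n ∧ P.coeff 0 = A₀ i j ∧ P.coeff n = A₁ i j ∧
    ∀ lam, A lam i j = P.eval lam

theorem PolyDep.transpose {ι : Type*} {n : ℕ} {A : ℂ → Matrix ι ι ℂ} {A₀ A₁ : Matrix ι ι ℂ}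
    (h : PolyDep n A A₀ A₁) : PolyDep n (fun lam => (A lam)ᵀ) A₀ᵀ A₁ᵀ := fun i j => h j i

/-- With the zeros of the eigenvalue of `B` as nodes, every term on the right is known from
`ShiftFamily`: the identity, the operator `V`, and `A` at the zeros. -/
theorem PolyDep.mulVec {ι : Type*} [Fintype ι] {m : ℕ} {A : ℂ → Matrix ι ι ℂ}
    {A₀ A₁ : Matrix ι ι ℂ} (h : PolyDep (m + 1) A A₀ A₁) (f : ι → ℂ) (x : Fin m → ℂ)
    (hx0 : ∀ l, x l ≠ 0) (hx : Function.Injective x) (lam : ℂ) :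
    A lam *ᵥ f = (∏ l, ((lam - x l) / (0 - x l))) • (A₀ *ᵥ f)
      + (lam * ∏ l, (lam - x l)) • (A₁ *ᵥ f) + ∑ l, lagr x l lam • (A (x l) *ᵥ f) := by
  choose P hd h0 h1 hP using h
  ext i
  simp only [Pi.add_apply, Pi.smul_apply, Finset.sum_apply, Matrix.mulVec, dotProduct,
    smul_eq_mul, Finset.mul_sum]
  rw [Finset.sum_comm, ← Finset.sum_add_distrib, ← Finset.sum_add_distrib]
  refine Finset.sum_congr rfl fun j _ => ?_
  rw [hP, eval_eq_interpolation (P i j) (hd i j) x hx0 hx lam, h0, h1]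
  simp only [hP, add_mul, Finset.sum_mul]
  congr 1
  · ring
  · exact Finset.sum_congr rfl fun l _ => by ring

/-! ### Adding a site -/

/-- The operator `M ⊗ P` on a chain of `n + 1` sites. -/
def tens {N n : ℕ} (M : Matrix (Fin n → ZMod N) (Fin n → ZMod N) ℂ)
    (P : Matrix (ZMod N) (ZMod N) ℂ) :
    Matrix (Fin (n + 1) → ZMod N) (Fin (n + 1) → ZMod N) ℂ :=
  Matrix.of fun γ γ' => M (Fin.init γ) (Fin.init γ') * P (γ (Fin.last n)) (γ' (Fin.last n))

theorem sum_snoc {N n : ℕ} [NeZero N] {β : Type*} [AddCommMonoid β]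
    (F : (Fin (n + 1) → ZMod N) → β) :
    ∑ γ, F γ = ∑ γ₀ : Fin n → ZMod N, ∑ g : ZMod N, F (Fin.snoc γ₀ g : Fin (n + 1) → ZMod N) := by
  rw [← (Fin.snocEquiv fun _ : Fin (n + 1) => ZMod N).sum_comp, Fintype.sum_prod_type,
    Finset.sum_comm]
  rfl

theorem tens_transpose {N n : ℕ} (M : Matrix (Fin n → ZMod N) (Fin n → ZMod N) ℂ)
    (P : Matrix (ZMod N) (ZMod N) ℂ) : (tens M P)ᵀ = tens Mᵀ Pᵀ := rfl

theorem tens_mul {N n : ℕ} [NeZero N] (M M' : Matrix (Fin n → ZMod N) (Fin n → ZMod N) ℂ)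
    (P P' : Matrix (ZMod N) (ZMod N) ℂ) : tens M P * tens M' P' = tens (M * M') (P * P') := by
  ext γ γ'
  simp only [tens, Matrix.mul_apply, Matrix.of_apply, sum_snoc, Fin.init_snoc, Fin.snoc_last,
    Finset.sum_mul_sum]
  exact Finset.sum_congr rfl fun i _ => Finset.sum_congr rfl fun j _ => by ring

/-- The vector `f ⊗ g` on a chain of `n + 1` sites. -/
def tvec {N n : ℕ} (f : (Fin n → ZMod N) → ℂ) (g : ZMod N → ℂ) (γ : Fin (n + 1) → ZMod N) : ℂ :=
  f (Fin.init γ) * g (γ (Fin.last n))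

theorem tens_mulVec {N n : ℕ} [NeZero N] (M : Matrix (Fin n → ZMod N) (Fin n → ZMod N) ℂ)
    (P : Matrix (ZMod N) (ZMod N) ℂ) (f : (Fin n → ZMod N) → ℂ) (g : ZMod N → ℂ) :
    tens M P *ᵥ tvec f g = tvec (M *ᵥ f) (P *ᵥ g) := by
  ext γ
  simp only [tens, tvec, Matrix.mulVec, dotProduct, Matrix.of_apply, sum_snoc, Fin.init_snoc,
    Fin.snoc_last, Finset.sum_mul_sum]
  exact Finset.sum_congr rfl fun i _ => Finset.sum_congr rfl fun j _ => by ring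

theorem tvec_smul_left {N n : ℕ} (c : ℂ) (f : (Fin n → ZMod N) → ℂ) (g : ZMod N → ℂ) :
    tvec (c • f) g = c • tvec f g := by ext; simp [tvec, mul_assoc]

theorem tvec_smul_right {N n : ℕ} (c : ℂ) (f : (Fin n → ZMod N) → ℂ) (g : ZMod N → ℂ) :
    tvec f (c • g) = c • tvec f g := by ext; simp [tvec]; ring

theorem tvec_add_left {N n : ℕ} (f f' : (Fin n → ZMod N) → ℂ) (g : ZMod N → ℂ) :
    tvec (f + f') g = tvec f g + tvec f' g := by ext; simp [tvec, add_mul]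

theorem tvec_add_right {N n : ℕ} (f : (Fin n → ZMod N) → ℂ) (g g' : ZMod N → ℂ) :
    tvec f (g + g') = tvec f g + tvec f g' := by ext; simp [tvec, mul_add]

end

/-! ### The induction step for an abstract kernel. -/

section

variable {N : ℕ} [NeZero N] (χ : AddChar (ZMod N) ℂ)

/-- The numbers `R_l χ(-ρ_l)`, `l ≥ 1`, the negatives of the nontrivial zeros of the eigenvalue. -/
def zeta (R : ℕ → ℂ) {m : ℕ} (ρ : Fin (m + 1) → ZMod N) (l : Fin m) : ℂ :=
  R (l + 1) * χ (-ρ l.succ)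

/-- The eigenvalue polynomial for the character `χ`. -/
def eigv (R : ℕ → ℂ) {m : ℕ} (ρ : Fin (m + 1) → ZMod N) (lam : ℂ) : ℂ :=
  lam * (R 0 * χ (-ρ 0)) * ∏ l, (lam + zeta χ R ρ l)

/-- A family of eigenvectors of `B` on which `V` and the values of `A` at the zeros of the
eigenvalue act as shifts. -/
structure ShiftFamily {m : ℕ} (R : ℕ → ℂ)
    (A B : ℂ → Matrix (Fin (m + 1) → ZMod N) (Fin (m + 1) → ZMod N) ℂ)
    (V : Matrix (Fin (m + 1) → ZMod N) (Fin (m + 1) → ZMod N) ℂ)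
    (Ψ : (Fin (m + 1) → ZMod N) → (Fin (m + 1) → ZMod N) → ℂ)
    (φ : Fin m → (Fin (m + 1) → ZMod N) → ℂ) : Prop where
  eig : ∀ ρ lam, B lam *ᵥ Ψ ρ = eigv χ R ρ lam • Ψ ρ
  shiftV : ∀ ρ, V *ᵥ Ψ ρ = Ψ (ρ + Pi.single 0 1)
  shiftA : ∀ ρ l, A (-zeta χ R ρ l) *ᵥ Ψ ρ = φ l ρ • Ψ (ρ + Pi.single l.succ 1)

/-- The quantum determinant of the `L`-operator, up to a shift. -/
def quad (κ α β e f lam : ℂ) : ℂ := β + lam ^ 2 * κ * α / χ 1 + lam * (e / χ 1 + f)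

/-- The difference equations for the kernel of the step from `m + 1` to `m + 2` sites. -/
structure IsKernel {m : ℕ} (R R' : ℕ → ℂ) (r κ α β κh e f : ℂ)
    (φ : Fin m → (Fin (m + 1) → ZMod N) → ℂ) (φ' : Fin (m + 1) → (Fin (m + 2) → ZMod N) → ℂ)
    (Q : (Fin (m + 1) → ZMod N) → ZMod N → (Fin (m + 2) → ZMod N) → ℂ) : Prop where
  top : ∀ σ q ρ, r * χ (-q) * κh * Q σ q ρ
    = (R' 0 * χ (-ρ 0) - R 0 * χ (-(σ 0 + 1)) * α) * Q (σ + Pi.single 0 1) q ρ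
  bot : ∀ σ q ρ, (R' 0 * χ (-ρ 0) * ∏ k, zeta χ R' ρ k - r * χ (-q)) * Q σ q ρ
    = R 0 * χ (-σ 0) * (∏ l, zeta χ R σ l) * β * Q σ (q - 1) ρ
  mid : ∀ σ q ρ l lam, r * χ (-q) * φ l σ * Q σ q ρ * lagr (-zeta χ R σ) l lam
    = R' 0 * χ (-ρ 0) * (∏ k, (-zeta χ R (σ + Pi.single l.succ 1) l + zeta χ R' ρ k))
      * Q (σ + Pi.single l.succ 1) q ρ * lagr (-zeta χ R (σ + Pi.single l.succ 1)) l lam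
  shiftA : ∀ σ q ρ k, φ' k ρ * Q σ (q + 1) (ρ + Pi.single k.succ 1)
    = -(χ (q + 1) / r) * quad χ κ α β e f (-zeta χ R' ρ k) * (R 0 * χ (-σ 0))
      * (∏ l, (-zeta χ R' ρ k + zeta χ R σ l)) * Q σ q ρ
  shiftV : ∀ σ q ρ, Q (σ + Pi.single 0 1) (q + 1) (ρ + Pi.single 0 1) = Q σ q ρ

theorem sum_add_right {G β : Type*} [AddGroup G] [Fintype G] [AddCommMonoid β] (c : G)
    (F : G → β) : ∑ x, F (x + c) = ∑ x, F x :=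
  Fintype.sum_equiv (Equiv.addRight c) _ _ fun _ => rfl

/-- The vector obtained from the families `Ψ`, `ψ` and the kernel `Q`. -/
def stepVec {m : ℕ} (Q : (Fin (m + 1) → ZMod N) → ZMod N → (Fin (m + 2) → ZMod N) → ℂ)
    (Ψ : (Fin (m + 1) → ZMod N) → (Fin (m + 1) → ZMod N) → ℂ) (ψ : ZMod N → ZMod N → ℂ)
    (ρ : Fin (m + 2) → ZMod N) : (Fin (m + 2) → ZMod N) → ℂ :=
  ∑ q, tvec (∑ σ, Q σ q ρ • Ψ σ) (ψ q)

theorem tens_mulVec_stepVec {m : ℕ}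
    (Q : (Fin (m + 1) → ZMod N) → ZMod N → (Fin (m + 2) → ZMod N) → ℂ)
    (Ψ : (Fin (m + 1) → ZMod N) → (Fin (m + 1) → ZMod N) → ℂ) (ψ : ZMod N → ZMod N → ℂ)
    (ρ : Fin (m + 2) → ZMod N) (M : Matrix (Fin (m + 1) → ZMod N) (Fin (m + 1) → ZMod N) ℂ)
    (P : Matrix (ZMod N) (ZMod N) ℂ) :
    tens M P *ᵥ stepVec Q Ψ ψ ρ = ∑ q, tvec (∑ σ, Q σ q ρ • (M *ᵥ Ψ σ)) (P *ᵥ ψ q) := by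
  simp only [stepVec, Matrix.mulVec_sum, tens_mulVec, Matrix.mulVec_smul]

/-- This expands the new eigenvalue in the same basis as `A lam`, so the eigenvalue equation can be
compared basis function by basis function. -/
theorem prod_add_eq_interpolation {m : ℕ} (t : Fin (m + 1) → ℂ) (x : Fin m → ℂ)
    (hx0 : ∀ l, x l ≠ 0) (hx : Function.Injective x) (lam : ℂ) :
    ∏ k, (lam + t k) = (∏ k, t k) * ∏ l, ((lam - x l) / (0 - x l))
      + lam * ∏ l, (lam - x l) + ∑ l, (∏ k, (x l + t k)) * lagr x l lam := by
  set P : ℂ[X] := ∏ k, (Polynomial.X + Polynomial.C (t k)) with hP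
  have hm : P.Monic := Polynomial.monic_prod_of_monic _ _ fun k _ => Polynomial.monic_X_add_C _
  have hd : P.natDegree = m + 1 := by
    rw [hP, Polynomial.natDegree_prod_of_monic _ _ fun k _ => Polynomial.monic_X_add_C _]
    simp
  have h1 : P.coeff (m + 1) = 1 := by rw [← hd]; exact hm
  have he : ∀ s, P.eval s = ∏ k, (s + t k) := fun s => by simp [hP, Polynomial.eval_prod]
  have := eval_eq_interpolation P hd.le x hx0 hx lam
  simpa only [h1, he, Polynomial.coeff_zero_eq_eval_zero, zero_add, one_mul] using this

section Step

variable {χ} {m : ℕ} {R R' : ℕ → ℂ} {r κ α β κh e f : ℂ}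
  {A B : ℂ → Matrix (Fin (m + 1) → ZMod N) (Fin (m + 1) → ZMod N) ℂ}
  {V : Matrix (Fin (m + 1) → ZMod N) (Fin (m + 1) → ZMod N) ℂ}
  {Ψ : (Fin (m + 1) → ZMod N) → (Fin (m + 1) → ZMod N) → ℂ}
  {φ : Fin m → (Fin (m + 1) → ZMod N) → ℂ}
  {φ' : Fin (m + 1) → (Fin (m + 2) → ZMod N) → ℂ}
  {Q : (Fin (m + 1) → ZMod N) → ZMod N → (Fin (m + 2) → ZMod N) → ℂ}

/-- This is the component along `ψ q` of the eigenvalue equation for the new `B`. After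
interpolation, `top` compares the leading coefficients, `bot` the values of the quotient by `lam` at
zero, and `mid` its values at the nodes. -/
theorem ShiftFamily.kernel_eigen (h : ShiftFamily χ R A B V Ψ φ)
    (hA : PolyDep (m + 1) A 1 (κh • V)) (hz0 : ∀ σ l, zeta χ R (m := m) σ l ≠ 0)
    (hz : ∀ σ, Function.Injective (zeta χ R (m := m) σ))
    (hQ : IsKernel χ R R' r κ α β κh e f φ φ' Q) (ρ : Fin (m + 2) → ZMod N) (q : ZMod N)
    (lam : ℂ) :
    (lam * (r * χ (-q))) • (∑ σ, Q σ q ρ • (A lam *ᵥ Ψ σ))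
      + (lam * α) • (∑ σ, Q σ q ρ • (B lam *ᵥ Ψ σ)) + β • (∑ σ, Q σ (q - 1) ρ • (B lam *ᵥ Ψ σ))
      = eigv χ R' ρ lam • ∑ σ, Q σ q ρ • Ψ σ := by
  have hx0 : ∀ σ l, (-zeta χ R (m := m) σ) l ≠ 0 := fun σ l => neg_ne_zero.2 (hz0 σ l)
  have hx : ∀ σ, Function.Injective (-zeta χ R (m := m) σ) := fun σ i j hij =>
    hz σ (neg_injective hij)
  ext γ
  simp only [Pi.add_apply, Pi.smul_apply, Finset.sum_apply, smul_eq_mul, h.eig]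
  -- Here `A` moves `Ψ σ` to `Ψ (σ + e_0)` and `Ψ (σ + e_l)`. The right sides of `top` and `mid`
  -- carry `Q` at the shifted argument, so translating `σ` collects the coefficient of each `Ψ σ`.
  have hF : (r * χ (-q)) * ∑ σ, Q σ q ρ * (A lam *ᵥ Ψ σ) γ
      = ∑ σ, (r * χ (-q) * (∏ l, ((lam - (-zeta χ R σ) l) / (0 - (-zeta χ R σ) l)))
        + (R' 0 * χ (-ρ 0) - R 0 * χ (-σ 0) * α) * (lam * ∏ l, (lam - (-zeta χ R σ) l))
        + ∑ l, R' 0 * χ (-ρ 0) * (∏ k, ((-zeta χ R σ) l + zeta χ R' ρ k))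
            * lagr (-zeta χ R σ) l lam) * (Q σ q ρ * Ψ σ γ) := by
    have e1 : ∀ σ, (r * χ (-q)) * (Q σ q ρ * (A lam *ᵥ Ψ σ) γ)
        = r * χ (-q) * (∏ l, ((lam - (-zeta χ R σ) l) / (0 - (-zeta χ R σ) l)))
            * (Q σ q ρ * Ψ σ γ)
        + r * χ (-q) * κh * Q σ q ρ * (lam * ∏ l, (lam - (-zeta χ R σ) l))
            * Ψ (σ + Pi.single 0 1) γ
        + ∑ l, r * χ (-q) * φ l σ * Q σ q ρ * lagr (-zeta χ R σ) l lam
            * Ψ (σ + Pi.single l.succ 1) γ := by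
      intro σ
      rw [hA.mulVec (Ψ σ) (-zeta χ R σ) (hx0 σ) (hx σ) lam]
      simp only [Matrix.one_mulVec, Matrix.smul_mulVec, h.shiftV, Pi.add_apply, Pi.smul_apply,
        Finset.sum_apply, smul_eq_mul, Pi.neg_apply, h.shiftA]
      rw [mul_add, mul_add, mul_add, mul_add, Finset.mul_sum, Finset.mul_sum]
      congr 1
      · ring
      · exact Finset.sum_congr rfl fun l _ => by ring
    rw [Finset.mul_sum, Finset.sum_congr rfl fun σ _ => e1 σ]
    simp only [hQ.top, hQ.mid, Finset.sum_add_distrib, add_mul]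
    congr 1
    · congr 1
      refine Eq.trans ?_ (sum_add_right (Pi.single 0 1 : Fin (m + 1) → ZMod N) _)
      refine Finset.sum_congr rfl fun σ _ => ?_
      have : zeta χ R (σ + Pi.single 0 1) = zeta χ R σ := by
        ext l; simp [zeta]
      simp only [this, Pi.add_apply, Pi.single_eq_same]
      ring
    · rw [Finset.sum_comm]
      simp only [Finset.sum_mul]
      rw [Finset.sum_comm (s := Finset.univ (α := Fin (m + 1) → ZMod N))]
      refine Finset.sum_congr rfl fun l _ => ?_
      refine Eq.trans ?_ (sum_add_right (Pi.single l.succ 1 : Fin (m + 1) → ZMod N) _)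
      refine Finset.sum_congr rfl fun σ _ => ?_
      simp only [Pi.neg_apply]
      ring
  rw [mul_assoc, hF]
  simp only [Finset.mul_sum, ← Finset.sum_add_distrib]
  refine Finset.sum_congr rfl fun σ _ => ?_
  have hprod := prod_add_eq_interpolation (zeta χ R' ρ) (-zeta χ R σ) (hx0 σ) (hx σ) lam
  -- The node polynomial is the product of the `zeta` times the basis function at zero; this brings
  -- the `β` term into the form in which `bot` applies.
  have hw : (∏ l, zeta χ R σ l) * ∏ l, ((lam - (-zeta χ R σ) l) / (0 - (-zeta χ R σ) l))
      = ∏ l, (lam - (-zeta χ R σ) l) := by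
    rw [← Finset.prod_mul_distrib]
    refine Finset.prod_congr rfl fun l _ => ?_
    have := hz0 σ l
    simp only [Pi.neg_apply, zero_sub, neg_neg]
    field_simp
  have hb := hQ.bot σ q ρ
  have hs : ∑ l, R' 0 * χ (-ρ 0) * (∏ k, ((-zeta χ R σ) l + zeta χ R' ρ k))
      * lagr (-zeta χ R σ) l lam = R' 0 * χ (-ρ 0) *
      ∑ l, (∏ k, ((-zeta χ R σ) l + zeta χ R' ρ k)) * lagr (-zeta χ R σ) l lam := by
    rw [Finset.mul_sum]; exact Finset.sum_congr rfl fun l _ => by ring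
  have hu : ∏ l, (lam + zeta χ R σ l) = ∏ l, (lam - (-zeta χ R σ) l) := by simp
  simp only [eigv]
  rw [hs, hprod, hu]
  set w0 := ∏ l, ((lam - (-zeta χ R σ) l) / (0 - (-zeta χ R σ) l))
  set w1 := ∏ l, (lam - (-zeta χ R σ) l)
  linear_combination lam * w0 * Ψ σ γ * (-hb) - lam * (R 0 * χ (-σ 0)) * β * Q σ (q - 1) ρ
    * Ψ σ γ * hw

/-- The eigenvalue property is `kernel_eigen`, and `shiftV` is the invariance of `Q` under a common
translation. For `shiftA`, the vanishing of the new eigenvalue at `lam` expresses the `A` component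
through `B` components, and the surviving coefficient is the quantum determinant. -/
theorem ShiftFamily.step (h : ShiftFamily χ R A B V Ψ φ)
    (hA : PolyDep (m + 1) A 1 (κh • V)) (hz0 : ∀ σ l, zeta χ R (m := m) σ l ≠ 0)
    (hz : ∀ σ, Function.Injective (zeta χ R (m := m) σ))
    (hz0' : ∀ ρ k, zeta χ R' (m := m + 1) ρ k ≠ 0) (hr : r ≠ 0)
    (hQ : IsKernel χ R R' r κ α β κh e f φ φ' Q)
    {v X Y : Matrix (ZMod N) (ZMod N) ℂ} {ψ : ZMod N → ZMod N → ℂ}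
    (hv : ∀ q, v *ᵥ ψ q = ψ (q + 1)) (hX : ∀ q, X *ᵥ ψ q = (r * χ (-q)) • ψ q)
    (hY : ∀ q, Y *ᵥ ψ q = (χ q / r) • (α • ψ q - (e + χ 1 * f) • ψ (q + 1)
      + (χ 1 * (β * κ)) • ψ (q + 2))) :
    ShiftFamily χ R' (fun lam => tens (A lam) (1 + (lam * κ) • v) + tens (B lam) Y)
      (fun lam => tens (A lam) (lam • X) + tens (B lam) ((lam * α) • (1 : Matrix _ _ ℂ) + β • v))
      (tens V v) (stepVec Q Ψ ψ) φ' := by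
  have hK := h.kernel_eigen hA hz0 hz hQ
  constructor
  · intro ρ lam
    rw [Matrix.add_mulVec, tens_mulVec_stepVec, tens_mulVec_stepVec]
    simp only [Matrix.add_mulVec, Matrix.smul_mulVec, Matrix.one_mulVec, hv, hX]
    simp only [tvec_add_right, tvec_smul_right, Finset.sum_add_distrib]
    have : ∑ q, β • tvec (∑ σ, Q σ q ρ • (B lam *ᵥ Ψ σ)) (ψ (q + 1))
        = ∑ q, β • tvec (∑ σ, Q σ (q - 1) ρ • (B lam *ᵥ Ψ σ)) (ψ q) := by
      refine Eq.trans ?_ (sum_add_right (1 : ZMod N) _)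
      simp
    rw [this, stepVec, Finset.smul_sum, ← Finset.sum_add_distrib, ← Finset.sum_add_distrib]
    refine Finset.sum_congr rfl fun q _ => ?_
    rw [← tvec_smul_left (eigv χ R' ρ lam), ← hK ρ q lam]
    simp only [tvec_add_left, tvec_smul_left, smul_smul, add_assoc]
  · intro ρ
    rw [tens_mulVec_stepVec, stepVec]
    refine Eq.trans ?_ (sum_add_right (1 : ZMod N) _)
    refine Finset.sum_congr rfl fun q _ => ?_
    simp only [hv, h.shiftV]
    congr 1
    refine Eq.trans ?_ (sum_add_right (Pi.single 0 1 : Fin (m + 1) → ZMod N) _)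
    simp only [hQ.shiftV]
  · intro ρ k
    set lam := -zeta χ R' ρ k with hlam
    have hlam0 : lam ≠ 0 := neg_ne_zero.2 (hz0' ρ k)
    have hχ : ∀ a, χ a ≠ 0 := fun a => (χ.val_isUnit a).ne_zero
    have hev : eigv χ R' ρ lam = 0 := by
      rw [eigv, Finset.prod_eq_zero (Finset.mem_univ k), mul_zero]
      simp [hlam]
    rw [Matrix.add_mulVec, tens_mulVec_stepVec, tens_mulVec_stepVec]
    simp only [Matrix.add_mulVec, Matrix.smul_mulVec, Matrix.one_mulVec, hv, hY]
    set F : ZMod N → (Fin (m + 1) → ZMod N) → ℂ := fun q => ∑ σ, Q σ q ρ • (A lam *ᵥ Ψ σ)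
      with hF
    set G : ZMod N → (Fin (m + 1) → ZMod N) → ℂ := fun q => ∑ σ, Q σ q ρ • (B lam *ᵥ Ψ σ)
      with hG
    -- The eigenvalue equation at a zero, solved for the `A` part `F q` in terms of `G q` and `G (q
    -- - 1)`.
    have hK' : ∀ q γ, lam * (r * χ (-q)) * F q γ = -(lam * α * G q γ + β * G (q - 1) γ) := by
      intro q γ
      have := congrFun (hK ρ q lam) γ
      rw [hev, zero_smul] at this
      simp only [Pi.add_apply, Pi.smul_apply, smul_eq_mul, Pi.zero_apply] at this
      linear_combination this
    have hGq : ∀ q, -(χ (q + 1) / (lam * r) * quad χ κ α β e f lam) • G q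
        = φ' k ρ • ∑ σ, Q σ (q + 1) (ρ + Pi.single k.succ 1) • Ψ σ := by
      intro q
      rw [hG, Finset.smul_sum, Finset.smul_sum]
      refine Finset.sum_congr rfl fun σ _ => ?_
      rw [h.eig, smul_smul, smul_smul, smul_smul, hQ.shiftA, ← hlam, eigv]
      congr 1
      field_simp
    rw [stepVec, Finset.smul_sum]
    refine Eq.trans ?_ (sum_add_right (1 : ZMod N) _)
    change ∑ q, tvec (F q) _ + ∑ q, tvec (G q) _ = _
    simp only [← tvec_smul_left, ← hGq]
    ext γ
    simp only [Pi.add_apply, Pi.smul_apply, Finset.sum_apply, smul_eq_mul, Pi.sub_apply, tvec]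
    have s1 : ∑ q, F q (Fin.init γ) * (lam * κ * ψ (q + 1) (γ (Fin.last (m + 1))))
        = ∑ q, lam * κ * F q (Fin.init γ) * ψ (q + 1) (γ (Fin.last (m + 1))) :=
      Finset.sum_congr rfl fun q _ => by ring
    have hFq : ∀ q γ, F q γ = -(χ q / (lam * r)) * (lam * α * G q γ + β * G (q - 1) γ) := by
      intro q γ
      have h1 := hK' q γ
      have h2 : χ (-q) * χ q = 1 := by rw [← AddChar.map_add_eq_mul]; simp
      have h3 : lam * r ≠ 0 := mul_ne_zero hlam0 hr
      rw [div_eq_mul_inv]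
      have h4 : (lam * r) * (lam * r)⁻¹ = 1 := mul_inv_cancel₀ h3
      linear_combination χ q * (lam * r)⁻¹ * h1 - F q γ * h2 - F q γ * χ q * χ (-q) * h4
    have s2 : ∀ q, F q (Fin.init γ) * (ψ q (γ (Fin.last (m + 1)))
          + lam * κ * ψ (q + 1) (γ (Fin.last (m + 1))))
        + G q (Fin.init γ) * (χ q / r * (α * ψ q (γ (Fin.last (m + 1)))
          - (e + χ 1 * f) * ψ (q + 1) (γ (Fin.last (m + 1)))
          + χ 1 * (β * κ) * ψ (q + 2) (γ (Fin.last (m + 1)))))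
        = (-(χ q / (lam * r)) * β * G (q - 1) (Fin.init γ) * ψ q (γ (Fin.last (m + 1)))
          + (-(χ q / (lam * r)) * lam ^ 2 * κ * α - χ q / r * (e + χ 1 * f))
              * G q (Fin.init γ) * ψ (q + 1) (γ (Fin.last (m + 1))))
          + (-(χ q / r) * κ * β * G (q - 1) (Fin.init γ) * ψ (q + 1) (γ (Fin.last (m + 1)))
            + χ q / r * χ 1 * (β * κ) * G q (Fin.init γ)
              * ψ (q + 2) (γ (Fin.last (m + 1)))) := by
      intro q
      rw [hFq]
      field_simp
      ring
    rw [← Finset.sum_add_distrib, Finset.sum_congr rfl fun q _ => s2 q, Finset.sum_add_distrib,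
      Finset.sum_add_distrib, Finset.sum_add_distrib]
    -- Translating the two sums with `G (q - 1)` makes the `ψ (q + 2)` terms cancel, while the `ψ (q
    -- + 1)` terms add up to `quad`.
    rw [← sum_add_right (1 : ZMod N) (fun q =>
      -(χ q / (lam * r)) * β * G (q - 1) (Fin.init γ) * ψ q (γ (Fin.last (m + 1)))),
      ← sum_add_right (1 : ZMod N) (fun q =>
        -(χ q / r) * κ * β * G (q - 1) (Fin.init γ) * ψ (q + 1) (γ (Fin.last (m + 1)))),
      ← Finset.sum_add_distrib, ← Finset.sum_add_distrib, ← Finset.sum_add_distrib]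
    refine Finset.sum_congr rfl fun q _ => ?_
    have h11 : q + 1 + 1 = q + 2 := by ring
    simp only [add_sub_cancel_right, h11, AddChar.map_add_eq_mul, quad]
    have := hχ 1
    field_simp
    ring

end Step

end

/-! ### Products of cyclic functions solve the kernel equations. -/

section

variable {N : ℕ} (χ : AddChar (ZMod N) ℂ)

/-- Cyclic functions for the character `χ`, up to normalization. -/
structure IsCyc (x y : ℂ) (f : ZMod N → ℂ) : Prop where
  ne : ∀ γ, f γ ≠ 0
  y_ne : y ≠ 0
  step : ∀ γ, f (γ + 1) * (1 - χ (γ + 1) * x) = y * f γ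

/-- The kernel of the step from `m + 1` to `m + 2` sites, in terms of cyclic functions. -/
def kern {m : ℕ} (f₀ f₁ : ZMod N → ℂ) (g : Fin m → Fin (m + 1) → ZMod N → ℂ)
    (h : Fin m → Fin m → ZMod N → ℂ) (s : Fin m → ZMod N → ℂ)
    (σ : Fin (m + 1) → ZMod N) (q : ZMod N) (ρ : Fin (m + 2) → ZMod N) : ℂ :=
  χ ((∑ k, ρ k - ∑ k, σ k) * (q - ρ 0)) / (f₀ (ρ 0 - σ 0 - 1) * f₁ (∑ k, ρ k - q - 1))
  * ((∏ l : Fin m, ∏ k : Fin (m + 1), g l k (σ l.succ - ρ k.succ))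
    / ∏ j : Fin m, ∏ l ∈ Finset.univ.erase j, h j l (σ j.succ - σ l.succ))
  * ∏ l : Fin m, s l (σ l.succ)

theorem sum_add_single {n : ℕ} (ρ : Fin n → ZMod N) (i : Fin n) (c : ZMod N) :
    ∑ k, (ρ + Pi.single i c : Fin n → ZMod N) k = ∑ k, ρ k + c := by
  simp [Finset.sum_add_distrib]

theorem zeta_add_single_self (R : ℕ → ℂ) {m : ℕ} (ρ : Fin (m + 1) → ZMod N) (l : Fin m) :
    zeta χ R (ρ + Pi.single l.succ 1) l = zeta χ R ρ l * χ (-1) := by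
  simp only [zeta, Pi.add_apply, Pi.single_eq_same, neg_add, AddChar.map_add_eq_mul]; ring

theorem zeta_add_single_of_ne (R : ℕ → ℂ) {m : ℕ} (ρ : Fin (m + 1) → ZMod N) {l j : Fin m}
    (h : j ≠ l) : zeta χ R (ρ + Pi.single l.succ 1) j = zeta χ R ρ j := by
  simp [zeta, Pi.single_eq_of_ne ((Fin.succ_injective _).ne h)]

/-- The phases combine to a function of the sum of all indices. This is how the total index and the
product of the amplitudes enter the kernel. -/
theorem prod_zeta (R : ℕ → ℂ) {m : ℕ} (ρ : Fin (m + 1) → ZMod N) :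
    χ (-ρ 0) * ∏ l, zeta χ R ρ l = (∏ l : Fin m, R (l + 1)) * χ (-∑ k, ρ k) := by
  have : ∀ s : Finset (Fin m), ∏ l ∈ s, χ (-ρ l.succ) = χ (-∑ l ∈ s, ρ l.succ) := by
    intro s
    induction s using Finset.induction_on with
    | empty => simp
    | insert a s ha ih =>
      rw [Finset.prod_insert ha, Finset.sum_insert ha, ih, neg_add, AddChar.map_add_eq_mul]
  simp only [zeta, Finset.prod_mul_distrib, this, Fin.sum_univ_succ, neg_add,
    AddChar.map_add_eq_mul]
  ring

/-- Changing one index in an off-diagonal double product. -/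
theorem prod_erase_update {ι : Type*} [Fintype ι] [DecidableEq ι] (F F' : ι → ι → ℂ)
    (l : ι) (u w : ι → ℂ) (hoff : ∀ i j, i ≠ l → j ≠ l → i ≠ j → F' i j = F i j)
    (hrow : ∀ j, j ≠ l → F' l j * F' j l * u j = F l j * F j l * w j) :
    (∏ i, ∏ j ∈ Finset.univ.erase i, F' i j) * ∏ j ∈ Finset.univ.erase l, u j
      = (∏ i, ∏ j ∈ Finset.univ.erase i, F i j) * ∏ j ∈ Finset.univ.erase l, w j := by
  have split : ∀ E : ι → ι → ℂ, ∏ i, ∏ j ∈ Finset.univ.erase i, E i j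
      = (∏ j ∈ Finset.univ.erase l, E l j * E j l)
        * ∏ i ∈ Finset.univ.erase l, ∏ j ∈ (Finset.univ.erase i).erase l, E i j := by
    intro E
    have hi : ∀ i ∈ Finset.univ.erase l, ∏ j ∈ Finset.univ.erase i, E i j
        = E i l * ∏ j ∈ (Finset.univ.erase i).erase l, E i j := fun i hi =>
      (Finset.mul_prod_erase _ (fun j => E i j)
        (Finset.mem_erase.2 ⟨(Finset.ne_of_mem_erase hi).symm, Finset.mem_univ l⟩)).symm
    rw [← Finset.mul_prod_erase Finset.univ (fun i => ∏ j ∈ Finset.univ.erase i, E i j)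
      (Finset.mem_univ l), Finset.prod_congr rfl hi, Finset.prod_mul_distrib,
      Finset.prod_mul_distrib]
    ring
  have hrest : ∏ i ∈ Finset.univ.erase l, ∏ j ∈ (Finset.univ.erase i).erase l, F' i j
      = ∏ i ∈ Finset.univ.erase l, ∏ j ∈ (Finset.univ.erase i).erase l, F i j := by
    refine Finset.prod_congr rfl fun i hi => Finset.prod_congr rfl fun j hj => ?_
    simp only [Finset.mem_erase, Finset.mem_univ, and_true] at hi hj
    exact hoff i j hi hj.1 (Ne.symm hj.2)
  have hr : (∏ j ∈ Finset.univ.erase l, F' l j * F' j l) * ∏ j ∈ Finset.univ.erase l, u j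
      = (∏ j ∈ Finset.univ.erase l, F l j * F j l) * ∏ j ∈ Finset.univ.erase l, w j := by
    rw [← Finset.prod_mul_distrib, ← Finset.prod_mul_distrib]
    exact Finset.prod_congr rfl fun j hj => hrow j (Finset.ne_of_mem_erase hj)
  rw [split F, split F', hrest]
  linear_combination (∏ i ∈ Finset.univ.erase l,
    ∏ j ∈ (Finset.univ.erase i).erase l, F i j) * hr

theorem prod_update {ι : Type*} [Fintype ι] [DecidableEq ι] (F F' : ι → ℂ) (l : ι) (u w : ℂ)
    (hoff : ∀ i, i ≠ l → F' i = F i) (hl : F' l * u = F l * w) :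
    (∏ i, F' i) * u = (∏ i, F i) * w := by
  rw [← Finset.mul_prod_erase _ _ (Finset.mem_univ l),
    ← Finset.mul_prod_erase _ F (Finset.mem_univ l),
    Finset.prod_congr rfl fun i hi => hoff i (Finset.ne_of_mem_erase hi)]
  linear_combination (∏ i ∈ Finset.univ.erase l, F i) * hl

section Kernel

variable {χ} {m : ℕ} {R R' : ℕ → ℂ} {r κ α β κh e f κ₀ α₀ β₀ e₀ f₀ : ℂ}
  {w₀ w₁ : ZMod N → ℂ} {g : Fin m → Fin (m + 1) → ZMod N → ℂ}
  {h : Fin m → Fin m → ZMod N → ℂ} {s : Fin m → ZMod N → ℂ}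
  {x₀ y₀ x₁ y₁ : ℂ} {yg : Fin m → Fin (m + 1) → ℂ} {yh : Fin m → Fin m → ℂ} {cs cφ : Fin m → ℂ}

theorem IsCyc.factor_ne {x y : ℂ} {w : ZMod N → ℂ} (hw : IsCyc χ x y w) (γ : ZMod N) :
    1 - χ γ * x ≠ 0 := by
  have := hw.step (γ - 1)
  rw [sub_add_cancel] at this
  intro h0
  rw [h0, mul_zero] at this
  exact mul_ne_zero hw.y_ne (hw.ne _) this.symm

theorem chi_mul_chi_neg (a : ZMod N) : χ a * χ (-a) = 1 := by
  rw [← AddChar.map_add_eq_mul]; simp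

/-- Only the row `l` changes. There `1 - χ γ x` from the recursion, times minus the shifted zeta, is
the difference of a new and an old zeta. -/
theorem kern_G_update (hR : ∀ l, l < m → R (l + 1) ≠ 0)
    (hg : ∀ (l : Fin m) (k : Fin (m + 1)), IsCyc χ (R' (k + 1) / R (l + 1)) (yg l k) (g l k))
    (σ : Fin (m + 1) → ZMod N) (ρ : Fin (m + 2) → ZMod N) (l : Fin m) :
    (∏ i : Fin m, ∏ k : Fin (m + 1), g i k ((σ + Pi.single l.succ 1 : Fin (m + 1) → ZMod N) i.succ
        - ρ k.succ)) * ∏ k, (-zeta χ R (σ + Pi.single l.succ 1) l + zeta χ R' ρ k)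
      = (∏ i : Fin m, ∏ k : Fin (m + 1), g i k (σ i.succ - ρ k.succ))
        * ((-(zeta χ R σ l * χ (-1))) ^ (m + 1) * ∏ k, yg l k) := by
  refine prod_update _ _ l _ _ (fun i hi => ?_) ?_
  · simp [Pi.single_eq_of_ne ((Fin.succ_injective _).ne hi)]
  · have : (-(zeta χ R σ l * χ (-1))) ^ (m + 1)
        = ∏ k : Fin (m + 1), (-(zeta χ R σ l * χ (-1))) := by simp
    rw [this, ← Finset.prod_mul_distrib, ← Finset.prod_mul_distrib, ← Finset.prod_mul_distrib]
    refine Finset.prod_congr rfl fun k _ => ?_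
    have hrec := (hg l k).step (σ l.succ - ρ k.succ)
    rw [zeta_add_single_self]
    simp only [Pi.add_apply, Pi.single_eq_same]
    have e1 : σ l.succ + 1 - ρ k.succ = σ l.succ - ρ k.succ + 1 := by ring
    have e2 : χ (σ l.succ - ρ k.succ + 1) * (χ (-σ l.succ) * χ (-1)) = χ (-ρ k.succ) := by
      rw [← AddChar.map_add_eq_mul, ← AddChar.map_add_eq_mul]; congr 1; ring
    have hRl := hR l l.2
    rw [e1]
    simp only [zeta]
    have e3 : R' (k + 1) / R (l + 1) * R (l + 1) = R' (k + 1) := div_mul_cancel₀ _ hRl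
    linear_combination (-(R (l + 1) * χ (-σ l.succ) * χ (-1))) * hrec
      - g l k (σ l.succ - ρ k.succ + 1) * χ (-ρ k.succ) * e3
      - g l k (σ l.succ - ρ k.succ + 1) * (R' (k + 1) / R (l + 1) * R (l + 1)) * e2

/-- Raising `σ l` moves the argument of `h l j` up and that of `h j l` down. The two recursions give
differences of zetas after and before the shift, which are the denominators of the two Lagrange
basis functions in `mid`. -/
theorem kern_H_update (hR : ∀ l, l < m → R (l + 1) ≠ 0)
    (hh : ∀ j l : Fin m, j ≠ l → IsCyc χ (R (l + 1) / R (j + 1)) (yh j l) (h j l))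
    (σ : Fin (m + 1) → ZMod N) (l : Fin m) :
    (∏ j : Fin m, ∏ i ∈ Finset.univ.erase j,
        h j i ((σ + Pi.single l.succ 1 : Fin (m + 1) → ZMod N) j.succ
          - (σ + Pi.single l.succ 1 : Fin (m + 1) → ZMod N) i.succ))
      * ∏ j ∈ Finset.univ.erase l,
          ((zeta χ R σ j - zeta χ R σ l * χ (-1)) * yh j l * zeta χ R σ j)
      = (∏ j : Fin m, ∏ i ∈ Finset.univ.erase j, h j i (σ j.succ - σ i.succ))
        * ∏ j ∈ Finset.univ.erase l,
          (yh l j * (zeta χ R σ j - zeta χ R σ l) * (-(zeta χ R σ l * χ (-1)))) := by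
  refine prod_erase_update _ _ l _ _ (fun i j hi hj _ => ?_) fun j hj => ?_
  · simp [Pi.single_eq_of_ne ((Fin.succ_injective _).ne hi),
      Pi.single_eq_of_ne ((Fin.succ_injective _).ne hj)]
  · have r1 := (hh l j hj.symm).step (σ l.succ - σ j.succ)
    have r2 := (hh j l hj).step (σ j.succ - (σ l.succ + 1))
    have e0 : σ j.succ - (σ l.succ + 1) + 1 = σ j.succ - σ l.succ := by ring
    have e1 : σ l.succ + 1 - σ j.succ = σ l.succ - σ j.succ + 1 := by ring
    have e2 : χ (σ l.succ - σ j.succ + 1) * (χ (-σ l.succ) * χ (-1)) = χ (-σ j.succ) := by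
      rw [← AddChar.map_add_eq_mul, ← AddChar.map_add_eq_mul]; congr 1; ring
    have e3 : χ (σ j.succ - σ l.succ) * χ (-σ j.succ) = χ (-σ l.succ) := by
      rw [← AddChar.map_add_eq_mul]; congr 1; ring
    rw [e0] at r2
    simp only [Pi.add_apply, Pi.single_eq_same, add_zero, Pi.single_eq_of_ne
      ((Fin.succ_injective _).ne hj), e1]
    have f1 : R (j + 1) / R (l + 1) * R (l + 1) = R (j + 1) := div_mul_cancel₀ _ (hR l l.2)
    have f2 : R (l + 1) / R (j + 1) * R (j + 1) = R (l + 1) := div_mul_cancel₀ _ (hR j j.2)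
    have g1 : h l j (σ l.succ - σ j.succ + 1)
        * (zeta χ R σ j - zeta χ R σ l * χ (-1))
        = -(zeta χ R σ l * χ (-1)) * (yh l j * h l j (σ l.succ - σ j.succ)) := by
      simp only [zeta]
      linear_combination (-(R (l + 1) * χ (-σ l.succ) * χ (-1))) * r1
        - h l j (σ l.succ - σ j.succ + 1) * χ (-σ j.succ) * f1
        - h l j (σ l.succ - σ j.succ + 1) * (R (j + 1) / R (l + 1) * R (l + 1)) * e2
    have g2 : h j l (σ j.succ - σ l.succ) * (zeta χ R σ j - zeta χ R σ l)
        = zeta χ R σ j * (yh j l * h j l (σ j.succ - (σ l.succ + 1))) := by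
      simp only [zeta]
      linear_combination (R (j + 1) * χ (-σ j.succ)) * r2
        + h j l (σ j.succ - σ l.succ) * χ (-σ l.succ) * f2
        + h j l (σ j.succ - σ l.succ) * (R (l + 1) / R (j + 1) * R (j + 1)) * e3
    linear_combination (h j l (σ j.succ - (σ l.succ + 1)) * yh j l * zeta χ R σ j) * g1
      + (zeta χ R σ l * χ (-1)) * (yh l j * h l j (σ l.succ - σ j.succ)) * g2

/-- The algebra of the equation `mid`. Here `z` is the zeta of index `l`, `u` is `χ (-1)`, `Zj` is
the product of the other zetas, primes mark values after the shift, and `hc` is the phase condition.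
-/
theorem kern_mid_aux {r phσ quad₀ c ph u z lam R₀ χρ χq T P1 P2 P3 Y1 Y2 Zj G G' H H' S S' Yg
    cs cφ χ1 PR F wpow : ℂ}
    (hG : G' * T = G * ((-(z * u)) ^ 2 * wpow * Yg))
    (hH : H' * (P3 * Y2 * Zj) = H * (Y1 * P2 * wpow))
    (hS : quad₀ * S = cs * z * S') (hc : r * cφ * cs * χ1 * Y1 = R₀ * PR * Yg * Y2)
    (hz : PR * phσ = z * Zj) (hu : u * χ1 = 1) (hcq : c * χρ = χq)
    (hz0 : z ≠ 0) (hP2 : P2 ≠ 0) (hP3 : P3 ≠ 0) (hY2 : Y2 ≠ 0) (hZj : Zj ≠ 0) (hH0 : H ≠ 0)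
    (hH0' : H' ≠ 0) (hF : F ≠ 0) :
    r * χq * (cφ * phσ * quad₀) * (ph / F * (G / H) * S) * (lam / -z * (P1 / P2))
      = R₀ * χρ * T * (ph * c / F * (G' / H') * S') * (lam / (-(z * u)) * (P1 / P3)) := by
  have hu0 : u ≠ 0 := left_ne_zero_of_mul_eq_one hu
  have key : r * (cφ * phσ) * (quad₀ * S) * G * (H' * P3) * u
      = R₀ * (T * G') * S' * (H * P2) := by
    have hinj : Y2 * Zj * (χ1 * u) * (r * (cφ * phσ) * (quad₀ * S) * G * (H' * P3) * u)
        = Y2 * Zj * (χ1 * u) * (R₀ * (T * G') * S' * (H * P2)) := by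
      rw [hS, mul_comm T, hG]
      linear_combination (χ1 * u * (r * (cφ * phσ) * (cs * z * S') * G * u)) * hH
        + (u * phσ * z * S' * G * u * H * P2 * wpow) * hc
        + (u * R₀ * Yg * Y2 * z * S' * G * u * H * P2 * wpow) * hz
        - (R₀ * G * z ^ 2 * u ^ 2 * wpow * Yg * S' * H * P2 * Y2 * Zj) * hu
    have h1 : Y2 * Zj * (χ1 * u) ≠ 0 := by
      rw [mul_comm χ1, hu, mul_one]; exact mul_ne_zero hY2 hZj
    exact mul_left_cancel₀ h1 hinj
  rw [← hcq]
  field_simp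
  linear_combination (-(c * χρ * ph * lam * P1)) * key

/-- Each equation tests few factors: `top` uses the recursion of `w₀`, `bot` that of `w₁`, `mid`
those of `g`, `h`, `s` together with `hc`, and `shiftA` that of `g`. Finally `shiftV` holds because
only differences of the shifted indices occur. -/
theorem isKernel_kern (hR : ∀ l, l ≤ m → R l ≠ 0) (hr : r ≠ 0)
    (hinj : ∀ σ, Function.Injective (zeta χ R (m := m) σ))
    (hw₀ : IsCyc χ x₀ y₀ w₀) (hx₀ : x₀ * R' 0 = R 0 * α) (hy₀ : y₀ * R' 0 = κh * r)
    (hw₁ : IsCyc χ x₁ y₁ w₁) (hx₁ : x₁ * (R' 0 * ∏ k : Fin (m + 1), R' (k + 1)) = r)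
    (hy₁ : y₁ * (R' 0 * ∏ k : Fin (m + 1), R' (k + 1)) = β * (R 0 * ∏ l : Fin m, R (l + 1)))
    (hg : ∀ (l : Fin m) (k : Fin (m + 1)), IsCyc χ (R' (k + 1) / R (l + 1)) (yg l k) (g l k))
    (hh : ∀ j l : Fin m, j ≠ l → IsCyc χ (R (l + 1) / R (j + 1)) (yh j l) (h j l))
    (hs : ∀ (l : Fin m) γ, quad χ κ₀ α₀ β₀ e₀ f₀ (-(R (l + 1) * χ (-γ))) * s l γ
      = cs l * (R (l + 1) * χ (-γ)) * s l (γ + 1))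
    (hc : ∀ l, r * cφ l * cs l * χ 1 * ∏ j ∈ Finset.univ.erase l, yh l j
      = R' 0 * (∏ i : Fin m, R (i + 1)) * (∏ k, yg l k) * ∏ j ∈ Finset.univ.erase l, yh j l) :
    IsKernel χ R R' r κ α β κh e f
      (fun l σ => cφ l * χ (σ 0 - ∑ k, σ k) * quad χ κ₀ α₀ β₀ e₀ f₀ (-zeta χ R σ l))
      (fun k ρ => -((R 0 * ∏ l : Fin m, R (l + 1)) / r) * (∏ l, yg l k) * χ (ρ 0 - ∑ k, ρ k)
        * quad χ κ α β e f (-zeta χ R' ρ k))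
      (kern χ w₀ w₁ g h s) := by
  have hχ : ∀ a, χ a ≠ 0 := fun a => (χ.val_isUnit a).ne_zero
  have hz : ∀ σ l, zeta χ R (m := m) σ l ≠ 0 := fun σ l => mul_ne_zero (hR _ l.2) (hχ _)
  have hH : ∀ σ : Fin (m + 1) → ZMod N, ∏ j : Fin m, ∏ i ∈ Finset.univ.erase j,
      h j i (σ j.succ - σ i.succ) ≠ 0 := fun σ => Finset.prod_ne_zero_iff.2 fun j _ =>
    Finset.prod_ne_zero_iff.2 fun i hi => (hh j i (Finset.ne_of_mem_erase hi).symm).ne _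
  constructor
  · intro σ q ρ
    have e1 : χ ((∑ k, ρ k - (∑ k, σ k + 1)) * (q - ρ 0))
        = χ ((∑ k, ρ k - ∑ k, σ k) * (q - ρ 0)) * χ (ρ 0 - q) := by
      rw [← AddChar.map_add_eq_mul]; congr 1; ring
    have e2 : χ (ρ 0 - q) * χ (-ρ 0) = χ (-q) := by
      rw [← AddChar.map_add_eq_mul]; congr 1; ring
    have e3 : χ (-(σ 0 + 1)) = χ (ρ 0 - (σ 0 + 1)) * χ (-ρ 0) := by
      rw [← AddChar.map_add_eq_mul]; congr 1; ring
    have e4 : ρ 0 - σ 0 - 1 = ρ 0 - (σ 0 + 1) := by ring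
    have hrec := hw₀.step (ρ 0 - (σ 0 + 1) - 1)
    rw [sub_add_cancel] at hrec
    have n1 := hw₀.ne (ρ 0 - (σ 0 + 1))
    have n2 := hw₀.ne (ρ 0 - (σ 0 + 1) - 1)
    simp only [kern, sum_add_single, e1, e3, e4]
    simp only [Pi.add_apply, Pi.single_eq_same, Pi.single_eq_of_ne (Fin.succ_ne_zero _), add_zero]
    rw [← e2]
    have n3 := hw₁.ne (∑ k, ρ k - q - 1)
    have n4 := hH σ
    generalize χ ((∑ k, ρ k - ∑ k, σ k) * (q - ρ 0)) = c0
    generalize (∏ j : Fin m, ∏ i ∈ Finset.univ.erase j, h j i (σ j.succ - σ i.succ)) = H at n4 ⊢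
    generalize (∏ l : Fin m, ∏ i : Fin (m + 1), g l i (σ l.succ - ρ i.succ)) = G
    generalize (∏ l : Fin m, s l (σ l.succ)) = S
    field_simp
    linear_combination (c0 * χ (ρ 0 - q) * G * S * χ (-ρ 0)) * (-R' 0 * hrec
      - w₀ (ρ 0 - (σ 0 + 1)) * χ (ρ 0 - (σ 0 + 1)) * hx₀ - w₀ (ρ 0 - (σ 0 + 1) - 1) * hy₀)
  · intro σ q ρ
    have e1 : χ ((∑ k, ρ k - ∑ k, σ k) * (q - 1 - ρ 0))
        = χ ((∑ k, ρ k - ∑ k, σ k) * (q - ρ 0)) * χ (∑ k, σ k - ∑ k, ρ k) := by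
      rw [← AddChar.map_add_eq_mul]; congr 1; ring
    have e2 : ∑ k, ρ k - (q - 1) - 1 = ∑ k, ρ k - q := by ring
    have hrec := hw₁.step (∑ k, ρ k - q - 1)
    rw [sub_add_cancel] at hrec
    have n1 := hw₁.ne (∑ k, ρ k - q)
    have n2 := hw₁.ne (∑ k, ρ k - q - 1)
    have n3 := hw₀.ne (ρ 0 - σ 0 - 1)
    have n4 := hH σ
    have p1 := prod_zeta χ R σ
    have p2 := prod_zeta χ R' ρ
    have e3 : χ (-q) = χ (∑ k, ρ k - q) * χ (-∑ k, ρ k) := by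
      rw [← AddChar.map_add_eq_mul]; congr 1; ring
    have e4 : χ (∑ k, σ k - ∑ k, ρ k) * χ (-∑ k, σ k) = χ (-∑ k, ρ k) := by
      rw [← AddChar.map_add_eq_mul]; congr 1; ring
    simp only [kern, e1, e2, e3]
    generalize χ ((∑ k, ρ k - ∑ k, σ k) * (q - ρ 0)) = c0
    generalize (∏ j : Fin m, ∏ i ∈ Finset.univ.erase j, h j i (σ j.succ - σ i.succ)) = H at n4 ⊢
    generalize (∏ l : Fin m, ∏ i : Fin (m + 1), g l i (σ l.succ - ρ i.succ)) = G
    generalize (∏ l : Fin m, s l (σ l.succ)) = S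
    field_simp
    linear_combination (c0 * G * S) * (w₁ (∑ k, ρ k - q) * R' 0 * p2
      - w₁ (∑ k, ρ k - q - 1) * R 0 * β * χ (∑ k, σ k - ∑ k, ρ k) * p1
      + w₁ (∑ k, ρ k - q) * χ (∑ k, ρ k - q) * χ (-∑ k, ρ k) * hx₁
      - w₁ (∑ k, ρ k - q - 1) * R 0 * β * (∏ l : Fin m, R (l + 1)) * e4
      + χ (-∑ k, ρ k) * (R' 0 * ∏ k : Fin (m + 1), R' (k + 1)) * hrec
      + χ (-∑ k, ρ k) * w₁ (∑ k, ρ k - q - 1) * hy₁)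
  · intro σ q ρ l lam
    have e1 : χ ((∑ k, ρ k - (∑ k, σ k + 1)) * (q - ρ 0))
        = χ ((∑ k, ρ k - ∑ k, σ k) * (q - ρ 0)) * χ (ρ 0 - q) := by
      rw [← AddChar.map_add_eq_mul]; congr 1; ring
    -- The nodes before and after the shift differ only in the node `l`, which is absent from the
    -- numerator. The two basis functions are therefore proportional as functions of `lam`.
    have l1 : lagr (-zeta χ R σ) l lam = lam / -zeta χ R σ l
        * ((∏ j ∈ Finset.univ.erase l, (lam + zeta χ R σ j))
          / ∏ j ∈ Finset.univ.erase l, (zeta χ R σ j - zeta χ R σ l)) := by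
      rw [lagr, ← Finset.prod_div_distrib]
      congr 1
      refine Finset.prod_congr rfl fun j _ => ?_
      simp only [Pi.neg_apply]
      congr 1 <;> ring
    have l2 : lagr (-zeta χ R (σ + Pi.single l.succ 1)) l lam
        = lam / (-(zeta χ R σ l * χ (-1)))
        * ((∏ j ∈ Finset.univ.erase l, (lam + zeta χ R σ j))
          / ∏ j ∈ Finset.univ.erase l, (zeta χ R σ j - zeta χ R σ l * χ (-1))) := by
      rw [lagr, ← Finset.prod_div_distrib, Pi.neg_apply, zeta_add_single_self]
      congr 1
      refine Finset.prod_congr rfl fun j hj => ?_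
      simp only [Pi.neg_apply,
        zeta_add_single_of_ne χ R σ (Finset.ne_of_mem_erase hj)]
      congr 1 <;> ring
    rw [l1, l2]
    simp only [kern, sum_add_single, e1]
    have z0 : (σ + Pi.single l.succ 1 : Fin (m + 1) → ZMod N) 0 = σ 0 := by
      simp [(Fin.succ_ne_zero l).symm]
    rw [z0]
    have hm : (-(zeta χ R σ l * χ (-1))) ^ (m + 1) = (-(zeta χ R σ l * χ (-1))) ^ 2
        * (-(zeta χ R σ l * χ (-1))) ^ (Finset.univ.erase l).card := by
      have := l.pos
      rw [← pow_add]
      congr 1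
      simp; omega
    have hGu := kern_G_update (fun _ hl => hR _ hl) hg σ ρ l
    have hHu := kern_H_update (fun _ hl => hR _ hl) hh σ l
    rw [hm] at hGu
    simp only [Finset.prod_mul_distrib, Finset.prod_const] at hHu
    refine kern_mid_aux hGu hHu (S' := ∏ i, s i ((σ + Pi.single l.succ 1 :
      Fin (m + 1) → ZMod N) i.succ)) (cs := cs l) ?_ (hc l) ?_ ((mul_comm _ _).trans
      (chi_mul_chi_neg 1)) ?_ (hz σ l) ?_ ?_ ?_ ?_ (hH σ) (hH _) ?_
    · have := prod_update (fun i => s i (σ i.succ)) (fun i => s i ((σ + Pi.single l.succ 1 :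
        Fin (m + 1) → ZMod N) i.succ)) l (cs l * zeta χ R σ l)
        (quad χ κ₀ α₀ β₀ e₀ f₀ (-zeta χ R σ l)) (fun i hi => by
          simp [Pi.single_eq_of_ne ((Fin.succ_injective _).ne hi)]) (by
          have := hs l (σ l.succ)
          simp only [Pi.add_apply, Pi.single_eq_same, zeta]
          linear_combination -this)
      linear_combination -this
    · have p1 := prod_zeta χ R σ
      rw [Finset.mul_prod_erase _ _ (Finset.mem_univ l), sub_eq_add_neg, AddChar.map_add_eq_mul]
      linear_combination (-χ (σ 0)) * p1
        + (∏ l, zeta χ R σ l) * chi_mul_chi_neg (χ := χ) (σ 0)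
    · rw [← AddChar.map_add_eq_mul]; congr 1; ring
    · exact Finset.prod_ne_zero_iff.2 fun j hj => sub_ne_zero.2 fun hjl =>
        Finset.ne_of_mem_erase hj (hinj σ hjl)
    · refine Finset.prod_ne_zero_iff.2 fun j hj => sub_ne_zero.2 fun hjl =>
        Finset.ne_of_mem_erase hj (hinj (σ + Pi.single l.succ 1) ?_)
      rw [zeta_add_single_self, zeta_add_single_of_ne χ R σ (Finset.ne_of_mem_erase hj), hjl]
    · exact Finset.prod_ne_zero_iff.2 fun j hj => (hh j l (Finset.ne_of_mem_erase hj)).y_ne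
    · exact Finset.prod_ne_zero_iff.2 fun j hj => hz σ j
    · exact mul_ne_zero (hw₀.ne _) (hw₁.ne _)
  · intro σ q ρ k
    have z0 : (ρ + Pi.single k.succ 1 : Fin (m + 2) → ZMod N) 0 = ρ 0 := by
      simp [(Fin.succ_ne_zero k).symm]
    have e1 : χ ((∑ k, ρ k + 1 - ∑ k, σ k) * (q + 1 - ρ 0))
        = χ ((∑ k, ρ k - ∑ k, σ k) * (q - ρ 0))
          * (χ (∑ k, ρ k - ρ 0) * χ (-∑ k, σ k) * χ (q + 1)) := by
      simp only [← AddChar.map_add_eq_mul]; congr 1; ring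
    have e2 : ∑ k, ρ k + 1 - (q + 1) - 1 = ∑ k, ρ k - q - 1 := by ring
    -- Raising `ρ k` lowers by one the argument of `g l k` for every `l` and leaves the other
    -- factors `g` unchanged.
    have hG : (∏ l : Fin m, ∏ i : Fin (m + 1), g l i (σ l.succ
          - (ρ + Pi.single k.succ 1 : Fin (m + 2) → ZMod N) i.succ))
          * ((∏ l, yg l k) * ∏ l, zeta χ R σ l)
        = (∏ l : Fin m, ∏ i : Fin (m + 1), g l i (σ l.succ - ρ i.succ))
          * ∏ l, (-zeta χ R' ρ k + zeta χ R σ l) := by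
      rw [← Finset.prod_mul_distrib, ← Finset.prod_mul_distrib, ← Finset.prod_mul_distrib]
      refine Finset.prod_congr rfl fun l _ => prod_update _ _ k _ _ (fun i hi => ?_) ?_
      · simp [Pi.single_eq_of_ne ((Fin.succ_injective _).ne hi)]
      · have hrec := (hg l k).step (σ l.succ - (ρ k.succ + 1))
        have e0 : σ l.succ - (ρ k.succ + 1) + 1 = σ l.succ - ρ k.succ := by ring
        rw [e0] at hrec
        have e3 : χ (σ l.succ - ρ k.succ) * χ (-σ l.succ) = χ (-ρ k.succ) := by
          rw [← AddChar.map_add_eq_mul]; congr 1; ring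
        have e4 : R' (k + 1) / R (l + 1) * R (l + 1) = R' (k + 1) :=
          div_mul_cancel₀ _ (hR _ l.2)
        simp only [Pi.add_apply, Pi.single_eq_same, zeta]
        linear_combination (-(R (l + 1) * χ (-σ l.succ))) * hrec
          - g l k (σ l.succ - ρ k.succ) * χ (-ρ k.succ) * e4
          - g l k (σ l.succ - ρ k.succ) * (R' (k + 1) / R (l + 1) * R (l + 1)) * e3
    have p1 := prod_zeta χ R σ
    have hzz : ∏ l, zeta χ R σ l ≠ 0 := Finset.prod_ne_zero_iff.2 fun l _ => hz σ l
    have e5 : χ (ρ 0 - ∑ k, ρ k) * χ (∑ k, ρ k - ρ 0) = 1 := by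
      rw [← AddChar.map_add_eq_mul]; simp
    simp only [kern, sum_add_single, z0, e1, e2]
    set G := ∏ l : Fin m, ∏ i : Fin (m + 1), g l i (σ l.succ - ρ i.succ)
    set G' := ∏ l : Fin m, ∏ i : Fin (m + 1), g l i (σ l.succ
      - (ρ + Pi.single k.succ 1 : Fin (m + 2) → ZMod N) i.succ)
    set PR := ∏ l : Fin m, R (l + 1)
    set Z := ∏ l, zeta χ R σ l
    have key : PR * (∏ l, yg l k) * χ (-∑ k, σ k) * G'
        = χ (-σ 0) * (∏ l, (-zeta χ R' ρ k + zeta χ R σ l)) * G := by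
      linear_combination χ (-σ 0) * hG - (∏ l, yg l k) * G' * p1
    generalize quad χ κ α β e f (-zeta χ R' ρ k) = qd
    generalize χ ((∑ k, ρ k - ∑ k, σ k) * (q - ρ 0)) = c0
    have n1 := hw₀.ne (ρ 0 - σ 0 - 1)
    have n2 := hw₁.ne (∑ k, ρ k - q - 1)
    have n4 := hH σ
    field_simp
    linear_combination (-(R 0 * χ (q + 1) * qd * c0 * ∏ l, s l (σ l.succ))) * key
      - R 0 * (∏ l, s l (σ l.succ)) * PR * (∏ l, yg l k) * χ (-∑ k, σ k) * G' * χ (q + 1)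
        * qd * c0 * e5
  · intro σ q ρ
    have e1 : (∑ k, ρ k + 1 - (∑ k, σ k + 1)) * (q + 1 - (ρ 0 + 1))
        = (∑ k, ρ k - ∑ k, σ k) * (q - ρ 0) := by ring
    have e2 : ρ 0 + 1 - (σ 0 + 1) - 1 = ρ 0 - σ 0 - 1 := by ring
    have e3 : ∑ k, ρ k + 1 - (q + 1) - 1 = ∑ k, ρ k - q - 1 := by ring
    simp only [kern, sum_add_single]
    simp only [Pi.add_apply, Pi.single_eq_same, Pi.single_eq_of_ne (Fin.succ_ne_zero _), add_zero,
      e1, e2, e3]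

end Kernel

end

/-! ### The operators of the chain: recursion in the length and dependence on λ. -/

section

theorem tens_one_one {N n : ℕ} :
    tens (1 : Matrix (Fin n → ZMod N) (Fin n → ZMod N) ℂ) 1 = 1 := by
  ext γ γ'
  simp only [tens, Matrix.of_apply, Matrix.one_apply]
  by_cases h : γ = γ'
  · subst h; simp
  · rw [if_neg h, ite_zero_mul_ite_zero, if_neg]
    rintro ⟨h1, h2⟩
    apply h
    rw [← Fin.snoc_init_self γ, ← Fin.snoc_init_self γ', h1, h2]

theorem tens_add_left {N n : ℕ} (M M' : Matrix (Fin n → ZMod N) (Fin n → ZMod N) ℂ)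
    (P : Matrix (ZMod N) (ZMod N) ℂ) : tens (M + M') P = tens M P + tens M' P := by
  ext; simp [tens, add_mul]

theorem tens_add_right {N n : ℕ} (M : Matrix (Fin n → ZMod N) (Fin n → ZMod N) ℂ)
    (P P' : Matrix (ZMod N) (ZMod N) ℂ) : tens M (P + P') = tens M P + tens M P' := by
  ext; simp [tens, mul_add]

theorem tens_sub_right {N n : ℕ} (M : Matrix (Fin n → ZMod N) (Fin n → ZMod N) ℂ)
    (P P' : Matrix (ZMod N) (ZMod N) ℂ) : tens M (P - P') = tens M P - tens M P' := by
  ext; simp [tens, mul_sub]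

theorem tens_smul_left {N n : ℕ} (c : ℂ) (M : Matrix (Fin n → ZMod N) (Fin n → ZMod N) ℂ)
    (P : Matrix (ZMod N) (ZMod N) ℂ) : tens (c • M) P = c • tens M P := by
  ext; simp [tens, mul_assoc]

theorem tens_smul_right {N n : ℕ} (c : ℂ) (M : Matrix (Fin n → ZMod N) (Fin n → ZMod N) ℂ)
    (P : Matrix (ZMod N) (ZMod N) ℂ) : tens M (c • P) = c • tens M P := by
  ext; simp [tens]; ring

theorem tens_zero_left {N n : ℕ} (P : Matrix (ZMod N) (ZMod N) ℂ) :
    tens (0 : Matrix (Fin n → ZMod N) (Fin n → ZMod N) ℂ) P = 0 := by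
  ext; simp [tens]

/-- Operators on `n` sites as operators on `n + 1` sites. -/
def emb {N : ℕ} [NeZero N] (n : ℕ) :
    Matrix (Fin n → ZMod N) (Fin n → ZMod N) ℂ →+*
      Matrix (Fin (n + 1) → ZMod N) (Fin (n + 1) → ZMod N) ℂ where
  toFun M := tens M 1
  map_one' := tens_one_one
  map_mul' M M' := by rw [tens_mul, mul_one]
  map_zero' := tens_zero_left _
  map_add' M M' := tens_add_left _ _ _

/-- The Weyl element `v` on one site. -/
def siteV (N : ℕ) : Matrix (ZMod N) (ZMod N) ℂ :=
  Matrix.of fun g g' => if g = g' + 1 then 1 else 0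

/-- `phase (s g)` as a multiplication operator on one site. -/
def siteU {N : ℕ} [NeZero N] (s : ZMod N) : Matrix (ZMod N) (ZMod N) ℂ :=
  Matrix.diagonal fun g => phase (s * g)

theorem phase_zero {N : ℕ} [NeZero N] : phase (0 : ZMod N) = 1 := AddChar.map_zero_eq_one _

theorem phase_add {N : ℕ} [NeZero N] (a b : ZMod N) : phase (a + b) = phase a * phase b :=
  AddChar.map_add_eq_mul _ a b

theorem phase_ne {N : ℕ} [NeZero N] (a : ZMod N) : phase a ≠ 0 :=
  (AddChar.val_isUnit (ZMod.stdAddChar : AddChar (ZMod N) ℂ) a).ne_zero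

theorem weylU_inv {N : ℕ} [NeZero N] {n : ℕ} (k : Fin n) :
    (weylU (N := N) k)⁻¹ = Matrix.diagonal fun γ => phase (-γ k) := by
  apply Matrix.inv_eq_right_inv
  rw [weylU, Matrix.diagonal_mul_diagonal, ← Matrix.diagonal_one]
  congr 1
  ext γ
  rw [← phase_add]
  simp [phase_zero]

theorem eq_iff_init_last {N n : ℕ} (γ γ' : Fin (n + 1) → ZMod N) :
    γ = γ' ↔ Fin.init γ = Fin.init γ' ∧ γ (Fin.last n) = γ' (Fin.last n) := by
  constructor
  · rintro rfl; exact ⟨rfl, rfl⟩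
  · rintro ⟨h1, h2⟩
    rw [← Fin.snoc_init_self γ, ← Fin.snoc_init_self γ', h1, h2]

theorem weylV_castSucc {N : ℕ} [NeZero N] {n : ℕ} (k : Fin n) :
    weylV (N := N) k.castSucc = tens (weylV k) 1 := by
  ext γ γ'
  simp only [weylV, tens, Matrix.of_apply, Matrix.one_apply, ite_zero_mul_ite_zero, mul_one]
  have : γ = γ' + Pi.single k.castSucc 1 ↔ Fin.init γ = Fin.init γ' + Pi.single k 1
      ∧ γ (Fin.last n) = γ' (Fin.last n) := by
    rw [eq_iff_init_last]
    have h1 : Fin.init (γ' + Pi.single k.castSucc 1 : Fin (n + 1) → ZMod N)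
        = Fin.init γ' + Pi.single k 1 := by
      ext i
      simp only [Fin.init, Pi.add_apply, Pi.single_apply, Fin.castSucc_inj]
    rw [h1]
    simp [(Fin.castSucc_lt_last k).ne']
  simp only [this]

theorem weylV_last {N : ℕ} [NeZero N] {n : ℕ} :
    weylV (N := N) (Fin.last n) = tens 1 (siteV N) := by
  ext γ γ'
  simp only [weylV, siteV, tens, Matrix.of_apply, Matrix.one_apply, ite_zero_mul_ite_zero, mul_one]
  have : γ = γ' + Pi.single (Fin.last n) 1 ↔ Fin.init γ = Fin.init γ'
      ∧ γ (Fin.last n) = γ' (Fin.last n) + 1 := by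
    rw [eq_iff_init_last]
    have h1 : Fin.init (γ' + Pi.single (Fin.last n) 1 : Fin (n + 1) → ZMod N)
        = Fin.init γ' := by
      ext i
      simp [Fin.init, (Fin.castSucc_lt_last i).ne]
    rw [h1]
    simp
  simp only [this]

theorem diagonal_castSucc {N : ℕ} {n : ℕ} (F : ZMod N → ℂ) (k : Fin n) :
    (Matrix.diagonal fun γ : Fin (n + 1) → ZMod N => F (γ k.castSucc))
      = tens (Matrix.diagonal fun γ => F (γ k)) 1 := by
  ext γ γ'
  simp only [tens, Matrix.diagonal_apply, Matrix.of_apply, Matrix.one_apply, eq_iff_init_last γ]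
  by_cases h1 : Fin.init γ = Fin.init γ' <;> by_cases h2 : γ (Fin.last n) = γ' (Fin.last n) <;>
    simp [h1, h2, Fin.init]

theorem diagonal_last {N : ℕ} {n : ℕ} (F : ZMod N → ℂ) :
    (Matrix.diagonal fun γ : Fin (n + 1) → ZMod N => F (γ (Fin.last n)))
      = tens 1 (Matrix.diagonal F) := by
  ext γ γ'
  simp only [tens, Matrix.diagonal_apply, Matrix.of_apply, Matrix.one_apply, eq_iff_init_last γ]
  rw [ite_mul, one_mul, zero_mul, ← ite_and]

namespace Data

variable (D : Data)

/-- The operator `u⁻¹ (a - b v)` on the site number `k`. -/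
def siteX (N : ℕ) [NeZero N] (k : ℕ) : Matrix (ZMod N) (ZMod N) ℂ :=
  siteU (-1) * (D.a k • (1 : Matrix _ _ ℂ) - D.b k • siteV N)

/-- The operator `u (c - d v)` on the site number `k`. -/
def siteY (N : ℕ) [NeZero N] (k : ℕ) : Matrix (ZMod N) (ZMod N) ℂ :=
  siteU 1 * (D.c k • (1 : Matrix _ _ ℂ) - D.d k • siteV N)

theorem lOp_castSucc (N : ℕ) [NeZero N] {n : ℕ} (k : Fin n) (lam : ℂ) :
    D.lOp N k.castSucc lam = (emb n).mapMatrix (D.lOp N k lam) := by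
  have hs : ∀ (c : ℂ) (M : Matrix (Fin n → ZMod N) (Fin n → ZMod N) ℂ),
      emb n (c • M) = c • emb n M := fun c M => tens_smul_left c M 1
  have h1 : emb n (weylV (N := N) k) = weylV k.castSucc := (weylV_castSucc k).symm
  have h2 : emb n (weylU (N := N) k) = weylU k.castSucc := (diagonal_castSucc phase k).symm
  have h3 : emb n (weylU (N := N) k)⁻¹ = (weylU k.castSucc)⁻¹ := by
    rw [weylU_inv, weylU_inv]; exact (diagonal_castSucc (fun g => phase (-g)) k).symm
  ext i j : 2
  fin_cases i <;> fin_cases j <;>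
    simp [lOp, RingHom.mapMatrix_apply, hs, h1, h2, h3]

theorem lOp_last (N : ℕ) [NeZero N] {n : ℕ} (lam : ℂ) :
    D.lOp N (Fin.last n) lam = Matrix.of fun i j => tens 1 ((!![1 + (lam * D.κ (n + 1)) • siteV N,
      lam • D.siteX N (n + 1); D.siteY N (n + 1),
      (lam * (D.a (n + 1) * D.c (n + 1))) • (1 : Matrix _ _ ℂ)
        + (D.b (n + 1) * D.d (n + 1) / D.κ (n + 1)) • siteV N] :
        Matrix (Fin 2) (Fin 2) (Matrix (ZMod N) (ZMod N) ℂ)) i j) := by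
  have h2 : weylU (N := N) (Fin.last n) = tens 1 (siteU 1) := by
    simp only [siteU, one_mul]; exact diagonal_last phase
  have h3 : (weylU (N := N) (Fin.last n))⁻¹ = tens 1 (siteU (-1)) := by
    simp only [siteU, neg_one_mul]; rw [weylU_inv]; exact diagonal_last (fun g => phase (-g))
  have hm : ∀ P P' : Matrix (ZMod N) (ZMod N) ℂ, tens (n := n) 1 (P * P') = tens 1 P * tens 1 P' :=
    fun P P' => by rw [tens_mul, one_mul]
  ext i j : 2
  fin_cases i <;> fin_cases j <;>
    simp [lOp, tens_add_right, tens_sub_right, tens_smul_right, tens_one_one, h3, siteX,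
      siteY, hm, weylV_last, mul_assoc]
  all_goals simp [h2]

theorem monodromy_succ (N : ℕ) [NeZero N] (n : ℕ) (lam : ℂ) :
    D.monodromy N (n + 1) lam
      = (emb n).mapMatrix (D.monodromy N n lam) * D.lOp N (Fin.last n) lam := by
  rw [monodromy, List.ofFn_succ', List.concat_eq_append, List.prod_append, List.prod_singleton,
    monodromy, map_list_prod, List.map_ofFn]
  simp only [lOp_castSucc]
  rfl

/-- The operator `A_n(λ)`. -/
def aOp (N : ℕ) [NeZero N] (n : ℕ) (lam : ℂ) : Matrix (Fin n → ZMod N) (Fin n → ZMod N) ℂ :=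
  D.monodromy N n lam 0 0

theorem emb_mul_tens {N : ℕ} [NeZero N] {n : ℕ} (M : Matrix (Fin n → ZMod N) (Fin n → ZMod N) ℂ)
    (P : Matrix (ZMod N) (ZMod N) ℂ) : emb n M * tens 1 P = tens M P := by
  change tens M 1 * tens 1 P = _
  rw [tens_mul, mul_one, one_mul]

theorem aOp_succ (N : ℕ) [NeZero N] (n : ℕ) (lam : ℂ) :
    D.aOp N (n + 1) lam = tens (D.aOp N n lam) (1 + (lam * D.κ (n + 1)) • siteV N)
      + tens (D.bOp N n lam) (D.siteY N (n + 1)) := by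
  rw [aOp, monodromy_succ, Matrix.mul_apply, Fin.sum_univ_two, lOp_last]
  simp [RingHom.mapMatrix_apply, emb_mul_tens, aOp, bOp]

theorem bOp_succ (N : ℕ) [NeZero N] (n : ℕ) (lam : ℂ) :
    D.bOp N (n + 1) lam = tens (D.aOp N n lam) (lam • D.siteX N (n + 1))
      + tens (D.bOp N n lam) ((lam * (D.a (n + 1) * D.c (n + 1))) • (1 : Matrix _ _ ℂ)
        + (D.b (n + 1) * D.d (n + 1) / D.κ (n + 1)) • siteV N) := by
  rw [bOp, monodromy_succ, Matrix.mul_apply, Fin.sum_univ_two, lOp_last]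
  simp [RingHom.mapMatrix_apply, emb_mul_tens, aOp, bOp]

theorem aOp_zero (N : ℕ) [NeZero N] (lam : ℂ) : D.aOp N 0 lam = 1 := by
  simp [aOp, monodromy]

theorem bOp_zero (N : ℕ) [NeZero N] (lam : ℂ) : D.bOp N 0 lam = 0 := by
  simp [bOp, monodromy]

end Data

/-- The operator `v_1 ⋯ v_n`. -/
def shiftOp (N : ℕ) : (n : ℕ) → Matrix (Fin n → ZMod N) (Fin n → ZMod N) ℂ
  | 0 => 1
  | n + 1 => tens (shiftOp N n) (siteV N)

theorem PolyDep.tens_smul_add {N n : ℕ} {A B : ℂ → Matrix (Fin n → ZMod N) (Fin n → ZMod N) ℂ}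
    {A₀ A₁ B₀ B₁ : Matrix (Fin n → ZMod N) (Fin n → ZMod N) ℂ} (hA : PolyDep n A A₀ A₁)
    (hB : PolyDep n B B₀ B₁) (P P' Q Q' : Matrix (ZMod N) (ZMod N) ℂ) :
    PolyDep (n + 1) (fun lam => tens (A lam) (P + lam • P') + tens (B lam) (Q + lam • Q'))
      (tens A₀ P + tens B₀ Q) (tens A₁ P' + tens B₁ Q') := by
  intro γ γ'
  obtain ⟨p, hp, hp0, hp1, hpe⟩ := hA (Fin.init γ) (Fin.init γ')
  obtain ⟨q, hq, hq0, hq1, hqe⟩ := hB (Fin.init γ) (Fin.init γ')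
  set g := γ (Fin.last n)
  set g' := γ' (Fin.last n)
  have hlin : ∀ x y : ℂ, (Polynomial.C x + Polynomial.C y * Polynomial.X).natDegree ≤ 1 := by
    intro x y; rw [add_comm]; exact Polynomial.natDegree_linear_le
  refine ⟨p * (Polynomial.C (P g g') + Polynomial.C (P' g g') * Polynomial.X)
    + q * (Polynomial.C (Q g g') + Polynomial.C (Q' g g') * Polynomial.X), ?_, ?_, ?_, ?_⟩
  · exact Polynomial.natDegree_add_le_of_degree_le
      (Polynomial.natDegree_mul_le_of_le hp (hlin _ _))
      (Polynomial.natDegree_mul_le_of_le hq (hlin _ _))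
  · simp only [Polynomial.coeff_add, Polynomial.mul_coeff_zero, hp0, hq0]
    simp [tens, g, g']
  · have hp2 : p.coeff (n + 1) = 0 := Polynomial.coeff_eq_zero_of_natDegree_lt (by omega)
    have hq2 : q.coeff (n + 1) = 0 := Polynomial.coeff_eq_zero_of_natDegree_lt (by omega)
    simp only [mul_add, Polynomial.coeff_add, Polynomial.coeff_mul_C, ← mul_assoc,
      Polynomial.coeff_mul_X, hp1, hq1, hp2, hq2]
    simp [tens, g, g']
  · intro lam
    simp only [Matrix.add_apply, tens, Matrix.of_apply, hpe, hqe]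
    simp [g, g', mul_comm lam]

/-- The term with `siteY` does not affect the extreme coefficients of `A`: it contains no `lam`, and
`B` vanishes at zero. The top coefficient of `B` plays no role, so only its existence is recorded.
-/
theorem Data.polyDep_ops (D : Data) (N : ℕ) [NeZero N] (n : ℕ) :
    PolyDep n (D.aOp N n) 1 ((∏ s ∈ Finset.range n, D.κ (s + 1)) • shiftOp N n)
      ∧ ∃ B₁, PolyDep n (D.bOp N n) 0 B₁ := by
  induction n with
  | zero =>
    refine ⟨fun i j => ⟨Polynomial.C ((1 : Matrix _ _ ℂ) i j), by simp, by simp, ?_, ?_⟩,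
      0, fun i j => ⟨0, by simp, by simp, by simp, ?_⟩⟩
    · simp [shiftOp]
    · intro lam; rw [aOp_zero]; simp
    · intro lam; rw [bOp_zero]; simp
  | succ n ih =>
    obtain ⟨hA, B₁, hB⟩ := ih
    constructor
    · have := hA.tens_smul_add hB 1 (D.κ (n + 1) • siteV N) (D.siteY N (n + 1)) 0
      rw [tens_one_one, tens_zero_left, add_zero] at this
      intro γ γ'
      obtain ⟨p, h1, h2, h3, h4⟩ := this γ γ'
      refine ⟨p, h1, h2, ?_, ?_⟩
      · rw [h3, Finset.prod_range_succ, shiftOp]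
        simp [tens]
        ring
      · intro lam
        rw [← h4, aOp_succ]
        simp [smul_smul]
    · have := hA.tens_smul_add hB 0 (D.siteX N (n + 1))
        ((D.b (n + 1) * D.d (n + 1) / D.κ (n + 1)) • siteV N)
        ((D.a (n + 1) * D.c (n + 1)) • (1 : Matrix _ _ ℂ))
      have h0 : tens (1 : Matrix (Fin n → ZMod N) (Fin n → ZMod N) ℂ) 0
          + tens 0 ((D.b (n + 1) * D.d (n + 1) / D.κ (n + 1)) • siteV N) = 0 := by
        ext; simp [tens]
      rw [h0] at this
      have hB' : D.bOp N (n + 1) = fun lam =>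
          tens (D.aOp N n lam) (0 + lam • D.siteX N (n + 1)) + tens (D.bOp N n lam)
            ((D.b (n + 1) * D.d (n + 1) / D.κ (n + 1)) • siteV N
              + lam • (D.a (n + 1) * D.c (n + 1)) • (1 : Matrix _ _ ℂ)) := by
        funext lam
        rw [bOp_succ, zero_add, smul_smul, add_comm ((_ / _) • siteV N)]
      exact ⟨_, hB' ▸ this⟩

end

/-! ### Roots of unity, cyclic functions, one-site vectors and the averaged chain. -/

section

section Phase

variable {N : ℕ} [NeZero N]

theorem phase_neg_mul (a : ZMod N) : phase (-a) * phase a = 1 := by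
  rw [← phase_add, neg_add_cancel, phase_zero]

theorem phase_pow (k : ℕ) (a : ZMod N) : phase a ^ k = phase ((k : ZMod N) * a) := by
  rw [← nsmul_eq_mul]; exact (AddChar.map_nsmul_eq_pow _ k a).symm

theorem phase_pow_card (a : ZMod N) : phase a ^ N = 1 := by
  rw [phase_pow]; simp [phase_zero]

theorem phase_injective : Function.Injective (phase : ZMod N → ℂ) := ZMod.injective_stdAddChar

theorem isPrimitiveRoot_phase_one : IsPrimitiveRoot (phase (1 : ZMod N)) N where
  pow_eq_one := phase_pow_card 1
  dvd_of_pow_eq_one l hl := by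
    rw [phase_pow, mul_one, ← phase_zero (N := N)] at hl
    exact (ZMod.natCast_eq_zero_iff _ _).1 (phase_injective hl)

theorem nthRootsFinset_eq_image_phase :
    Polynomial.nthRootsFinset N (1 : ℂ) = Finset.univ.image (phase : ZMod N → ℂ) := by
  symm
  apply Finset.eq_of_subset_of_card_le
  · intro z hz
    obtain ⟨a, -, rfl⟩ := Finset.mem_image.1 hz
    exact (Polynomial.mem_nthRootsFinset (NeZero.pos N) 1).2 (phase_pow_card a)
  · rw [(isPrimitiveRoot_phase_one (N := N)).card_nthRootsFinset,
      Finset.card_image_of_injective _ phase_injective]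
    simp [ZMod.card]

theorem prod_one_sub_phase (x : ℂ) : ∏ γ : ZMod N, (1 - phase γ * x) = 1 - x ^ N := by
  have := (isPrimitiveRoot_phase_one (N := N)).pow_sub_pow_eq_prod_sub_mul (x := 1) (y := x)
    (NeZero.pos N)
  rw [one_pow, nthRootsFinset_eq_image_phase, Finset.prod_image phase_injective.injOn] at this
  exact this.symm

theorem exists_phase_of_pow_eq {z w : ℂ} (hw : w ≠ 0) (h : z ^ N = w ^ N) :
    ∃ a : ZMod N, z = w * phase a := by
  have h1 : (z / w) ^ N = 1 := by rw [div_pow, h, div_self (pow_ne_zero _ hw)]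
  have h2 := (Polynomial.mem_nthRootsFinset (NeZero.pos N) (1 : ℂ)).2 h1
  rw [nthRootsFinset_eq_image_phase] at h2
  obtain ⟨a, -, ha⟩ := Finset.mem_image.1 h2
  exact ⟨a, by rw [ha, mul_div_cancel₀ _ hw]⟩

theorem prod_range_natCast (F : ZMod N → ℂ) :
    ∏ j ∈ Finset.range N, F ((j : ℕ) : ZMod N) = ∏ γ, F γ := by
  refine Finset.prod_nbij' (fun j => (j : ZMod N)) ZMod.val (by simp) (fun γ _ => ?_)
    (fun j hj => ?_) (fun γ _ => ?_) (fun _ _ => rfl)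
  · exact Finset.mem_range.2 (ZMod.val_lt γ)
  · exact ZMod.val_cast_of_lt (Finset.mem_range.1 hj)
  · exact ZMod.natCast_zmod_val γ

/-- The Fermat equation says that the product of all `N` ratios is one. This makes `cyc`, defined by
representatives, satisfy the recursion also from `N - 1` to `0`. -/
theorem isCyc_cyc {x y : ℂ} (h : IsFermat N x y) :
    IsCyc (ZMod.stdAddChar : AddChar (ZMod N) ℂ) x y (cyc x y) := by
  obtain ⟨h1, hy⟩ := h
  have hx : 1 - x ^ N = y ^ N := by rw [← h1]; ring
  have hf : ∀ γ : ZMod N, 1 - phase γ * x ≠ 0 := by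
    have := prod_one_sub_phase (N := N) x
    rw [hx] at this
    intro γ h0
    exact pow_ne_zero N hy (this.symm.trans (Finset.prod_eq_zero (Finset.mem_univ γ) h0))
  have htot : ∏ j ∈ Finset.range N, y / (1 - phase ((j + 1 : ℕ) : ZMod N) * x) = 1 := by
    have e : ∀ j : ℕ, y / (1 - phase ((j + 1 : ℕ) : ZMod N) * x)
        = (fun γ : ZMod N => y / (1 - phase (γ + 1) * x)) (j : ZMod N) := by intro j; simp
    refine (Finset.prod_congr rfl fun j _ => e j).trans
      ((prod_range_natCast fun γ : ZMod N => y / (1 - phase (γ + 1) * x)).trans ?_)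
    have : ∏ γ : ZMod N, y / (1 - phase (γ + 1) * x) = ∏ γ : ZMod N, y / (1 - phase γ * x) :=
      Fintype.prod_equiv (Equiv.addRight 1) _ _ fun _ => rfl
    rw [this, Finset.prod_div_distrib, prod_one_sub_phase, hx]
    simp [ZMod.card, div_self (pow_ne_zero N hy)]
  refine ⟨fun γ => ?_, hy, fun γ => ?_⟩
  · exact Finset.prod_ne_zero_iff.2 fun j _ => div_ne_zero hy (hf _)
  · change cyc x y (γ + 1) * (1 - phase (γ + 1) * x) = y * cyc x y γ
    have hγ := ZMod.val_lt γ
    have hc : ((γ.val + 1 : ℕ) : ZMod N) = γ + 1 := by simp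
    rcases Nat.lt_or_ge (γ.val + 1) N with hlt | hge
    · have hv : (γ + 1).val = γ.val + 1 := by rw [← hc, ZMod.val_cast_of_lt hlt]
      rw [cyc, hv, Finset.prod_range_succ, hc, cyc, mul_assoc, div_mul_cancel₀ _ (hf _), mul_comm]
    -- The wrap-around case: the recursion holds here because the full product `htot` is one.
    · have hN : γ.val + 1 = N := by omega
      have h0 : γ + 1 = 0 := by rw [← hc, hN]; simp
      have h2 := htot
      have hr : Finset.range N = Finset.range (γ.val + 1) := by rw [hN]
      rw [hr, Finset.prod_range_succ, hc, h0] at h2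
      rw [h0]
      have h3 := hf 0
      simp only [cyc, ZMod.val_zero, Finset.prod_range_zero, one_mul]
      rw [← mul_div_assoc, div_eq_one_iff_eq h3] at h2
      linear_combination -h2

/-- This turns the reciprocal cyclic functions of the left kernel into cyclic functions of the
inverse character at the same point, so that the right-hand argument applies to them. -/
theorem IsCyc.reflect {N : ℕ} {χ : AddChar (ZMod N) ℂ} {x y : ℂ} {f : ZMod N → ℂ}
    (h : IsCyc χ x y f) : IsCyc χ⁻¹ x y (fun γ => (f (-γ - 1))⁻¹) := by
  refine ⟨fun γ => inv_ne_zero (h.ne _), h.y_ne, fun γ => ?_⟩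
  have h1 := h.step (-(γ + 1) - 1)
  have e : -γ - 1 = -(γ + 1) := by ring
  rw [sub_add_cancel] at h1
  have n1 := h.ne (-(γ + 1) - 1)
  have n2 := h.ne (-(γ + 1))
  simp only [AddChar.inv_apply, e]
  field_simp
  linear_combination h1

end Phase

namespace Data

variable {D : Data} {N : ℕ} [NeZero N]

theorem siteV_mulVec (f : ZMod N → ℂ) (g : ZMod N) : (siteV N *ᵥ f) g = f (g - 1) := by
  simp only [siteV, Matrix.mulVec, dotProduct, Matrix.of_apply, ← sub_eq_iff_eq_add]
  simp

theorem siteV_transpose_mulVec (f : ZMod N → ℂ) (g : ZMod N) :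
    ((siteV N)ᵀ *ᵥ f) g = f (g + 1) := by
  simp only [siteV, Matrix.mulVec, dotProduct, Matrix.of_apply, Matrix.transpose_apply]
  simp

theorem siteX_mulVec (k : ℕ) (f : ZMod N → ℂ) (g : ZMod N) :
    (D.siteX N k *ᵥ f) g = phase (-g) * (D.a k * f g - D.b k * f (g - 1)) := by
  simp [siteX, siteU, ← Matrix.mulVec_mulVec, Matrix.mulVec_diagonal, Matrix.sub_mulVec,
    Matrix.smul_mulVec, siteV_mulVec]

theorem siteY_mulVec (k : ℕ) (f : ZMod N → ℂ) (g : ZMod N) :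
    (D.siteY N k *ᵥ f) g = phase g * (D.c k * f g - D.d k * f (g - 1)) := by
  simp [siteY, siteU, ← Matrix.mulVec_mulVec, Matrix.mulVec_diagonal, Matrix.sub_mulVec,
    Matrix.smul_mulVec, siteV_mulVec]

theorem siteX_transpose_mulVec (k : ℕ) (f : ZMod N → ℂ) (g : ZMod N) :
    ((D.siteX N k)ᵀ *ᵥ f) g
      = D.a k * (phase (-g) * f g) - D.b k * (phase (-(g + 1)) * f (g + 1)) := by
  simp [siteX, siteU, ← Matrix.mulVec_mulVec, Matrix.mulVec_diagonal, Matrix.sub_mulVec,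
    Matrix.smul_mulVec, siteV_transpose_mulVec]

theorem siteY_transpose_mulVec (k : ℕ) (f : ZMod N → ℂ) (g : ZMod N) :
    ((D.siteY N k)ᵀ *ᵥ f) g
      = D.c k * (phase g * f g) - D.d k * (phase (g + 1) * f (g + 1)) := by
  simp [siteY, siteU, ← Matrix.mulVec_mulVec, Matrix.mulVec_diagonal, Matrix.sub_mulVec,
    Matrix.smul_mulVec, siteV_transpose_mulVec]

theorem siteV_psiR (k : ℕ) (q : ZMod N) : siteV N *ᵥ D.psiR k q = D.psiR k (q + 1) := by
  ext g
  rw [siteV_mulVec, psiR, psiR]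
  congr 1; ring

theorem siteV_psiL (k : ℕ) (q : ZMod N) : (siteV N)ᵀ *ᵥ D.psiL k q = D.psiL k (q - 1) := by
  ext g
  rw [siteV_transpose_mulVec, psiL, psiL]
  congr 2; ring

section Site

variable {k : ℕ} (ha : D.a k ≠ 0) (hb : D.b k ≠ 0) (hκ : D.κ k ≠ 0) (hr : D.r k ≠ 0)
  (hrN : D.r k ^ N = D.a k ^ N - D.b k ^ N)

omit [NeZero N] in
include ha hb hrN in
theorem isFermat_one : IsFermat N (D.x1 k) (D.y1 k) := by
  refine ⟨?_, div_ne_zero hb ha⟩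
  rw [x1, y1, div_pow, div_pow, hrN]
  field_simp
  ring

include ha hb hrN in
theorem isFermat_one' : IsFermat N (D.x1 k) (D.b k / (phase (1 : ZMod N) * D.a k)) := by
  refine ⟨?_, div_ne_zero hb (mul_ne_zero (phase_ne _) ha)⟩
  rw [x1, div_pow, div_pow, hrN, mul_pow, phase_pow_card, one_mul]
  field_simp
  ring

-- The recursion of the cyclic function at `(r/a, b/a)` is precisely the eigenvector equation.
include ha hb hrN in
theorem siteX_psiR (q : ZMod N) : D.siteX N k *ᵥ D.psiR k q
    = (D.r k * phase (-q)) • D.psiR k q := by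
  ext g
  have h := (isCyc_cyc (isFermat_one ha hb hrN)).step (g - 1 - q)
  have e : g - 1 - q + 1 = g - q := by ring
  rw [e] at h
  change cyc (D.x1 k) (D.y1 k) (g - q) * (1 - phase (g - q) * D.x1 k) = _ at h
  have e2 : phase (-g) * phase (g - q) = phase (-q) := by
    rw [← phase_add]; congr 1; ring
  rw [siteX_mulVec, Pi.smul_apply, smul_eq_mul, psiR, psiR, ← e2]
  rw [x1, y1] at *
  field_simp at h
  linear_combination phase (-g) * h

include ha hb hrN in
theorem siteX_psiL (q : ZMod N) : (D.siteX N k)ᵀ *ᵥ D.psiL k q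
    = (D.r k * phase (-q)) • D.psiL k q := by
  ext g
  have hc := isCyc_cyc (isFermat_one' ha hb hrN)
  have h := hc.step (g - q - 1)
  have e : g + 1 - q - 1 = g - q := by ring
  have n1 := hc.ne (g - q)
  have n2 := hc.ne (g - q - 1)
  rw [sub_add_cancel] at h
  change cyc _ _ (g - q) * (1 - phase (g - q) * D.x1 k) = _ at h
  have e2 : phase (-q) = phase (-g) * phase (g - q) := by
    rw [← phase_add]; congr 1; ring
  have e3 : phase (-(g + 1)) = phase (-g) * (phase (1 : ZMod N))⁻¹ := by
    rw [neg_add, phase_add]; congr 1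
    exact eq_inv_of_mul_eq_one_left (phase_neg_mul 1)
  have n3 := phase_ne (1 : ZMod N)
  rw [siteX_transpose_mulVec, Pi.smul_apply, smul_eq_mul]
  simp only [psiL, e, e2, e3]
  have hx : D.x1 k * D.a k = D.r k := div_mul_cancel₀ _ ha
  have hy : D.b k / (phase (1 : ZMod N) * D.a k) * (phase 1 * D.a k) = D.b k :=
    div_mul_cancel₀ _ (mul_ne_zero n3 ha)
  rw [← hx]
  generalize cyc (D.x1 k) (D.b k / (phase (1 : ZMod N) * D.a k)) (g - q) = w at *
  generalize cyc (D.x1 k) (D.b k / (phase (1 : ZMod N) * D.a k)) (g - q - 1) = w' at *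
  generalize D.b k / (phase (1 : ZMod N) * D.a k) = y at *
  rw [← hy]
  field_simp
  linear_combination phase (-g) * h

-- The eigenvector equation for `siteX` can be solved for the action of `u`, which becomes a
-- combination of the vectors with labels `q` and `q + 1` (this is `key`). Applying it to both terms
-- of `siteY` gives three neighbouring labels.
include ha hb hκ hr hrN in
theorem siteY_psiR (q : ZMod N) : D.siteY N k *ᵥ D.psiR k q
    = (phase q / D.r k) • ((D.a k * D.c k) • D.psiR k q
      - (D.b k * D.c k + phase (1 : ZMod N) * (D.a k * D.d k)) • D.psiR k (q + 1)
      + (phase (1 : ZMod N) * (D.b k * D.d k / D.κ k * D.κ k)) • D.psiR k (q + 2)) := by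
  ext g
  have key : ∀ g, phase g * D.psiR k q g
      = phase q / D.r k * (D.a k * D.psiR k q g - D.b k * D.psiR k q (g - 1)) := by
    intro g
    have h := congrFun (siteX_psiR ha hb hrN q) g
    rw [siteX_mulVec, Pi.smul_apply, smul_eq_mul] at h
    have e1 := phase_neg_mul g
    have e2 := phase_neg_mul q
    field_simp
    linear_combination (-phase g * phase q) * h
      + phase q * (D.a k * D.psiR k q g - D.b k * D.psiR k q (g - 1)) * e1
      - D.r k * phase g * D.psiR k q g * e2
  have k1 := key g
  have k2 := key (g - 1)
  have e1 : phase g = phase (1 : ZMod N) * phase (g - 1) := by rw [← phase_add]; congr 1; ring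
  have s1 : D.psiR k (q + 1) g = D.psiR k q (g - 1) := by
    simp only [psiR]; congr 1; ring
  have s2 : D.psiR k (q + 2) g = D.psiR k q (g - 1 - 1) := by
    simp only [psiR]; congr 1; ring
  rw [siteY_mulVec, div_mul_cancel₀ _ hκ]
  simp only [Pi.smul_apply, Pi.add_apply, Pi.sub_apply, smul_eq_mul, s1, s2]
  linear_combination D.c k * k1 - D.d k * phase (1 : ZMod N) * k2 - D.d k * D.psiR k q (g - 1) * e1

include ha hb hκ hr hrN in
theorem siteY_psiL (q : ZMod N) : (D.siteY N k)ᵀ *ᵥ D.psiL k q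
    = (phase q / D.r k) • ((D.a k * D.c k) • D.psiL k q
      - (D.a k * D.d k + phase (-1 : ZMod N) * (D.b k * D.c k)) • D.psiL k (q - 1)
      + (phase (-1 : ZMod N) * (D.b k * D.d k / D.κ k * D.κ k)) • D.psiL k (q - 2)) := by
  ext g
  have key : ∀ g, phase g * D.psiL k q g
      = phase q / D.r k * (D.a k * D.psiL k q g
        - D.b k * phase (-1 : ZMod N) * D.psiL k q (g + 1)) := by
    intro g
    have h := congrFun (siteX_psiL ha hb hrN q) g
    rw [siteX_transpose_mulVec, Pi.smul_apply, smul_eq_mul, neg_add, phase_add] at h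
    have e1 := phase_neg_mul g
    have e2 := phase_neg_mul q
    field_simp
    linear_combination (-phase g * phase q) * h
      + phase q * (D.a k * D.psiL k q g - D.b k * phase (-1 : ZMod N) * D.psiL k q (g + 1)) * e1
      - D.r k * phase g * D.psiL k q g * e2
  have k1 := key g
  have k2 := key (g + 1)
  have s1 : D.psiL k (q - 1) g = D.psiL k q (g + 1) := by
    simp only [psiL]; congr 2; ring
  have s2 : D.psiL k (q - 2) g = D.psiL k q (g + 1 + 1) := by
    simp only [psiL]; congr 2; ring
  rw [siteY_transpose_mulVec, div_mul_cancel₀ _ hκ]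
  simp only [Pi.smul_apply, Pi.add_apply, Pi.sub_apply, smul_eq_mul, s1, s2]
  linear_combination D.c k * k1 - D.d k * k2

end Site

/-! ### Consequences of admissibility -/

theorem eigB_eq_eigv {m : ℕ} (ρ : Fin (m + 1) → ZMod N) (lam : ℂ) :
    D.eigB ρ lam = eigv ZMod.stdAddChar (D.R (m + 1)) ρ lam := by
  rw [eigB, eigv, prod_erase_zero, mul_assoc lam]
  rfl

/-- If the amplitude were zero, the eigenvalue would not depend on the corresponding index, against
distinctness when `N ≥ 2`. -/
theorem R_ne {n : ℕ} (hD : D.Admissible N n) (hN : 2 ≤ N) {m k : ℕ} (hm : m + 1 ≤ n)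
    (hk : k ≤ m) : D.R (m + 1) k ≠ 0 := by
  intro h0
  have h1 : (1 : ZMod N) ≠ 0 := by
    have : Fact (1 < N) := ⟨hN⟩
    exact one_ne_zero
  have := @hD.distinct m hm (Pi.single ⟨k, Nat.lt_succ_of_le hk⟩ 1) 0 (by
    funext lam
    simp only [eigB]
    rcases Nat.eq_zero_or_pos k with rfl | hk0
    · simp [h0]
    · have e0 : (Pi.single (⟨k, Nat.lt_succ_of_le hk⟩ : Fin (m + 1)) (1 : ZMod N) :
          Fin (m + 1) → ZMod N) 0 = 0 := by
        rw [Pi.single_eq_of_ne]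
        intro h; exact hk0.ne (congrArg Fin.val h)
      rw [e0]
      congr 1
      refine Finset.prod_congr rfl fun j _ => ?_
      by_cases hj : j = ⟨k, Nat.lt_succ_of_le hk⟩
      · subst hj; simp [h0]
      · rw [Pi.single_eq_of_ne hj]; rfl)
  have := congrFun this ⟨k, Nat.lt_succ_of_le hk⟩
  simp only [Pi.single_eq_same, Pi.zero_apply] at this
  exact h1 this

/-- Equal `N`-th powers would make the amplitudes differ by a root of unity `phase s`. Then two
factors of the eigenvalue can be exchanged by `(u, w) ↦ (w + s, u - s)`, and distinctness would
force `u = w + s` for all `u`, `w`. -/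
theorem R_pow_ne {n : ℕ} (hD : D.Admissible N n) (hN : 2 ≤ N) {m : ℕ} (hm : m + 1 ≤ n)
    {j k : Fin m} (hjk : j ≠ k) : D.R (m + 1) (j + 1) ^ N ≠ D.R (m + 1) (k + 1) ^ N := by
  intro h
  have : Fact (1 < N) := ⟨hN⟩
  obtain ⟨s, hs⟩ := exists_phase_of_pow_eq (R_ne hD hN hm k.2) h
  have h1 : (1 : ZMod N) ≠ 0 := one_ne_zero
  have swap : ∀ u w : ZMod N, (Pi.single j.succ u + Pi.single k.succ w : Fin (m + 1) → ZMod N)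
      = Pi.single j.succ (w + s) + Pi.single k.succ (u - s) := by
    intro u w
    apply hD.distinct m hm
    funext lam
    simp only [eigB_eq_eigv, eigv]
    have z0 : ∀ (i : Fin m) (u : ZMod N), (Pi.single i.succ u : Fin (m + 1) → ZMod N) 0 = 0 :=
      fun i u => Pi.single_eq_of_ne (Fin.succ_ne_zero i).symm _
    simp only [Pi.add_apply, z0]
    congr 1
    have hk : k ∈ Finset.univ.erase j := Finset.mem_erase.2 ⟨hjk.symm, Finset.mem_univ _⟩
    have split : ∀ F : Fin m → ℂ, ∏ l, F l
        = F j * F k * ∏ l ∈ (Finset.univ.erase j).erase k, F l := fun F => by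
      rw [← Finset.mul_prod_erase _ _ (Finset.mem_univ j), ← Finset.mul_prod_erase _ _ hk,
        mul_assoc]
    rw [split, split]
    congr 1
    · have hjk' := (Fin.succ_injective _).ne hjk
      simp only [zeta, Pi.add_apply, Pi.single_eq_same, Pi.single_eq_of_ne hjk',
        Pi.single_eq_of_ne hjk'.symm, add_zero, zero_add, hs]
      change (lam + D.R (m + 1) (k + 1) * phase s * phase (-u))
        * (lam + D.R (m + 1) (k + 1) * phase (-w))
        = (lam + D.R (m + 1) (k + 1) * phase s * phase (-(w + s)))
        * (lam + D.R (m + 1) (k + 1) * phase (-(u - s)))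
      have e1 : phase (-(u - s)) = phase s * phase (-u) := by
        rw [← phase_add]; congr 1; ring
      have e2 : phase (-w) = phase s * phase (-(w + s)) := by
        rw [← phase_add]; congr 1; ring
      rw [e1, e2]; ring
    · refine Finset.prod_congr rfl fun l hl => ?_
      simp only [Finset.mem_erase, Finset.mem_univ, and_true] at hl
      simp [zeta, Pi.single_eq_of_ne ((Fin.succ_injective _).ne hl.1),
        Pi.single_eq_of_ne ((Fin.succ_injective _).ne hl.2)]
  have e : ∀ u w : ZMod N, u = w + s := by
    intro u w
    have := congrFun (swap u w) j.succ
    simpa [Pi.single_eq_of_ne ((Fin.succ_injective _).ne hjk)] using this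
  have h2 := (e 0 0).trans (e 1 0).symm
  exact h1 h2.symm

theorem zeta_ne {n : ℕ} (hD : D.Admissible N n) (hN : 2 ≤ N) {m : ℕ} (hm : m + 1 ≤ n)
    (χ : AddChar (ZMod N) ℂ) (ρ : Fin (m + 1) → ZMod N) (l : Fin m) :
    zeta χ (D.R (m + 1)) ρ l ≠ 0 :=
  mul_ne_zero (R_ne hD hN hm l.2) (χ.val_isUnit _).ne_zero

omit [NeZero N] in
theorem chi_pow_card (χ : AddChar (ZMod N) ℂ) (a : ZMod N) : χ a ^ N = 1 := by
  rw [← AddChar.map_nsmul_eq_pow]; simp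

theorem zeta_injective {n : ℕ} (hD : D.Admissible N n) (hN : 2 ≤ N) {m : ℕ} (hm : m + 1 ≤ n)
    (χ : AddChar (ZMod N) ℂ) (ρ : Fin (m + 1) → ZMod N) :
    Function.Injective (zeta χ (D.R (m + 1)) ρ) := by
  intro j k h
  by_contra hjk
  apply R_pow_ne hD hN hm hjk
  have := congrArg (· ^ N) h
  simpa [zeta, mul_pow, chi_pow_card] using this

theorem avgMonodromy_succ (D : Data) (N m : ℕ) : D.avgMonodromy N (m + 1) 0 1
    = D.avgMonodromy N m 0 0 * (Polynomial.C 0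
        + Polynomial.C (-((-1) ^ N * (D.a (m + 1) ^ N - D.b (m + 1) ^ N))) * Polynomial.X)
      + D.avgMonodromy N m 0 1 * (Polynomial.C ((D.b (m + 1) * D.d (m + 1) / D.κ (m + 1)) ^ N)
        + Polynomial.C (-((-1) ^ N * (D.a (m + 1) * D.c (m + 1)) ^ N)) * Polynomial.X) := by
  rw [avgMonodromy, Matrix.mul_apply, Fin.sum_univ_two]
  congr 2 <;> simp [avgL, sub_eq_add_neg]

/-- These extreme coefficients, compared with the factorization `R_avg`, yield the recursions
`Rt_pow` and `R_zero_pow`. -/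
theorem avgMonodromy_coeff (D : Data) (N m : ℕ) :
    (D.avgMonodromy N m 0 0).natDegree ≤ m ∧ (D.avgMonodromy N m 0 0).coeff 0 = 1 ∧
    (D.avgMonodromy N m 0 0).coeff m
      = (-(-1) ^ N) ^ m * (∏ s ∈ Finset.range m, D.κ (s + 1)) ^ N ∧
    (D.avgMonodromy N m 0 1).natDegree ≤ m ∧ (D.avgMonodromy N m 0 1).coeff 0 = 0 := by
  have hlin : ∀ x y : ℂ, (Polynomial.C x + Polynomial.C y * Polynomial.X).natDegree ≤ 1 := by
    intro x y; rw [add_comm]; exact Polynomial.natDegree_linear_le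
  induction m with
  | zero => simp [avgMonodromy]
  | succ m ih =>
    obtain ⟨h1, h2, h3, h4, h5⟩ := ih
    have eA : D.avgMonodromy N (m + 1) 0 0 = D.avgMonodromy N m 0 0
          * (Polynomial.C 1 + Polynomial.C (-((-1) ^ N * D.κ (m + 1) ^ N)) * Polynomial.X)
        + D.avgMonodromy N m 0 1 * (Polynomial.C (D.c (m + 1) ^ N - D.d (m + 1) ^ N)
          + Polynomial.C 0 * Polynomial.X) := by
      rw [avgMonodromy, Matrix.mul_apply, Fin.sum_univ_two]
      congr 2 <;> simp [avgL, sub_eq_add_neg]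
    have eB := avgMonodromy_succ D N m
    have h6 : (D.avgMonodromy N m 0 0).coeff (m + 1) = 0 :=
      Polynomial.coeff_eq_zero_of_natDegree_lt (by omega)
    have h7 : (D.avgMonodromy N m 0 1).coeff (m + 1) = 0 :=
      Polynomial.coeff_eq_zero_of_natDegree_lt (by omega)
    rw [eA, eB]
    refine ⟨?_, ?_, ?_, ?_, ?_⟩
    · exact Polynomial.natDegree_add_le_of_degree_le
        (Polynomial.natDegree_mul_le_of_le h1 (hlin _ _))
        (Polynomial.natDegree_mul_le_of_le h4 (hlin _ _))
    · simp only [Polynomial.coeff_add, Polynomial.mul_coeff_zero, h2, h5]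
      simp
    · simp only [mul_add, Polynomial.coeff_add, Polynomial.coeff_mul_C, ← mul_assoc,
        Polynomial.coeff_mul_X, h6, h7, h3, Finset.prod_range_succ, mul_pow, pow_succ]
      ring
    · exact Polynomial.natDegree_add_le_of_degree_le
        (Polynomial.natDegree_mul_le_of_le h1 (hlin _ _))
        (Polynomial.natDegree_mul_le_of_le h4 (hlin _ _))
    · simp only [Polynomial.coeff_add, Polynomial.mul_coeff_zero, h2, h5]
      simp

end Data

end

/-! ### The Fermat points of the kernel, and the induction over the chain. -/

section

theorem prod_fin_add_one {m : ℕ} (F : ℕ → ℂ) :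
    ∏ l : Fin m, F (l + 1) = ∏ s ∈ Finset.Ico 1 (m + 1), F s := by
  rw [Finset.prod_Ico_eq_prod_range, Fin.prod_univ_eq_prod_range (fun i => F (i + 1))]
  exact Finset.prod_congr rfl fun i _ => by rw [add_comm]

theorem prod_erase_fin_add_one {m : ℕ} (F : ℕ → ℂ) (l : Fin m) :
    ∏ j ∈ Finset.univ.erase l, F (j + 1)
      = ∏ s ∈ (Finset.Ico 1 (m + 1)).erase (l + 1), F s := by
  refine Finset.prod_nbij (fun j : Fin m => (j : ℕ) + 1) (fun j hj => ?_) (fun i _ j _ h => ?_)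
    (fun s hs => ?_) (fun _ _ => rfl)
  · have := Finset.ne_of_mem_erase hj
    have h2 := j.2
    simp only [Finset.mem_erase, Finset.mem_Ico, ne_eq, add_left_inj, Fin.val_inj]
    exact ⟨this, by omega, by omega⟩
  · exact Fin.ext (Nat.succ_injective h)
  · simp only [Finset.coe_erase, Finset.coe_Ico, Set.mem_sdiff, Set.mem_Ico,
      Set.mem_singleton_iff] at hs
    refine ⟨⟨s - 1, by omega⟩, ?_, by simp; omega⟩
    simp only [Finset.coe_erase, Finset.coe_univ, Set.mem_sdiff, Set.mem_univ, true_and,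
      Set.mem_singleton_iff]
    intro h
    have := congrArg Fin.val h
    simp only at this
    omega

namespace Data

variable {D : Data} {N : ℕ} [NeZero N]

theorem Rt_succ (m : ℕ) :
    D.Rt (m + 1) = D.R (m + 1) 0 * ∏ l : Fin m, D.R (m + 1) (l + 1) := by
  rw [Rt, Finset.prod_range_succ', mul_comm, Fin.prod_univ_eq_prod_range
    (fun i => D.R (m + 1) (i + 1))]

theorem Rt_ne {n : ℕ} (hD : D.Admissible N n) (hN : 2 ≤ N) {m : ℕ} (hm : m + 1 ≤ n) :
    D.Rt (m + 1) ≠ 0 :=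
  Finset.prod_ne_zero_iff.2 fun _ hk =>
    R_ne hD hN hm (Nat.le_of_lt_succ (Finset.mem_range.1 hk))

theorem avg_coeff {n : ℕ} (hD : D.Admissible N n) {m : ℕ} (hm : m + 1 ≤ n) :
    (D.avgMonodromy N (m + 1) 0 1).coeff 1 = -(-1) ^ N * D.Rt (m + 1) ^ N ∧
    (D.avgMonodromy N (m + 1) 0 1).coeff (m + 1)
      = (-(-1) ^ N) ^ (m + 1) * D.R (m + 1) 0 ^ N := by
  rw [hD.R_avg (m + 1) (by omega) hm, mul_assoc]
  set P : ℂ[X] := ∏ k ∈ Finset.Ico 1 (m + 1),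
    (Polynomial.C (D.R (m + 1) k ^ N) - Polynomial.C ((-1) ^ N) * Polynomial.X) with hP
  have h0 : P.coeff 0 = (∏ l : Fin m, D.R (m + 1) (l + 1)) ^ N := by
    rw [Polynomial.coeff_zero_eq_eval_zero, hP, Polynomial.eval_prod, prod_fin_add_one,
      ← Finset.prod_pow]
    simp
  have h1 : P.coeff m = (-(-1) ^ N) ^ m := by
    have := Polynomial.coeff_prod_of_natDegree_le (s := Finset.Ico 1 (m + 1))
      (fun k => Polynomial.C (D.R (m + 1) k ^ N) - Polynomial.C ((-1 : ℂ) ^ N) * Polynomial.X) 1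
      (fun k _ => by
        refine (Polynomial.natDegree_sub_le _ _).trans ?_
        rw [Polynomial.natDegree_C]
        exact max_le (Nat.zero_le _) (Polynomial.natDegree_C_mul_le _ _ |>.trans
          Polynomial.natDegree_X_le))
    rw [Nat.card_Ico, Nat.add_sub_cancel, mul_one] at this
    have h2 (k : ℕ) : (Polynomial.C (D.R (m + 1) k ^ N)
        - Polynomial.C ((-1 : ℂ) ^ N) * Polynomial.X).coeff 1 = -(-1) ^ N := by
      rw [Polynomial.coeff_sub, Polynomial.coeff_C_mul, Polynomial.coeff_C_of_ne_zero one_ne_zero,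
        Polynomial.coeff_X_one, mul_one, zero_sub]
    rw [hP, this, Finset.prod_congr rfl fun k _ => h2 k, Finset.prod_const, Nat.card_Ico,
      Nat.add_sub_cancel]
  constructor
  · rw [Polynomial.coeff_C_mul, Polynomial.coeff_X_mul, h0, Rt_succ]; ring
  · rw [Polynomial.coeff_C_mul, Polynomial.coeff_X_mul, h1]; ring

/-- This compares the coefficients of the first power of the variable in the averaged recursion.
Division by the left side gives the Fermat equation of `p̃_n`; the top coefficients give that of
`p_{n,0}` in the same way. -/
theorem Rt_pow {n : ℕ} (hD : D.Admissible N n) {m : ℕ} (hm : m + 2 ≤ n) :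
    D.Rt (m + 2) ^ N = D.r (m + 2) ^ N
      + (D.b (m + 2) * D.d (m + 2) / D.κ (m + 2)) ^ N * D.Rt (m + 1) ^ N := by
  have h := (avg_coeff hD (m := m + 1) hm).1
  obtain ⟨-, h2, -, -, h5⟩ := avgMonodromy_coeff D N (m + 1)
  rw [avgMonodromy_succ] at h
  simp only [mul_add, Polynomial.coeff_add, Polynomial.coeff_mul_C, ← mul_assoc,
    Polynomial.coeff_mul_X, (avg_coeff hD (m := m) (by omega)).1] at h
  have he : ((-1 : ℂ) ^ N) ≠ 0 := pow_ne_zero _ (by norm_num)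
  have hr := (hD.r_pow (m + 2) (by omega) hm).1
  apply mul_left_cancel₀ he
  simp [h2, h5] at h
  rw [hr]
  linear_combination h

theorem R_zero_pow {n : ℕ} (hD : D.Admissible N n) {m : ℕ} (hm : m + 2 ≤ n) :
    D.R (m + 2) 0 ^ N = (∏ s ∈ Finset.range (m + 1), D.κ (s + 1)) ^ N * D.r (m + 2) ^ N
      + (D.a (m + 2) * D.c (m + 2)) ^ N * D.R (m + 1) 0 ^ N := by
  have h := (avg_coeff hD (m := m + 1) hm).2
  obtain ⟨h1, h2, h3, h4, h5⟩ := avgMonodromy_coeff D N (m + 1)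
  rw [avgMonodromy_succ] at h
  simp only [mul_add, Polynomial.coeff_add, Polynomial.coeff_mul_C, ← mul_assoc,
    Polynomial.coeff_mul_X, (avg_coeff hD (m := m) (by omega)).2, h3,
    Polynomial.coeff_eq_zero_of_natDegree_lt (h1.trans_lt (Nat.lt_succ_self _)),
    Polynomial.coeff_eq_zero_of_natDegree_lt (h4.trans_lt (Nat.lt_succ_self _))] at h
  have he : (-(-1 : ℂ) ^ N) ^ (m + 2) ≠ 0 := pow_ne_zero _ (neg_ne_zero.2
    (pow_ne_zero _ (by norm_num)))
  have hr := (hD.r_pow (m + 2) (by omega) hm).1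
  apply mul_left_cancel₀ he
  rw [hr]
  simp only [pow_succ _ (m + 1)] at h ⊢
  linear_combination -h

theorem y0_succ (m : ℕ) : D.y0 (m + 2)
    = (∏ s ∈ Finset.range (m + 1), D.κ (s + 1)) * D.r (m + 2) / D.R (m + 2) 0 := by
  rw [y0, ← prod_fin_add_one, Fin.prod_univ_eq_prod_range (fun i => D.κ (i + 1))]

theorem prod_κ_ne {n : ℕ} (hD : D.Admissible N n) {m : ℕ} (hm : m ≤ n) :
    ∏ s ∈ Finset.range m, D.κ (s + 1) ≠ 0 :=
  Finset.prod_ne_zero_iff.2 fun s hs =>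
    (hD.param_ne (s + 1) (by omega) (by have := Finset.mem_range.1 hs; omega)).2.2.2.2

theorem isFermat_zero {n : ℕ} (hD : D.Admissible N n) (hN : 2 ≤ N) {m : ℕ} (hm : m + 2 ≤ n) :
    IsFermat N (D.x0 (m + 2)) (D.y0 (m + 2)) := by
  have hR := R_ne hD hN (m := m + 1) hm (Nat.zero_le _)
  have hr := (hD.r_pow (m + 2) (by omega) hm).2
  constructor
  · have h := R_zero_pow hD hm
    have hx : D.x0 (m + 2) = D.R (m + 1) 0 * D.a (m + 2) * D.c (m + 2) / D.R (m + 2) 0 := rfl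
    rw [hx, y0_succ, div_pow, div_pow, ← add_div, div_eq_one_iff_eq (pow_ne_zero _ hR), h]
    simp only [mul_pow]
    ring
  · rw [y0_succ]
    exact div_ne_zero (mul_ne_zero (prod_κ_ne hD (by omega)) hr) hR

theorem isFermat_tilde {n : ℕ} (hD : D.Admissible N n) (hN : 2 ≤ N) {m : ℕ} (hm : m + 2 ≤ n) :
    IsFermat N (D.xt1 (m + 2)) (D.yt1 (m + 2)) := by
  have hR := Rt_ne hD hN (m := m + 1) hm
  have hR' := Rt_ne hD hN (m := m) (by omega)
  obtain ⟨-, hb, -, hd, hκ⟩ := hD.param_ne (m + 2) (by omega) hm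
  have hy : D.yt1 (m + 2) = D.b (m + 2) * D.d (m + 2) * D.Rt (m + 1)
    / (D.κ (m + 2) * D.Rt (m + 2)) := rfl
  constructor
  · have h := Rt_pow hD hm
    have hx : D.xt1 (m + 2) = D.r (m + 2) / D.Rt (m + 2) := rfl
    have hy' : D.yt1 (m + 2) = D.b (m + 2) * D.d (m + 2) / D.κ (m + 2) * D.Rt (m + 1)
        / D.Rt (m + 2) := by rw [hy]; field_simp
    rw [hx, hy', div_pow, div_pow, ← add_div, div_eq_one_iff_eq (pow_ne_zero _ hR), h, mul_pow]
  · rw [hy]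
    exact div_ne_zero (mul_ne_zero (mul_ne_zero hb hd) hR') (mul_ne_zero hκ hR)

end Data

/-- The data that are common to the constructions of the right and of the left vectors. -/
structure Frame (D : Data) (N : ℕ) [NeZero N] (n : ℕ) where
  χ : AddChar (ZMod N) ℂ
  (e f : ℕ → ℂ)
  (A B : (m : ℕ) → ℂ → Matrix (Fin m → ZMod N) (Fin m → ZMod N) ℂ)
  V : (m : ℕ) → Matrix (Fin m → ZMod N) (Fin m → ZMod N) ℂ
  v : Matrix (ZMod N) (ZMod N) ℂ
  (X Y : ℕ → Matrix (ZMod N) (ZMod N) ℂ)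
  ψ : ℕ → ZMod N → ZMod N → ℂ
  W : ℂ → ℂ → ZMod N → ℂ
  S : ℕ → ℕ → ZMod N → ℂ
  A_zero : ∀ lam, A 0 lam = 1
  B_zero : ∀ lam, B 0 lam = 0
  V_zero : V 0 = 1
  A_succ : ∀ m lam, A (m + 1) lam
    = tens (A m lam) (1 + (lam * D.κ (m + 1)) • v) + tens (B m lam) (Y (m + 1))
  B_succ : ∀ m lam, B (m + 1) lam = tens (A m lam) (lam • X (m + 1))
    + tens (B m lam) ((lam * (D.a (m + 1) * D.c (m + 1))) • (1 : Matrix _ _ ℂ)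
      + (D.b (m + 1) * D.d (m + 1) / D.κ (m + 1)) • v)
  V_succ : ∀ m, V (m + 1) = tens (V m) v
  polyDep : ∀ m, PolyDep m (A m) 1 ((∏ s ∈ Finset.range m, D.κ (s + 1)) • V m)
  v_mulVec : ∀ k q, v *ᵥ ψ k q = ψ k (q + 1)
  X_mulVec : ∀ k q, 1 ≤ k → k ≤ n → X k *ᵥ ψ k q = (D.r k * χ (-q)) • ψ k q
  Y_mulVec : ∀ k q, 1 ≤ k → k ≤ n → Y k *ᵥ ψ k q = (χ q / D.r k) • ((D.a k * D.c k) • ψ k q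
    - (e k + χ 1 * f k) • ψ k (q + 1)
    + (χ 1 * (D.b k * D.d k / D.κ k * D.κ k)) • ψ k (q + 2))
  isCyc : ∀ x y, IsFermat N x y → IsCyc χ x y (W x y)
  S_step : ∀ m l γ, m + 1 < n → l < m →
    quad χ (D.κ (m + 1)) (D.a (m + 1) * D.c (m + 1)) (D.b (m + 1) * D.d (m + 1) / D.κ (m + 1))
        (e (m + 1)) (f (m + 1)) (-(D.R (m + 1) (l + 1) * χ (-γ))) * S (m + 1) (l + 1) γ
      = -(D.b (m + 1) * D.c (m + 1) * χ (-1) * D.yp (m + 1) (l + 1) * D.yt (m + 1) (l + 1))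
        * (D.R (m + 1) (l + 1) * χ (-γ)) * S (m + 1) (l + 1) (γ + 1)

namespace Frame

variable {D : Data} {N : ℕ} [NeZero N] {n : ℕ} (F : Frame D N n)

/-- The kernel of the step from `m + 1` to `m + 2` sites. -/
def Q (m : ℕ) : (Fin (m + 1) → ZMod N) → ZMod N → (Fin (m + 2) → ZMod N) → ℂ :=
  kern F.χ (F.W (D.x0 (m + 2)) (D.y0 (m + 2))) (F.W (D.xt1 (m + 2)) (D.yt1 (m + 2)))
    (fun l k => F.W (D.R (m + 2) (k + 1) / D.R (m + 1) (l + 1))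
      (D.y (m + 1) (l + 1) (m + 2) (k + 1)))
    (fun j l => F.W (D.R (m + 1) (l + 1) / D.R (m + 1) (j + 1))
      (D.y (m + 1) (j + 1) (m + 1) (l + 1)))
    (fun l => F.S (m + 1) (l + 1))

/-- The vectors of the chain of `m + 1` sites. -/
def vec : (m : ℕ) → (Fin (m + 1) → ZMod N) → (Fin (m + 1) → ZMod N) → ℂ
  | 0 => fun ρ => tvec (fun _ => 1) (F.ψ 1 (ρ 0))
  | m + 1 => stepVec (F.Q m) (vec m) (F.ψ (m + 2))

/-- The coefficients in the action of `A` at the zeros of the eigenvalue. -/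
def phi (m : ℕ) (l : Fin m) (σ : Fin (m + 1) → ZMod N) : ℂ :=
  -(D.Rt m / D.r (m + 1)) * (∏ s ∈ Finset.Ico 1 m, D.y m s (m + 1) (l + 1))
    * F.χ (σ 0 - ∑ k, σ k)
    * quad F.χ (D.κ (m + 1)) (D.a (m + 1) * D.c (m + 1))
        (D.b (m + 1) * D.d (m + 1) / D.κ (m + 1)) (F.e (m + 1)) (F.f (m + 1))
        (-zeta F.χ (D.R (m + 1)) σ l)

theorem isKernel (hD : D.Admissible N n) (hN : 2 ≤ N) {m : ℕ} (hm : m + 2 ≤ n) :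
    IsKernel F.χ (D.R (m + 1)) (D.R (m + 2)) (D.r (m + 2)) (D.κ (m + 2))
      (D.a (m + 2) * D.c (m + 2)) (D.b (m + 2) * D.d (m + 2) / D.κ (m + 2))
      (∏ s ∈ Finset.range (m + 1), D.κ (s + 1)) (F.e (m + 2)) (F.f (m + 2))
      (F.phi m) (F.phi (m + 1)) (F.Q m) := by
  have hm' : m + 1 ≤ n := by omega
  have hr := (hD.r_pow (m + 2) (by omega) hm).2
  have hr₁ := (hD.r_pow (m + 1) (by omega) hm').2
  have hR0 := Data.R_ne hD hN hm' (Nat.zero_le _)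
  have hR0' := Data.R_ne hD hN (m := m + 1) hm (Nat.zero_le _)
  have hRt := Data.Rt_ne hD hN (m := m + 1) hm
  obtain ⟨-, -, -, -, hκ⟩ := hD.param_ne (m + 2) (by omega) hm
  -- The coefficient `phi` of the longer chain has to be the one that `isKernel_kern` produces, for
  -- otherwise the induction could not be iterated.
  have hphi : F.phi (m + 1) = fun (k : Fin (m + 1)) ρ =>
      -((D.R (m + 1) 0 * ∏ l : Fin m, D.R (m + 1) (l + 1))
      / D.r (m + 2)) * (∏ l : Fin m, D.y (m + 1) (l + 1) (m + 2) (k + 1))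
      * F.χ (ρ 0 - ∑ k, ρ k)
      * quad F.χ (D.κ (m + 2)) (D.a (m + 2) * D.c (m + 2))
        (D.b (m + 2) * D.d (m + 2) / D.κ (m + 2)) (F.e (m + 2)) (F.f (m + 2))
        (-zeta F.χ (D.R (m + 2)) ρ k) := by
    funext k ρ
    rw [← Data.Rt_succ, prod_fin_add_one (fun s => D.y (m + 1) s (m + 2) (k + 1))]
    rfl
  rw [hphi]
  refine isKernel_kern (x₀ := D.x0 (m + 2)) (y₀ := D.y0 (m + 2)) (x₁ := D.xt1 (m + 2))
    (y₁ := D.yt1 (m + 2)) (κ₀ := D.κ (m + 1)) (α₀ := D.a (m + 1) * D.c (m + 1))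
    (β₀ := D.b (m + 1) * D.d (m + 1) / D.κ (m + 1)) (e₀ := F.e (m + 1)) (f₀ := F.f (m + 1))
    (yg := fun l k => D.y (m + 1) (l + 1) (m + 2) (k + 1))
    (yh := fun j l => D.y (m + 1) (j + 1) (m + 1) (l + 1))
    (cs := fun l => -(D.b (m + 1) * D.c (m + 1) * F.χ (-1) * D.yp (m + 1) (l + 1)
      * D.yt (m + 1) (l + 1)))
    (cφ := fun l => -(D.Rt m / D.r (m + 1)) * (∏ s ∈ Finset.Ico 1 m, D.y m s (m + 1) (l + 1)))
    (fun l hl => Data.R_ne hD hN hm' hl) hr (fun σ => Data.zeta_injective hD hN hm' F.χ σ)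
    (F.isCyc _ _ (Data.isFermat_zero hD hN hm)) ?_ ?_
    (F.isCyc _ _ (Data.isFermat_tilde hD hN hm)) ?_ ?_
    (fun l k => F.isCyc _ _ (hD.fermat_up (m + 1) (l + 1) (k + 1) (by omega) (by omega)
      (by have := l.2; omega) (by omega) (by have := k.2; omega)))
    (fun j l hjl => F.isCyc _ _ (hD.fermat_same (m + 1) (j + 1) (l + 1) (by omega) (by omega)
      (by have := j.2; omega) (by omega) (by have := l.2; omega)
      (fun h => hjl (Fin.ext (Nat.succ_injective h)))))
    (fun l γ => F.S_step m l γ (by omega) l.2) (fun l => ?_)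
  · rw [Data.x0, div_mul_cancel₀ _ hR0']; exact mul_assoc _ _ _
  · rw [Data.y0_succ, div_mul_cancel₀ _ hR0']
  · rw [← Data.Rt_succ, Data.xt1, div_mul_cancel₀ _ hRt]
  · rw [← Data.Rt_succ, ← Data.Rt_succ]
    change D.b (m + 2) * D.d (m + 2) * D.Rt (m + 1) / (D.κ (m + 2) * D.Rt (m + 2))
      * D.Rt (m + 2) = _
    field_simp
  -- The condition `hc` of `isKernel_kern` is the phase relation, with the products over `j ≠ l`
  -- cleared from the denominator and `χ (-1)` cancelled against `χ 1`.
  · have hp := hD.phases (m + 1) (l + 1) (by omega) (by omega) (by have := l.2; omega)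
    have hIcc : Finset.Icc 1 (m + 1) = Finset.Ico 1 (m + 2) := rfl
    have hne : ∏ j ∈ Finset.univ.erase l, D.y (m + 1) (j + 1) (m + 1) (l + 1) ≠ 0 :=
      Finset.prod_ne_zero_iff.2 fun j hj =>
        (hD.fermat_same (m + 1) (j + 1) (l + 1) (by omega) (by omega)
          (by have := j.2; omega) (by omega) (by have := l.2; omega)
          (fun h => Finset.ne_of_mem_erase hj (Fin.ext (Nat.succ_injective h)))).2
    rw [← prod_erase_fin_add_one (fun j => D.y (m + 1) (l + 1) (m + 1) j
      / D.y (m + 1) j (m + 1) (l + 1)), hIcc,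
      ← prod_fin_add_one (fun k => D.y (m + 1) (l + 1) (m + 2) k), Finset.prod_div_distrib,
      Data.Rt_succ, Nat.add_sub_cancel] at hp
    have hχ := chi_mul_chi_neg (χ := F.χ) 1
    field_simp at hp ⊢
    linear_combination hp + D.r (m + 2) * D.Rt m * (∏ s ∈ Finset.Ico 1 m, D.y m s (m + 1) (l + 1))
      * D.b (m + 1) * D.c (m + 1) * D.yp (m + 1) (l + 1) * D.yt (m + 1) (l + 1)
      * (∏ j ∈ Finset.univ.erase l, D.y (m + 1) (l + 1) (m + 1) (j + 1)) * hχ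

/-- For one site `B` is `lam` times `X`, its eigenvalue has no nonzero zeros, and the condition
`shiftA` is empty. -/
theorem shiftFamily (hD : D.Admissible N n) (hN : 2 ≤ N) {m : ℕ} (hm : m + 1 ≤ n) :
    ShiftFamily F.χ (D.R (m + 1)) (F.A (m + 1)) (F.B (m + 1)) (F.V (m + 1)) (F.vec m)
      (F.phi m) := by
  induction m with
  | zero =>
    refine ⟨fun ρ lam => ?_, fun ρ => ?_, fun ρ l => l.elim0⟩
    · rw [F.B_succ, F.A_zero, F.B_zero, tens_zero_left, add_zero, vec, tens_mulVec,
        Matrix.one_mulVec, Matrix.smul_mulVec, F.X_mulVec 1 _ le_rfl hm, tvec_smul_right,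
        tvec_smul_right, smul_smul, eigv, hD.R_one]
      simp
    · rw [F.V_succ, F.V_zero, vec, tens_mulVec, Matrix.one_mulVec, F.v_mulVec]
      simp
  | succ m ih =>
    have hA : F.A (m + 2) = fun lam => _ := funext fun lam => F.A_succ (m + 1) lam
    have hB : F.B (m + 2) = fun lam => _ := funext fun lam => F.B_succ (m + 1) lam
    rw [hA, hB, F.V_succ (m + 1)]
    exact (ih (by omega)).step (F.polyDep (m + 1)) (Data.zeta_ne hD hN (by omega) F.χ)
      (Data.zeta_injective hD hN (by omega) F.χ) (Data.zeta_ne hD hN hm F.χ)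
      (hD.r_pow (m + 2) (by omega) hm).2 (F.isKernel hD hN hm) (F.v_mulVec (m + 2))
      (fun q => F.X_mulVec (m + 2) q (by omega) hm) (fun q => F.Y_mulVec (m + 2) q (by omega) hm)

end Frame

end

/-! ### The right and the left eigenvectors as two instances of a frame. -/

section

variable {D : Data} {N : ℕ} [NeZero N] {n : ℕ}

omit [NeZero N] in
theorem prod_addChar (χ : AddChar (ZMod N) ℂ) {ι : Type*} (s : Finset ι) (f : ι → ZMod N) :
    ∏ l ∈ s, χ (f l) = χ (∑ l ∈ s, f l) := by
  classical
  induction s using Finset.induction_on with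
  | empty => simp
  | insert a s ha ih => rw [Finset.prod_insert ha, Finset.sum_insert ha, ih, AddChar.map_add_eq_mul]

/-- The quantum determinant is a product of two linear factors (`hq`), which are the recursion
factors of the cyclic functions at `p_{n,l}` and `p̃_{n,l}`. -/
theorem quad_factor_right {a b c d κ R xp xt yp yt z u w wi P₀ P₁ T₀ T₁ : ℂ} (hκ : κ ≠ 0)
    (hX : xp * b = a * κ * R) (hT : xt * (κ * c * R) = d) (hw : w * wi = 1) (hu : z * wi * u = 1)
    (hP : P₀ * (1 - z * xp) = yp * P₁) (hQ : T₁ * (1 - u * xt) = yt * T₀)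
    (h₀ : T₀ ≠ 0) (h₁ : T₁ ≠ 0) :
    (b * d / κ + (-(R * z)) ^ 2 * κ * (a * c) / w + -(R * z) * (b * c / w + a * d)) * (P₀ / T₀)
      = -(b * c * wi * yp * yt) * (R * z) * (P₁ / T₁) := by
  have hq : b * d / κ + (-(R * z)) ^ 2 * κ * (a * c) / w + -(R * z) * (b * c / w + a * d)
      = -(b * c * wi) * (R * z) * (1 - z * xp) * (1 - u * xt) := by
    rw [div_eq_mul_inv _ w, div_eq_mul_inv _ w, inv_eq_of_mul_eq_one_right hw, ← hT,
      show b * (xt * (κ * c * R)) / κ = b * xt * c * R by field_simp]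
    linear_combination (-c * R * z ^ 2 * wi + R * z * c * xt) * hX
      + (-b * c * R * xt + b * c * R * z * xp * xt) * hu
  rw [hq]
  field_simp
  linear_combination (-b * c * wi * R * z) * (T₁ * (1 - u * xt) * hP + yp * P₁ * hQ)

/-- For the inverse character the factorization lacks the factor `wi`. The additional phase in the
left function `S`, here `t` and after the shift `p`, supplies it. -/
theorem quad_factor_left {a b c d κ R xp xt yp yt z u t p w wi P₀ P₁ T₀ T₁ : ℂ} (hκ : κ ≠ 0)
    (hX : xp * b = a * κ * R) (hT : xt * (κ * c * R) = d) (hw : w * wi = 1) (hu : z * wi = u)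
    (ht : z * t = 1) (hp : t = p * wi)
    (hP : P₁ * (1 - u * xp) = yp * P₀) (hQ : T₀ * (1 - t * xt) = yt * T₁)
    (h₀ : P₀ ≠ 0) (h₁ : P₁ ≠ 0) :
    (b * d / κ + (-(R * z)) ^ 2 * κ * (a * c) / w + -(R * z) * (a * d / w + b * c))
        * (t * T₀ / P₀)
      = -(b * c * wi * yp * yt) * (R * z) * (p * T₁ / P₁) := by
  have hq : b * d / κ + (-(R * z)) ^ 2 * κ * (a * c) / w + -(R * z) * (a * d / w + b * c)
      = -(b * c) * (R * z) * (1 - u * xp) * (1 - t * xt) := by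
    rw [div_eq_mul_inv _ w, div_eq_mul_inv _ w, inv_eq_of_mul_eq_one_right hw, ← hT, ← hu,
      show b * (xt * (κ * c * R)) / κ = b * xt * c * R by field_simp]
    linear_combination (-c * R * z ^ 2 * wi + R * z * c * xt * wi) * hX
      + (-b * c * R * xt + b * c * R * z * wi * xp * xt) * ht
  rw [hq, hp]
  rw [hp] at hQ
  field_simp
  linear_combination (-b * c * wi * R * z * p) * (T₀ * (1 - p * wi * xt) * hP + yp * P₀ * hQ)

namespace Data

/-- The frame of the right vectors. -/
def rightFrame (hD : D.Admissible N n) (hN : 2 ≤ N) : Frame D N n where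
  χ := ZMod.stdAddChar
  e k := D.b k * D.c k
  f k := D.a k * D.d k
  A := D.aOp N
  B := D.bOp N
  V := shiftOp N
  v := siteV N
  X := D.siteX N
  Y := D.siteY N
  ψ := D.psiR
  W := cyc
  S m l γ := cyc (D.xp m l) (D.yp m l) (-γ) / cyc (D.xt m l) (D.yt m l) γ
  A_zero := D.aOp_zero N
  B_zero := D.bOp_zero N
  V_zero := rfl
  A_succ := D.aOp_succ N
  B_succ := D.bOp_succ N
  V_succ _ := rfl
  polyDep m := (D.polyDep_ops N m).1
  v_mulVec := siteV_psiR
  X_mulVec k q h1 hk := by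
    obtain ⟨ha, hb, -, -, -⟩ := hD.param_ne k h1 hk
    exact siteX_psiR ha hb (hD.r_pow k h1 hk).1 q
  Y_mulVec k q h1 hk := by
    obtain ⟨ha, hb, -, -, hκ⟩ := hD.param_ne k h1 hk
    exact siteY_psiR ha hb hκ (hD.r_pow k h1 hk).2 (hD.r_pow k h1 hk).1 q
  isCyc _ _ := isCyc_cyc
  S_step m l γ hm hl := by
    obtain ⟨ha, hb, hc, hd, hκ⟩ := hD.param_ne (m + 1) (by omega) (by omega)
    have hR := R_ne hD hN (m := m) (k := l + 1) (by omega) hl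
    obtain ⟨hp, ht⟩ := hD.fermat_p (m + 1) (l + 1) (by omega) (by omega) (by omega)
    have sp := (isCyc_cyc hp).step (-(γ + 1))
    have st := (isCyc_cyc ht).step γ
    have nt := (isCyc_cyc ht).ne γ
    have nt' := (isCyc_cyc ht).ne (γ + 1)
    rw [show -(γ + 1) + 1 = -γ by ring] at sp
    exact quad_factor_right hκ (div_mul_cancel₀ _ hb)
      (div_mul_cancel₀ _ (mul_ne_zero (mul_ne_zero hκ hc) hR)) (chi_mul_chi_neg 1)
      (by rw [← AddChar.map_add_eq_mul, ← AddChar.map_add_eq_mul,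
        show -γ + -1 + (γ + 1) = 0 by ring, AddChar.map_zero_eq_one]) sp st nt nt'

/-- The frame of the left vectors. -/
def leftFrame (hD : D.Admissible N n) (hN : 2 ≤ N) : Frame D N n where
  χ := (ZMod.stdAddChar : AddChar (ZMod N) ℂ)⁻¹
  e k := D.a k * D.d k
  f k := D.b k * D.c k
  A m lam := (D.aOp N m lam)ᵀ
  B m lam := (D.bOp N m lam)ᵀ
  V m := (shiftOp N m)ᵀ
  v := (siteV N)ᵀ
  X k := (D.siteX N k)ᵀ
  Y k := (D.siteY N k)ᵀ
  ψ k q := D.psiL k (-q)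
  W x y γ := (cyc x y (-γ - 1))⁻¹
  S m l γ := phase (-γ) * cyc (D.xt m l) (D.yt m l) (-γ) / cyc (D.xp m l) (D.yp m l) γ
  A_zero lam := by rw [aOp_zero, Matrix.transpose_one]
  B_zero lam := by rw [bOp_zero, Matrix.transpose_zero]
  V_zero := Matrix.transpose_one
  A_succ m lam := by
    rw [aOp_succ, Matrix.transpose_add, tens_transpose, tens_transpose]; simp
  B_succ m lam := by
    rw [bOp_succ, Matrix.transpose_add, tens_transpose, tens_transpose]; simp
  V_succ _ := rfl
  polyDep m := by
    have := (D.polyDep_ops N m).1.transpose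
    rwa [Matrix.transpose_one, Matrix.transpose_smul] at this
  v_mulVec k q := by rw [siteV_psiL]; congr 1; ring
  X_mulVec k q h1 hk := by
    obtain ⟨ha, hb, -, -, -⟩ := hD.param_ne k h1 hk
    exact siteX_psiL ha hb (hD.r_pow k h1 hk).1 (-q)
  Y_mulVec k q h1 hk := by
    obtain ⟨ha, hb, -, -, hκ⟩ := hD.param_ne k h1 hk
    rw [siteY_psiL ha hb hκ (hD.r_pow k h1 hk).2 (hD.r_pow k h1 hk).1 (-q),
      show -(q + 1) = -q - 1 by ring, show -(q + 2) = -q - 2 by ring]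
    rfl
  isCyc _ _ h := (isCyc_cyc h).reflect
  S_step m l γ hm hl := by
    obtain ⟨ha, hb, hc, hd, hκ⟩ := hD.param_ne (m + 1) (by omega) (by omega)
    have hR := R_ne hD hN (m := m) (k := l + 1) (by omega) hl
    obtain ⟨hp, ht⟩ := hD.fermat_p (m + 1) (l + 1) (by omega) (by omega) (by omega)
    have sp := (isCyc_cyc hp).step γ
    have st := (isCyc_cyc ht).step (-(γ + 1))
    rw [show -(γ + 1) + 1 = -γ by ring] at st
    refine quad_factor_left hκ (div_mul_cancel₀ _ hb)
      (div_mul_cancel₀ _ (mul_ne_zero (mul_ne_zero hκ hc) hR)) (chi_mul_chi_neg 1) ?_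
      ?_ ?_ sp st ((isCyc_cyc hp).ne γ) ((isCyc_cyc hp).ne (γ + 1))
    · rw [AddChar.inv_apply, AddChar.inv_apply, ← AddChar.map_add_eq_mul, neg_neg, neg_neg]
    · rw [AddChar.inv_apply, neg_neg]
      exact chi_mul_chi_neg γ
    · rw [AddChar.inv_apply, neg_neg]
      refine Eq.trans ?_ (phase_add (-(γ + 1)) 1)
      rw [neg_add, neg_add_cancel_right]

theorem ket_eq_vec (hD : D.Admissible N n) (hN : 2 ≤ N) (m : ℕ) (ρ : Fin (m + 1) → ZMod N) :
    D.ket (m + 1) ρ = (rightFrame hD hN).vec m ρ := by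
  induction m with
  | zero => ext γ; simp [ket, Frame.vec, tvec, rightFrame]
  | succ m ih =>
    ext γ
    rw [ket, Frame.vec, stepVec]
    beta_reduce
    rw [Finset.sum_comm]
    simp only [Finset.sum_apply, tvec, Pi.smul_apply, smul_eq_mul, Finset.sum_mul, mul_assoc]
    exact Finset.sum_congr rfl fun q _ => Finset.sum_congr rfl fun σ _ => by rw [ih]; rfl

/-- The factor `phase (∑ k, σ k - σ 0)` of `QL` splits into one phase for each `σ l` with `l ≥ 1`.
These are the phases in the function `S` of the left frame. -/
theorem QL_neg (hD : D.Admissible N n) (hN : 2 ≤ N) {m : ℕ} (σ : Fin (m + 1) → ZMod N)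
    (q : ZMod N) (ρ : Fin (m + 2) → ZMod N) :
    D.QL (-σ) (-q) (-ρ) = (leftFrame hD hN).Q m σ q ρ := by
  have h1 : ∏ l : Fin m, phase (-σ l.succ) = phase (∑ k, (-σ) k - (-σ) 0) := by
    rw [Fin.sum_univ_succ, add_sub_cancel_left]
    exact prod_addChar _ _ _
  have e2 (a b : ZMod N) : -(a - b) - -1 - 1 = -a - -b := by ring
  have e1 (a b : ZMod N) : -(a - b) - 1 = -a - -b - 1 := by ring
  rw [QL, add_sub_assoc, phase_add, ← h1]
  simp only [Frame.Q, kern, leftFrame, e1, Finset.prod_inv_distrib, Finset.prod_mul_distrib,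
    Finset.prod_div_distrib, wR, Pi.neg_apply, Finset.sum_neg_distrib, AddChar.inv_apply]
  rw [e2, e2,
    show (-∑ k, ρ k - -∑ k, σ k) * (-q - -ρ 0) = (∑ k, ρ k - ∑ k, σ k) * (q - ρ 0) by ring]
  simp only [phase, div_eq_mul_inv, mul_inv, inv_inv, neg_neg]
  ring

theorem bra_eq_vec (hD : D.Admissible N n) (hN : 2 ≤ N) (m : ℕ) (ρ : Fin (m + 1) → ZMod N) :
    D.bra (m + 1) (-ρ) = (leftFrame hD hN).vec m ρ := by
  induction m with
  | zero => ext γ; simp [bra, Frame.vec, tvec, leftFrame]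
  | succ m ih =>
    ext γ
    rw [bra, Frame.vec, stepVec]
    beta_reduce
    rw [Finset.sum_comm, ← Equiv.sum_comp (Equiv.neg (ZMod N))]
    simp only [Finset.sum_apply, tvec, Pi.smul_apply, smul_eq_mul, Finset.sum_mul, mul_assoc]
    refine Finset.sum_congr rfl fun q _ => ?_
    rw [← Equiv.sum_comp (Equiv.neg (Fin (m + 1) → ZMod N))]
    refine Finset.sum_congr rfl fun σ _ => ?_
    rw [← ih, ← QL_neg]
    rfl

theorem bOp_mulVec_ket (hD : D.Admissible N n) (hN : 2 ≤ N) {m : ℕ} (hm : m + 1 ≤ n)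
    (ρ : Fin (m + 1) → ZMod N) (lam : ℂ) :
    D.bOp N (m + 1) lam *ᵥ D.ket (m + 1) ρ = D.eigB ρ lam • D.ket (m + 1) ρ := by
  rw [ket_eq_vec hD hN, eigB_eq_eigv]
  exact ((rightFrame hD hN).shiftFamily hD hN hm).eig ρ lam

theorem bra_vecMul_bOp (hD : D.Admissible N n) (hN : 2 ≤ N) {m : ℕ} (hm : m + 1 ≤ n)
    (ρ : Fin (m + 1) → ZMod N) (lam : ℂ) :
    D.bra (m + 1) ρ ᵥ* D.bOp N (m + 1) lam = D.eigB ρ lam • D.bra (m + 1) ρ := by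
  have h := ((leftFrame hD hN).shiftFamily hD hN hm).eig (-ρ) lam
  rw [← bra_eq_vec hD hN, neg_neg] at h
  have he : eigv (leftFrame hD hN).χ (D.R (m + 1)) (-ρ) lam = D.eigB ρ lam := by
    rw [eigB_eq_eigv]
    simp [eigv, zeta, leftFrame, AddChar.inv_apply]
  rw [he] at h
  rw [← h]
  exact (Matrix.mulVec_transpose _ _).symm

end Data

end

/-! ### Sums over roots of unity and Cauchy's determinant. -/

section

section Sums

variable {N : ℕ} [NeZero N]

theorem sum_phase_mul (b : ZMod N) :
    ∑ γ : ZMod N, phase (γ * b) = if b = 0 then (N : ℂ) else 0 := by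
  have := AddChar.sum_mulShift b (ZMod.isPrimitive_stdAddChar N)
  rw [ZMod.card] at this
  exact_mod_cast this

theorem one_sub_phase_mul_ne {x : ℂ} (hx : x ^ N ≠ 1) (γ : ZMod N) : 1 - phase γ * x ≠ 0 := by
  intro h
  have := congrArg (· ^ N) (sub_eq_zero.1 h)
  simp only [one_pow, mul_pow, phase_pow_card, one_mul] at this
  exact hx this.symm

/-- Multiplication by `1 - x ^ N` turns each term into a finite geometric sum, of which only the
constant term survives the summation over `γ`. -/
theorem sum_inv_one_sub_phase {x : ℂ} (hx : x ^ N ≠ 1) :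
    ∑ γ : ZMod N, (1 - phase γ * x)⁻¹ = N / (1 - x ^ N) := by
  have h1 : 1 - x ^ N ≠ 0 := sub_ne_zero.2 hx.symm
  have h (γ : ZMod N) : (1 - phase γ * x)⁻¹
      = (∑ j ∈ Finset.range N, x ^ j * phase (γ * (j : ZMod N))) / (1 - x ^ N) := by
    rw [eq_div_iff h1, inv_mul_eq_iff_eq_mul₀ (one_sub_phase_mul_ne hx γ)]
    have := mul_neg_geom_sum (phase γ * x) N
    rw [mul_pow, phase_pow_card, one_mul] at this
    rw [← this]
    congr 1
    exact Finset.sum_congr rfl fun j _ => by rw [mul_pow, phase_pow, mul_comm, mul_comm γ]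
  rw [Finset.sum_congr rfl fun γ _ => h γ, ← Finset.sum_div, Finset.sum_comm]
  congr 1
  simp only [← Finset.mul_sum, sum_phase_mul]
  rw [Finset.sum_eq_single 0]
  · simp
  · intro j hj h0
    rw [if_neg, mul_zero]
    rw [ZMod.natCast_eq_zero_iff]
    exact fun hd => h0 (Nat.eq_zero_of_dvd_of_lt hd (Finset.mem_range.1 hj))
  · intro h; exact absurd (Finset.mem_range.2 (NeZero.pos N)) h

theorem sum_inv_one_sub_phase_sub {x : ℂ} (hx : x ^ N ≠ 1) (c : ZMod N) :
    ∑ γ : ZMod N, (1 - phase (c - γ) * x)⁻¹ = N / (1 - x ^ N) := by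
  rw [← sum_inv_one_sub_phase hx]
  exact Fintype.sum_equiv (Equiv.subLeft c) _ _ fun _ => rfl

theorem sum_phase_div_one_sub_phase {x : ℂ} (hx : x ^ N ≠ 1) (hx0 : x ≠ 0) :
    ∑ γ : ZMod N, phase γ / (1 - phase γ * x) = N * x ^ (N - 1) / (1 - x ^ N) := by
  have h1 : 1 - x ^ N ≠ 0 := sub_ne_zero.2 hx.symm
  have h (γ : ZMod N) : x * (phase γ / (1 - phase γ * x)) = (1 - phase γ * x)⁻¹ - 1 := by
    have := one_sub_phase_mul_ne hx γ
    rw [mul_div_assoc', div_eq_iff this, sub_mul, inv_mul_cancel₀ this]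
    ring
  apply mul_left_cancel₀ hx0
  rw [Finset.mul_sum, Finset.sum_congr rfl fun γ _ => h γ, Finset.sum_sub_distrib,
    sum_inv_one_sub_phase hx, mul_div_assoc', mul_left_comm, mul_pow_sub_one (NeZero.ne N)]
  simp only [Finset.sum_const, Finset.card_univ, ZMod.card, nsmul_eq_mul, mul_one]
  field_simp
  ring

theorem sum_div_sub_phase {R t : ℂ} (hR : R ≠ 0) (h : R ^ N ≠ t ^ N) :
    ∑ a : ZMod N, R * phase (-a) * (R * phase (-a) - t)⁻¹
      = N * R ^ N * (R ^ N - t ^ N)⁻¹ := by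
  have hx : (t / R) ^ N ≠ 1 := by
    rw [div_pow, Ne, div_eq_one_iff_eq (pow_ne_zero _ hR)]; exact h.symm
  have e (a : ZMod N) : R * phase (-a) * (R * phase (-a) - t)⁻¹ = (1 - phase a * (t / R))⁻¹ := by
    have h1 := phase_neg_mul a
    have h2 := phase_ne (-a)
    have h3 : R * phase (-a) - t = R * phase (-a) * (1 - phase a * (t / R)) := by
      rw [mul_one_sub, show R * phase (-a) * (phase a * (t / R))
        = phase (-a) * phase a * (R * (t / R)) by ring, h1, mul_div_cancel₀ t hR, one_mul]
    rw [h3, mul_inv, mul_inv_cancel_left₀ (mul_ne_zero hR h2)]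
  rw [Finset.sum_congr rfl fun a _ => e a, sum_inv_one_sub_phase hx, div_pow]
  have h3 := sub_ne_zero.2 h
  field_simp

end Sums

theorem prod_erase_eq_prod_Ioi {m : ℕ} (f : Fin m → Fin m → ℂ) :
    ∏ k, ∏ j ∈ Finset.univ.erase k, f k j = ∏ k, ∏ j ∈ Finset.Ioi k, f k j * f j k := by
  have h (k : Fin m) : ∏ j ∈ Finset.univ.erase k, f k j
      = (∏ j ∈ Finset.Ioi k, f k j) * ∏ j ∈ Finset.Iio k, f k j := by
    rw [← Finset.prod_union]
    · congr 1
      ext j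
      rw [Finset.mem_erase, Finset.mem_union, Finset.mem_Ioi, Finset.mem_Iio]
      refine ⟨fun h => (lt_or_gt_of_ne h.1).symm, ?_⟩
      rintro (h | h)
      · exact ⟨h.ne', Finset.mem_univ _⟩
      · exact ⟨h.ne, Finset.mem_univ _⟩
    · rw [Finset.disjoint_left]
      intro j h1 h2
      exact lt_asymm (Finset.mem_Ioi.1 h1) (Finset.mem_Iio.1 h2)
  simp only [h, Finset.prod_mul_distrib]
  congr 1
  exact Finset.prod_comm' (by simp)

theorem det_cons_one {m : ℕ} (G : Fin m → Fin (m + 1) → ℂ) :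
    (Matrix.of (Fin.cons 1 G : Fin (m + 1) → Fin (m + 1) → ℂ)).det
      = ∑ π : Equiv.Perm (Fin (m + 1)), ((Equiv.Perm.sign π : ℤ) : ℂ) * ∏ l, G l (π l.succ) := by
  rw [← Matrix.det_transpose, Matrix.det_apply']
  refine Finset.sum_congr rfl fun π _ => ?_
  rw [Fin.prod_univ_succ]
  simp

/-- Cauchy's determinant, with one of the nodes at infinity. -/
theorem exists_cauchy_det (m : ℕ) : ∃ s : ℂ, ∀ (z : Fin m → ℂ) (t : Fin (m + 1) → ℂ),
    Function.Injective t → (∀ l k, z l ≠ t k) →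
    (∏ l, ∏ l' ∈ Finset.Ioi l, (z l - z l')) * (∏ k, ∏ k' ∈ Finset.Ioi k, (t k' - t k))
        / ∏ l, ∏ k, (z l - t k)
      = s * ∑ π : Equiv.Perm (Fin (m + 1)), ((Equiv.Perm.sign π : ℤ) : ℂ)
          * ∏ l, (z l - t (π l.succ))⁻¹ := by
  set S : ℂ := ∏ k : Fin (m + 1), ∏ _k' ∈ Finset.Ioi k, (-1 : ℂ) with hS
  set S' : ℂ := (-1) ^ m * ∏ l : Fin m, ∏ _l' ∈ Finset.Ioi l, (-1 : ℂ) with hS'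
  have hS0 : S ≠ 0 := Finset.prod_ne_zero_iff.2 fun _ _ => Finset.prod_ne_zero_iff.2
    fun _ _ => by norm_num
  have hS0' : S' ≠ 0 := mul_ne_zero (pow_ne_zero _ (by norm_num)) (Finset.prod_ne_zero_iff.2
    fun _ _ => Finset.prod_ne_zero_iff.2 fun _ _ => by norm_num)
  -- The sign depends on `m` alone. Its value is irrelevant, since in `sum_prod_div_prod` the
  -- formula is used once to expand and once to sum up.
  refine ⟨(S * S')⁻¹, fun z t ht hz => ?_⟩
  -- The numerators left when the row of the Cauchy matrix at `x` is multiplied by the product of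
  -- all `x - t j`. Their coefficient matrix `M` has a determinant known from its product with the
  -- Vandermonde matrix of `t`.
  let P : Fin (m + 1) → ℂ[X] := fun k =>
    ∏ j ∈ Finset.univ.erase k, (Polynomial.X - Polynomial.C (t j))
  have hPm (k) : (P k).Monic := Polynomial.monic_prod_X_sub_C _ _
  have hPd (k) : (P k).natDegree = m := by
    rw [Polynomial.natDegree_finsetProd_X_sub_C_eq_card]; simp
  have hPe (k) (x : ℂ) : ∑ i : Fin (m + 1), x ^ (i : ℕ) * (P k).coeff i
      = ∏ j ∈ Finset.univ.erase k, (x - t j) := by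
    rw [Fin.sum_univ_eq_sum_range (fun i => x ^ i * (P k).coeff i)]
    have := Polynomial.eval_eq_sum_range (p := P k) x
    rw [hPd] at this
    rw [Polynomial.eval_prod] at this
    simp only [Polynomial.eval_sub, Polynomial.eval_X, Polynomial.eval_C] at this
    rw [this]
    exact Finset.sum_congr rfl fun i _ => mul_comm _ _
  let M : Matrix (Fin (m + 1)) (Fin (m + 1)) ℂ := Matrix.of fun i k => (P k).coeff i
  have hV : (Matrix.vandermonde t).det ≠ 0 := Matrix.det_vandermonde_ne_zero_iff.2 ht
  have h1 : M.det = S * (Matrix.vandermonde t).det := by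
    have hm : Matrix.vandermonde t * M
        = Matrix.diagonal fun k => ∏ j ∈ Finset.univ.erase k, (t k - t j) := by
      ext i k
      rw [Matrix.mul_apply]
      simp only [Matrix.vandermonde_apply, M, Matrix.of_apply, hPe, Matrix.diagonal_apply]
      split_ifs with h
      · rw [h]
      · exact Finset.prod_eq_zero (Finset.mem_erase.2 ⟨h, Finset.mem_univ i⟩) (sub_self _)
    have := congrArg Matrix.det hm
    rw [Matrix.det_mul, Matrix.det_diagonal, prod_erase_eq_prod_Ioi] at this
    apply mul_left_cancel₀ hV
    rw [this, hS, Matrix.det_vandermonde]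
    simp only [← Finset.prod_mul_distrib]
    exact Finset.prod_congr rfl fun _ _ => Finset.prod_congr rfl fun _ _ => by ring
  -- The first projective node `(1, 0)` is the point at infinity. It picks out leading coefficients
  -- and hence gives the row of ones.
  let E := Matrix.projVandermonde (Fin.cons 1 z : Fin (m + 1) → ℂ) (Fin.cons 0 1)
  have h2 : E.det = S' * ∏ l, ∏ l' ∈ Finset.Ioi l, (z l - z l') := by
    rw [Matrix.det_projVandermonde, Fin.prod_univ_succ, Fin.prod_Ioi_zero]
    simp only [Fin.prod_Ioi_succ, Fin.cons_zero, Fin.cons_succ, Pi.one_apply, mul_one, mul_zero,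
      zero_sub, Finset.prod_const, Finset.card_univ, Fintype.card_fin]
    rw [hS', mul_assoc]
    congr 1
    simp only [← Finset.prod_mul_distrib]
    exact Finset.prod_congr rfl fun _ _ => Finset.prod_congr rfl fun _ _ => by ring
  have h3 : E * M = Matrix.diagonal (Fin.cons 1 fun l => ∏ j, (z l - t j))
      * Matrix.of (Fin.cons 1 fun l k => (z l - t k)⁻¹ : Fin (m + 1) → Fin (m + 1) → ℂ) := by
    ext i k
    rw [Matrix.mul_apply, Matrix.diagonal_mul]
    refine Fin.cases ?_ (fun l => ?_) i
    · rw [Finset.sum_eq_single (Fin.last m)]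
      · have := hPm k
        rw [Polynomial.Monic, Polynomial.leadingCoeff, hPd] at this
        simp [E, M, Matrix.projVandermonde_apply, this]
      · intro j _ hj
        have : (j.rev : ℕ) ≠ 0 := by
          intro h
          exact hj (Fin.rev_eq_iff.1 (Fin.ext h : j.rev = 0))
        simp only [E, Matrix.projVandermonde_apply, Fin.cons_zero, zero_pow this, mul_zero,
          zero_mul]
      · simp
    · simp only [E, M, Matrix.projVandermonde_apply, Fin.cons_succ, Pi.one_apply, one_pow,
        mul_one, Matrix.of_apply, hPe]
      rw [← Finset.mul_prod_erase _ _ (Finset.mem_univ k)]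
      field_simp [sub_ne_zero.2 (hz l k)]
  have h4 := congrArg Matrix.det h3
  rw [Matrix.det_mul, Matrix.det_mul, Matrix.det_diagonal, h1, h2, Fin.prod_univ_succ,
    det_cons_one, Matrix.det_vandermonde] at h4
  simp only [Fin.cons_zero, Fin.cons_succ, one_mul] at h4
  have h5 : ∏ l, ∏ k, (z l - t k) ≠ 0 := Finset.prod_ne_zero_iff.2 fun l _ =>
    Finset.prod_ne_zero_iff.2 fun k _ => sub_ne_zero.2 (hz l k)
  rw [div_eq_iff h5, inv_mul_eq_div, div_mul_eq_mul_div, eq_div_iff (mul_ne_zero hS0 hS0')]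
  linear_combination h4

/-- By Cauchy's formula, the summand times the Vandermonde product of `t` is a signed sum over
permutations of products of functions of one `τ l` each. The sums over `τ` factorize,
`sum_div_sub_phase` replaces all variables by `N`-th powers, and Cauchy's formula for the powers
gives the closed form. -/
theorem sum_prod_div_prod {N : ℕ} [NeZero N] {m : ℕ} (R : Fin m → ℂ) (t : Fin (m + 1) → ℂ)
    (hR : ∀ l, R l ≠ 0) (ht : Function.Injective fun k => t k ^ N)
    (h : ∀ l k, R l ^ N ≠ t k ^ N) :
    ∑ τ : Fin m → ZMod N, (∏ l, R l * phase (-τ l))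
        * (∏ l, ∏ l' ∈ Finset.Ioi l, (R l * phase (-τ l) - R l' * phase (-τ l')))
        / ∏ l, ∏ k, (R l * phase (-τ l) - t k)
      = N ^ m * (∏ l, R l ^ N) * ((∏ l, ∏ l' ∈ Finset.Ioi l, (R l ^ N - R l' ^ N))
          * (∏ k, ∏ k' ∈ Finset.Ioi k, (t k' ^ N - t k ^ N)) / ∏ l, ∏ k, (R l ^ N - t k ^ N))
        / ∏ k, ∏ k' ∈ Finset.Ioi k, (t k' - t k) := by
  obtain ⟨s, hs⟩ := exists_cauchy_det m
  have ht' : Function.Injective t := fun a b hab => ht (congrArg (· ^ N) hab)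
  have hV : ∏ k, ∏ k' ∈ Finset.Ioi k, (t k' - t k) ≠ 0 :=
    Finset.prod_ne_zero_iff.2 fun k _ => Finset.prod_ne_zero_iff.2 fun k' hk =>
      sub_ne_zero.2 (ht'.ne (ne_of_gt (Finset.mem_Ioi.1 hk)))
  have hpow (l) (a : ZMod N) : (R l * phase (-a)) ^ N = R l ^ N := by
    rw [mul_pow, phase_pow_card, mul_one]
  have hne (τ : Fin m → ZMod N) (l k) : R l * phase (-τ l) ≠ t k := fun he => h l k (by
    rw [← hpow l (-(-τ l)), neg_neg, he])
  rw [eq_div_iff hV, Finset.sum_mul, hs (fun l => R l ^ N) (fun k => t k ^ N) ht h]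
  have e (τ : Fin m → ZMod N) : (∏ l, R l * phase (-τ l))
        * (∏ l, ∏ l' ∈ Finset.Ioi l, (R l * phase (-τ l) - R l' * phase (-τ l')))
        / (∏ l, ∏ k, (R l * phase (-τ l) - t k)) * ∏ k, ∏ k' ∈ Finset.Ioi k, (t k' - t k)
      = s * ∑ π : Equiv.Perm (Fin (m + 1)), ((Equiv.Perm.sign π : ℤ) : ℂ)
          * ∏ l, (R l * phase (-τ l) * (R l * phase (-τ l) - t (π l.succ))⁻¹) := by
    simp only [Finset.prod_mul_distrib (f := fun l => R l * phase (-τ l)),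
      mul_left_comm _ (∏ l, R l * phase (-τ l)), ← Finset.mul_sum]
    rw [← hs (fun l => R l * phase (-τ l)) t ht' (hne τ)]
    ring
  rw [Finset.sum_congr rfl fun τ _ => e τ, ← Finset.mul_sum, Finset.sum_comm, mul_left_comm]
  congr 1
  rw [Finset.mul_sum]
  refine Finset.sum_congr rfl fun π _ => ?_
  rw [← Finset.mul_sum, ← Fintype.prod_sum
    (fun (l : Fin m) (a : ZMod N) => R l * phase (-a) * (R l * phase (-a) - t (π l.succ))⁻¹),
    Finset.prod_congr rfl fun l _ => sum_div_sub_phase (hR l) (h l (π l.succ))]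
  simp only [Finset.prod_mul_distrib, Finset.prod_const, Finset.card_univ, Fintype.card_fin]
  ring

end

/-! ### Orthogonality, and the product of the two kernels. -/

section

variable {D : Data} {N : ℕ} [NeZero N] {n : ℕ}

omit [NeZero N] in
theorem dotProduct_eq_zero_of_eigen {ι : Type*} [Fintype ι] {M : Matrix ι ι ℂ} {u w : ι → ℂ}
    {a b : ℂ} (hu : u ᵥ* M = a • u) (hw : M *ᵥ w = b • w) (h : a ≠ b) : u ⬝ᵥ w = 0 := by
  have := Matrix.dotProduct_mulVec u M w
  rw [hu, hw, dotProduct_smul, smul_dotProduct, smul_eq_mul, smul_eq_mul] at this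
  have h2 : (a - b) * (u ⬝ᵥ w) = 0 := by linear_combination -this
  exact (mul_eq_zero.1 h2).resolve_left (sub_ne_zero.2 h)

theorem tvec_dotProduct_tvec {m : ℕ} (f f' : (Fin m → ZMod N) → ℂ) (g g' : ZMod N → ℂ) :
    tvec f g ⬝ᵥ tvec f' g' = (f ⬝ᵥ f') * (g ⬝ᵥ g') := by
  simp only [dotProduct, tvec, sum_snoc, Fin.init_snoc, Fin.snoc_last, Finset.sum_mul_sum]
  exact Finset.sum_congr rfl fun i _ => Finset.sum_congr rfl fun j _ => by ring

theorem cyc_div_phase (x y : ℂ) (γ : ZMod N) :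
    cyc x (y / phase (1 : ZMod N)) γ = cyc x y γ * phase (-γ) := by
  have h : phase (-γ) = (phase (1 : ZMod N))⁻¹ ^ γ.val := by
    rw [inv_pow, phase_pow, ZMod.natCast_val, ZMod.cast_id, mul_one]
    exact eq_inv_of_mul_eq_one_left (phase_neg_mul γ)
  have h' : (phase (1 : ZMod N))⁻¹ ^ γ.val
      = ∏ _j ∈ Finset.range γ.val, (phase (1 : ZMod N))⁻¹ := by
    rw [Finset.prod_const, Finset.card_range]
  rw [cyc, cyc, h, h', ← Finset.prod_mul_distrib]
  exact Finset.prod_congr rfl fun j _ => by ring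

omit [NeZero N] in
theorem IsCyc.div {χ : AddChar (ZMod N) ℂ} {x y : ℂ} {f : ZMod N → ℂ} (h : IsCyc χ x y f)
    (γ : ZMod N) : f γ / f (γ - 1) = y / (1 - χ γ * x) := by
  have := h.step (γ - 1)
  rw [sub_add_cancel] at this
  rw [div_eq_div_iff (h.ne _) (h.factor_ne γ), this]

omit [NeZero N] in
theorem IsFermat.pow_ne {x y : ℂ} (h : IsFermat N x y) : x ^ N ≠ 1 := fun h1 =>
  pow_ne_zero N h.2 (by linear_combination h.1 - h1)

omit [NeZero N] in
theorem IsFermat.one_sub {x y : ℂ} (h : IsFermat N x y) : 1 - x ^ N = y ^ N := by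
  linear_combination -h.1

theorem prod_Icc_Ioc {m : ℕ} (F : ℕ → ℕ → ℂ) :
    ∏ k ∈ Finset.Icc 1 m, ∏ k' ∈ Finset.Ioc k m, F k k'
      = ∏ k : Fin m, ∏ k' ∈ Finset.Ioi k, F (k + 1) (k' + 1) := by
  have h : Finset.Icc 1 m = Finset.Ico 1 (m + 1) := rfl
  rw [h, ← prod_fin_add_one (fun k => ∏ k' ∈ Finset.Ioc k m, F k k')]
  refine Finset.prod_congr rfl fun k _ => ?_
  symm
  refine Finset.prod_nbij (fun j : Fin m => (j : ℕ) + 1) (fun j hj => ?_) (fun i _ j _ h => ?_)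
    (fun s hs => ?_) (fun _ _ => rfl)
  · have h1 := Fin.lt_def.1 (Finset.mem_Ioi.1 hj)
    have h2 := j.2
    rw [Finset.mem_Ioc]
    omega
  · exact Fin.ext (Nat.succ_injective h)
  · rw [Finset.coe_Ioc, Set.mem_Ioc] at hs
    refine ⟨⟨s - 1, by omega⟩, ?_, by simp; omega⟩
    rw [Finset.coe_Ioi, Set.mem_Ioi, Fin.lt_def]
    simp only
    omega

theorem prod_Icc {m : ℕ} (F : ℕ → ℂ) : ∏ k ∈ Finset.Icc 1 m, F k = ∏ k : Fin m, F (k + 1) :=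
  (prod_fin_add_one F).symm

namespace Data

theorem bra_dotProduct_ket (hD : D.Admissible N n) (hN : 2 ≤ N) {m : ℕ} (hm : m + 1 ≤ n)
    {σ σ' : Fin (m + 1) → ZMod N} (h : σ ≠ σ') : D.bra (m + 1) σ ⬝ᵥ D.ket (m + 1) σ' = 0 := by
  have h1 : ∃ lam, D.eigB σ lam ≠ D.eigB σ' lam := by
    by_contra hc
    push Not at hc
    exact h (hD.distinct m hm (funext hc))
  obtain ⟨lam, hl⟩ := h1
  exact dotProduct_eq_zero_of_eigen (bra_vecMul_bOp hD hN hm σ lam) (bOp_mulVec_ket hD hN hm σ' lam)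
    hl

theorem psiL_dotProduct_psiR_of_ne (hD : D.Admissible N n) {k : ℕ} (h1 : 1 ≤ k) (hk : k ≤ n)
    {q q' : ZMod N} (h : q ≠ q') : D.psiL k q ⬝ᵥ D.psiR k q' = 0 := by
  obtain ⟨ha, hb, -, -, -⟩ := hD.param_ne k h1 hk
  obtain ⟨hrN, hr⟩ := hD.r_pow k h1 hk
  have hL := siteX_psiL ha hb hrN q
  rw [Matrix.mulVec_transpose] at hL
  refine dotProduct_eq_zero_of_eigen hL (siteX_psiR ha hb hrN q') fun he => h ?_
  exact neg_injective (phase_injective (mul_left_cancel₀ hr he))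

/-- In the product of the components, the cyclic functions form the quotient at `g` and `g - 1`,
which is rational. The second coordinate of the left vector, divided by `ω`, only contributes a
phase (`cyc_div_phase`). -/
theorem psiL_dotProduct_psiR (hD : D.Admissible N n) {k : ℕ} (h1 : 1 ≤ k) (hk : k ≤ n)
    (q : ZMod N) : D.psiL k q ⬝ᵥ D.psiR k q
      = N / phase (1 : ZMod N) * (D.x1 k / D.y1 k) ^ (N - 1) := by
  obtain ⟨ha, hb, -, -, -⟩ := hD.param_ne k h1 hk
  obtain ⟨hrN, hr⟩ := hD.r_pow k h1 hk
  have hF := isFermat_one ha hb hrN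
  have hc := isCyc_cyc hF
  have e (g : ZMod N) : D.psiL k q (g + q) * D.psiR k q (g + q)
      = D.y1 k / phase (1 : ZMod N) * (phase g / (1 - phase g * D.x1 k)) := by
    have hy : D.b k / (phase (1 : ZMod N) * D.a k) = D.y1 k / phase (1 : ZMod N) := by
      rw [y1, div_div, mul_comm]
    have h := hc.div g
    have hp : phase (-(g - 1)) * phase g = phase (1 : ZMod N) := by
      rw [← phase_add]; congr 1; ring
    have hp1 := phase_ne (1 : ZMod N)
    have hp2 := phase_ne (-(g - 1))
    have hn := hc.ne (g - 1)
    have hf : 1 - phase g * D.x1 k ≠ 0 := hc.factor_ne g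
    change _ = _ / (1 - phase g * D.x1 k) at h
    rw [psiL, psiR, add_sub_cancel_right, hy, cyc_div_phase, ← hp, one_div, mul_inv,
      mul_right_comm, inv_mul_eq_div, h]
    have hp3 := phase_ne g
    field_simp
  rw [dotProduct, ← sum_add_right q, Finset.sum_congr rfl fun g _ => e g, ← Finset.mul_sum,
    sum_phase_div_one_sub_phase hF.pow_ne (div_ne_zero hr ha), hF.one_sub, div_pow]
  have := hF.2
  rw [← mul_pow_sub_one (NeZero.ne N) (D.y1 k)]
  field_simp

/-- Of the double sum over the labels of the two vectors only the diagonal remains, by orthogonality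
on the shorter chain and on the last site. -/
theorem overlap_step (hD : D.Admissible N n) (hN : 2 ≤ N) {m : ℕ} (hm : m + 2 ≤ n)
    (ρ : Fin (m + 2) → ZMod N) :
    D.overlap (m + 2) ρ = N / phase (1 : ZMod N) * (D.x1 (m + 2) / D.y1 (m + 2)) ^ (N - 1)
      * ∑ σ : Fin (m + 1) → ZMod N, ∑ q, D.QL σ q ρ * D.QR σ q ρ * D.overlap (m + 1) σ := by
  have hbra : D.bra (m + 2) ρ = ∑ p : (Fin (m + 1) → ZMod N) × ZMod N,
      D.QL p.1 p.2 ρ • tvec (D.bra (m + 1) p.1) (D.psiL (m + 2) p.2) := by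
    ext γ
    rw [Fintype.sum_prod_type]
    simp only [Finset.sum_apply, Pi.smul_apply, smul_eq_mul]
    rfl
  have hket : D.ket (m + 2) ρ = ∑ p : (Fin (m + 1) → ZMod N) × ZMod N,
      D.QR p.1 p.2 ρ • tvec (D.ket (m + 1) p.1) (D.psiR (m + 2) p.2) := by
    ext γ
    rw [Fintype.sum_prod_type]
    simp only [Finset.sum_apply, Pi.smul_apply, smul_eq_mul]
    rfl
  rw [overlap, hbra, hket, sum_dotProduct, ← Fintype.sum_prod_type'
    (fun σ q => D.QL σ q ρ * D.QR σ q ρ * D.overlap (m + 1) σ), Finset.mul_sum]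
  refine Finset.sum_congr rfl fun p _ => ?_
  rw [dotProduct_sum, Finset.sum_eq_single p]
  · rw [smul_dotProduct, dotProduct_smul, tvec_dotProduct_tvec,
      psiL_dotProduct_psiR hD (by omega) hm, overlap, smul_eq_mul, smul_eq_mul]
    ring
  · intro p' _ hp
    rw [smul_dotProduct, dotProduct_smul, tvec_dotProduct_tvec]
    by_cases h1 : p.1 = p'.1
    · rw [psiL_dotProduct_psiR_of_ne hD (by omega) hm (fun h2 => hp (Prod.ext h1 h2).symm)]
      simp
    · rw [bra_dotProduct_ket hD hN (by omega) h1]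
      simp
  · simp

/-- The product of the second coordinates of the Fermat points. -/
def prodY (D : Data) (m : ℕ) : ℂ :=
  (∏ l : Fin m, ∏ k : Fin (m + 1), D.y (m + 1) (l + 1) (m + 2) (k + 1))
    / ∏ l : Fin m, ∏ j ∈ Finset.univ.erase l, D.y (m + 1) (l + 1) (m + 1) (j + 1)

/-- The shifts by one in the two kernels are such that `w_{p_{n,0}}`, `w_{p̃_n}`, `g` and `h` occur
as quotients of neighbouring values. The functions at `p_{n-1,l}` and `p̃_{n-1,l}` cancel, and of
the phases only those of the `σ l`, `l ≥ 1`, are left. -/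
theorem QL_mul_QR (hD : D.Admissible N n) (hN : 2 ≤ N) {m : ℕ} (hm : m + 2 ≤ n)
    (σ : Fin (m + 1) → ZMod N) (q : ZMod N) (ρ : Fin (m + 2) → ZMod N) :
    D.QL σ q ρ * D.QR σ q ρ = D.y0 (m + 2) * D.yt1 (m + 2) * D.prodY m
      * (1 - phase (ρ 0 - σ 0) * D.x0 (m + 2))⁻¹ * (1 - phase (∑ k, ρ k - q) * D.xt1 (m + 2))⁻¹
      * ((∏ l : Fin m, phase (σ l.succ))
        * (∏ j : Fin m, ∏ l ∈ Finset.univ.erase j,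
          (1 - phase (σ j.succ - σ l.succ) * (D.R (m + 1) (l + 1) / D.R (m + 1) (j + 1))))
        / ∏ l : Fin m, ∏ k : Fin (m + 1),
          (1 - phase (σ l.succ - ρ k.succ) * (D.R (m + 2) (k + 1) / D.R (m + 1) (l + 1)))) := by
  have h0 := (isCyc_cyc (isFermat_zero hD hN hm)).div (ρ 0 - σ 0)
  have ht := (isCyc_cyc (isFermat_tilde hD hN hm)).div (∑ k, ρ k - q)
  have hgF (l : Fin m) (k : Fin (m + 1)) := hD.fermat_up (m + 1) (l + 1) (k + 1) (by omega)
    (by omega) (by have := l.2; omega) (by omega) (by have := k.2; omega)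
  have hhF (j l : Fin m) (hjl : j ≠ l) := hD.fermat_same (m + 1) (j + 1) (l + 1) (by omega)
    (by omega) (by have := j.2; omega) (by omega) (by have := l.2; omega)
    (fun h => hjl (Fin.ext (Nat.succ_injective h)))
  have hpF (l : Fin m) := hD.fermat_p (m + 1) (l + 1) (by omega) (by omega)
    (by have := l.2; omega)
  have hG : (∏ l : Fin m, ∏ k : Fin (m + 1),
        D.wR (m + 1) (l + 1) (m + 2) (k + 1) (σ l.succ - ρ k.succ))
      / (∏ l : Fin m, ∏ k : Fin (m + 1),
        D.wR (m + 1) (l + 1) (m + 2) (k + 1) (σ l.succ - ρ k.succ - 1))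
      = (∏ l : Fin m, ∏ k : Fin (m + 1), D.y (m + 1) (l + 1) (m + 2) (k + 1))
        / ∏ l : Fin m, ∏ k : Fin (m + 1),
          (1 - phase (σ l.succ - ρ k.succ) * (D.R (m + 2) (k + 1) / D.R (m + 1) (l + 1))) := by
    simp only [← Finset.prod_div_distrib]
    exact Finset.prod_congr rfl fun l _ => Finset.prod_congr rfl fun k _ =>
      (isCyc_cyc (hgF l k)).div _
  have hH : (∏ j : Fin m, ∏ l ∈ Finset.univ.erase j,
        D.wR (m + 1) (j + 1) (m + 1) (l + 1) (σ j.succ - σ l.succ - 1))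
      / (∏ j : Fin m, ∏ l ∈ Finset.univ.erase j,
        D.wR (m + 1) (j + 1) (m + 1) (l + 1) (σ j.succ - σ l.succ))
      = (∏ j : Fin m, ∏ l ∈ Finset.univ.erase j,
          (1 - phase (σ j.succ - σ l.succ) * (D.R (m + 1) (l + 1) / D.R (m + 1) (j + 1))))
        / ∏ l : Fin m, ∏ j ∈ Finset.univ.erase l, D.y (m + 1) (l + 1) (m + 1) (j + 1) := by
    simp only [← Finset.prod_div_distrib]
    refine Finset.prod_congr rfl fun j _ => Finset.prod_congr rfl fun l hl => ?_
    have := (isCyc_cyc (hhF j l (Finset.ne_of_mem_erase hl).symm)).div (σ j.succ - σ l.succ)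
    rw [← inv_div, wR, wR, this, inv_div]
    rfl
  have hP : (∏ l : Fin m, cyc (D.xt (m + 1) (l + 1)) (D.yt (m + 1) (l + 1)) (σ l.succ)
        / cyc (D.xp (m + 1) (l + 1)) (D.yp (m + 1) (l + 1)) (-σ l.succ))
      * (∏ l : Fin m, cyc (D.xp (m + 1) (l + 1)) (D.yp (m + 1) (l + 1)) (-σ l.succ)
        / cyc (D.xt (m + 1) (l + 1)) (D.yt (m + 1) (l + 1)) (σ l.succ)) = 1 := by
    rw [← Finset.prod_mul_distrib]
    refine Finset.prod_eq_one fun l _ => ?_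
    have h1 := (isCyc_cyc (hpF l).1).ne (-σ l.succ)
    have h2 := (isCyc_cyc (hpF l).2).ne (σ l.succ)
    field_simp
  have hφ : phase (-((∑ k, ρ k - ∑ k, σ k) * (q - ρ 0)) + ∑ k, σ k - σ 0)
      * phase ((∑ k, ρ k - ∑ k, σ k) * (q - ρ 0)) = ∏ l : Fin m, phase (σ l.succ) := by
    rw [← phase_add]
    refine Eq.trans ?_ (prod_addChar _ _ _).symm
    rw [phase, Fin.sum_univ_succ σ]
    congr 1; ring
  rw [← hφ]
  generalize (∏ j : Fin m, ∏ l ∈ Finset.univ.erase j,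
          (1 - phase (σ j.succ - σ l.succ) * (D.R (m + 1) (l + 1) / D.R (m + 1) (j + 1)))) = X1 at *
  generalize (∏ l : Fin m, ∏ k : Fin (m + 1),
          (1 - phase (σ l.succ - ρ k.succ) * (D.R (m + 2) (k + 1) / D.R (m + 1) (l + 1)))) = X2
    at *
  rw [QL, QR, prodY]
  generalize (∏ l : Fin m, cyc (D.xt (m + 1) (l + 1)) (D.yt (m + 1) (l + 1)) (σ l.succ)
        / cyc (D.xp (m + 1) (l + 1)) (D.yp (m + 1) (l + 1)) (-σ l.succ)) = P1 at *
  generalize (∏ l : Fin m, cyc (D.xp (m + 1) (l + 1)) (D.yp (m + 1) (l + 1)) (-σ l.succ)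
        / cyc (D.xt (m + 1) (l + 1)) (D.yt (m + 1) (l + 1)) (σ l.succ)) = P2 at *
  generalize phase (-((∑ k, ρ k - ∑ k, σ k) * (q - ρ 0)) + ∑ k, σ k - σ 0) = φ1
  generalize phase ((∑ k, ρ k - ∑ k, σ k) * (q - ρ 0)) = φ2
  calc _ = φ1 * φ2 * (cyc (D.x0 (m + 2)) (D.y0 (m + 2)) (ρ 0 - σ 0)
          / cyc (D.x0 (m + 2)) (D.y0 (m + 2)) (ρ 0 - σ 0 - 1))
        * (cyc (D.xt1 (m + 2)) (D.yt1 (m + 2)) (∑ k, ρ k - q)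
          / cyc (D.xt1 (m + 2)) (D.yt1 (m + 2)) (∑ k, ρ k - q - 1))
        * ((∏ l : Fin m, ∏ k : Fin (m + 1),
          D.wR (m + 1) (l + 1) (m + 2) (k + 1) (σ l.succ - ρ k.succ))
          / (∏ l : Fin m, ∏ k : Fin (m + 1),
            D.wR (m + 1) (l + 1) (m + 2) (k + 1) (σ l.succ - ρ k.succ - 1)))
        * ((∏ j : Fin m, ∏ l ∈ Finset.univ.erase j,
            D.wR (m + 1) (j + 1) (m + 1) (l + 1) (σ j.succ - σ l.succ - 1))
          / (∏ j : Fin m, ∏ l ∈ Finset.univ.erase j,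
            D.wR (m + 1) (j + 1) (m + 1) (l + 1) (σ j.succ - σ l.succ))) * (P1 * P2) := by ring
    _ = _ := by
      rw [hG, hH, hP, h0, ht]
      simp only [phase]
      ring

end Data

end

/-! ### The closed formula for the overlap. -/

section

namespace Data

variable {D : Data} {N : ℕ} [NeZero N] {n : ℕ}

omit [NeZero N] in
-- There are `m (m + 1)` sign changes, an even number.
theorem prod_prod_sub_comm {m : ℕ} (Z : Fin m → ℂ) (T : Fin (m + 1) → ℂ) :
    ∏ k, ∏ l, (T k - Z l) = ∏ l, ∏ k, (Z l - T k) := by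
  rw [Finset.prod_comm]
  have h (l k) : T k - Z l = (-1) * (Z l - T k) := by ring
  simp only [h, Finset.prod_mul_distrib, Finset.prod_const, Finset.card_univ, Fintype.card_fin]
  rw [← pow_mul, mul_comm (m + 1), (Nat.even_mul_succ_self m).neg_one_pow, one_mul]

/-- One recursion for both cases of the definition: for two sites the additional products are empty.
-/
theorem constC_succ (D : Data) (N : ℕ) [NeZero N] (m : ℕ) : D.constC N (m + 2)
    = D.constC N (m + 1) * ((N : ℂ) ^ 3 / phase (1 : ZMod N)
        * (D.x1 (m + 2) / (D.y1 (m + 2) * D.y0 (m + 2) * D.yt1 (m + 2))) ^ (N - 1) * D.prodY m)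
      * (N : ℂ) ^ m
      * ((∏ k : Fin (m + 1), ∏ k' ∈ Finset.Ioi k,
              (D.R (m + 2) (k' + 1) ^ N - D.R (m + 2) (k + 1) ^ N))
          * (∏ l : Fin m, ∏ l' ∈ Finset.Ioi l,
              (D.R (m + 1) (l + 1) ^ N - D.R (m + 1) (l' + 1) ^ N))
        / ∏ l : Fin m, ∏ k : Fin (m + 1), (D.R (m + 1) (l + 1) ^ N - D.R (m + 2) (k + 1) ^ N))
      * ∏ l : Fin m, D.R (m + 1) (l + 1) ^ (N + 1) := by
  cases m with
  | zero =>
    have h (k : Fin (0 + 1)) : Finset.Ioi k = ∅ := by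
      ext j
      simp only [Finset.mem_Ioi, Finset.notMem_empty, iff_false, not_lt, Fin.le_def]
      omega
    simp only [constC, prodY, h, Finset.univ_eq_empty, Finset.prod_empty, Finset.prod_const_one,
      pow_zero, div_one, mul_one]
    rw [zero_add, mul_right_comm (D.y1 2)]
  | succ m =>
    have hN : D.calN N (m + 3) = (N : ℂ) ^ 3 / phase (1 : ZMod N)
        * (D.x1 (m + 3) / (D.y1 (m + 3) * D.y0 (m + 3) * D.yt1 (m + 3))) ^ (N - 1)
        * D.prodY (m + 1) := by
      have h1 : Finset.Icc 1 (m + 3 - 2) = Finset.Icc 1 (m + 1) := rfl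
      have h2 : Finset.Icc 1 (m + 1) = Finset.Ico 1 (m + 1 + 1) := rfl
      have h3 : Finset.Icc 1 (m + 3 - 1) = Finset.Icc 1 (m + 2) := rfl
      have h4 (l : ℕ) : D.y (m + 3 - 1) l = D.y (m + 2) l := rfl
      rw [calN, prodY, h1, prod_Icc, Finset.prod_div_distrib]
      simp only [h2, h3, h4, prod_Icc, ← prod_erase_fin_add_one]
      rfl
    rw [constC, hN, prod_Icc_Ioc, prod_Icc_Ioc, prod_Icc, prod_Icc]
    simp only [prod_Icc]
    rw [prod_prod_sub_comm (fun l : Fin (m + 1) => D.R (m + 2) (l + 1) ^ N)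
      (fun k => D.R (m + 3) (k + 1) ^ N)]

/-- In the variables `R l * phase (-τ l)` the product over `j ≠ l` consists of two Vandermonde
products of opposite orientation, and the previous overlap cancels one of them. The powers of the
product of these variables reduce to one. -/
theorem summand_eq {m : ℕ} {R : Fin m → ℂ} {R' : Fin (m + 1) → ℂ} (hR : ∀ l, R l ≠ 0)
    (τ : Fin m → ZMod N) (ρ : Fin (m + 1) → ZMod N)
    (hz : Function.Injective fun l => R l * phase (-τ l)) :
    (∏ l, phase (τ l)) * (∏ j, ∏ l ∈ Finset.univ.erase j, (1 - phase (τ j - τ l) * (R l / R j)))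
        / (∏ l, ∏ k, (1 - phase (τ l - ρ k) * (R' k / R l)))
        / (∏ l, ∏ l' ∈ Finset.Ioi l, (R l' * phase (-τ l') - R l * phase (-τ l)))
      = (∏ l, R l) * ((∏ l, R l * phase (-τ l))
        * (∏ l, ∏ l' ∈ Finset.Ioi l, (R l * phase (-τ l) - R l' * phase (-τ l')))
        / ∏ l, ∏ k, (R l * phase (-τ l) - R' k * phase (-ρ k))) := by
  have hz0 (l) : R l * phase (-τ l) ≠ 0 := mul_ne_zero (hR l) (phase_ne _)
  have hW : ∏ l, ∏ l' ∈ Finset.Ioi l, (R l' * phase (-τ l') - R l * phase (-τ l)) ≠ 0 :=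
    Finset.prod_ne_zero_iff.2 fun l _ => Finset.prod_ne_zero_iff.2 fun l' hl =>
      sub_ne_zero.2 (hz.ne (ne_of_gt (Finset.mem_Ioi.1 hl)))
  have hP : ∏ l, R l * phase (-τ l) ≠ 0 := Finset.prod_ne_zero_iff.2 fun l _ => hz0 l
  have e1 : ∏ l, phase (τ l) = (∏ l, R l) / ∏ l, R l * phase (-τ l) := by
    rw [← Finset.prod_div_distrib]
    refine Finset.prod_congr rfl fun l _ => ?_
    rw [eq_div_iff (hz0 l)]
    linear_combination R l * phase_neg_mul (τ l)
  have e (a b : ZMod N) (s : ℂ) (l) : 1 - phase (τ l - b) * (s / R l)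
      = (R l * phase (-τ l) - s * phase (-b)) / (R l * phase (-τ l)) := by
    rw [eq_div_iff (hz0 l), sub_eq_add_neg (τ l), phase_add]
    have := hR l
    field_simp
    linear_combination (-s * phase (-b)) * phase_neg_mul (τ l)
  have e2 : ∏ j, ∏ l ∈ Finset.univ.erase j, (1 - phase (τ j - τ l) * (R l / R j))
      = (∏ l, ∏ l' ∈ Finset.Ioi l, (R l * phase (-τ l) - R l' * phase (-τ l')))
        * (∏ l, ∏ l' ∈ Finset.Ioi l, (R l' * phase (-τ l') - R l * phase (-τ l)))
        / (∏ l, R l * phase (-τ l)) ^ (m - 1) := by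
    simp only [e 0, Finset.prod_div_distrib, Finset.prod_const,
      Finset.card_erase_of_mem (Finset.mem_univ _), Finset.card_univ, Fintype.card_fin]
    rw [Finset.prod_pow, prod_erase_eq_prod_Ioi
      (fun j l => R j * phase (-τ j) - R l * phase (-τ l))]
    simp only [Finset.prod_mul_distrib]
  have e3 : ∏ l, ∏ k, (1 - phase (τ l - ρ k) * (R' k / R l))
      = (∏ l, ∏ k, (R l * phase (-τ l) - R' k * phase (-ρ k)))
        / (∏ l, R l * phase (-τ l)) ^ (m + 1) := by
    simp only [e 0, Finset.prod_div_distrib, Finset.prod_const, Finset.card_univ,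
      Fintype.card_fin]
    rw [Finset.prod_pow]
  -- For `m = 0` the exponent `m - 1` is truncated to zero, which is harmless because the product is
  -- empty.
  have e4 : (∏ l, R l * phase (-τ l)) ^ (m + 1) = (∏ l, R l * phase (-τ l)) ^ (m - 1)
      * (∏ l, R l * phase (-τ l)) * (∏ l, R l * phase (-τ l)) := by
    cases m with
    | zero => simp
    | succ m => simp only [Nat.add_sub_cancel, pow_succ]
  rw [e1, e2, e3, e4]
  have hP' := pow_ne_zero (m - 1) hP
  generalize (∏ l, R l * phase (-τ l)) ^ (m - 1) = P' at *
  generalize (∏ l, R l * phase (-τ l)) = P at *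
  generalize (∏ l, ∏ l' ∈ Finset.Ioi l, (R l' * phase (-τ l') - R l * phase (-τ l))) = W at *
  field_simp

theorem normalization_eq {ν ph x y y₀ y₁ u₀ u₁ Y C P M Z W T K V : ℂ} (h₀ : y₀ ≠ 0)
    (h₁ : y₁ ≠ 0) :
    ν / ph * (x / y) * (y₀ * y₁ * Y * C * (ν / (y₁ * u₁)) * (ν / (y₀ * u₀)
        * (P * ((M * Z) * ((W * T) / K) / V))))
      = C * (ν ^ 3 / ph * (x / (y * u₀ * u₁)) * Y) * M * ((T * W) / K) * (Z * P) / V := by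
  calc _ = y₀ * y₀⁻¹ * (y₁ * y₁⁻¹) * (C * (ν ^ 3 / ph * (x / (y * u₀ * u₁)) * Y) * M
        * ((T * W) / K) * (Z * P) / V) := by
        simp only [div_eq_mul_inv, mul_inv]
        ring
    _ = _ := by rw [mul_inv_cancel₀ h₀, mul_inv_cancel₀ h₁, one_mul, one_mul]

/-- By `hrec`, the summand is a product of a function of `q`, a function of `σ 0` and a function of
the remaining indices. The first two sums lose all dependence on `ρ`, and the third leaves only the
Vandermonde product of the new zeros. -/
theorem overlap_eq (hD : D.Admissible N n) (hN : 2 ≤ N) {m : ℕ} (hm : m + 1 ≤ n)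
    (ρ : Fin (m + 1) → ZMod N) :
    D.overlap (m + 1) ρ = D.constC N (m + 1) / ∏ l : Fin m, ∏ l' ∈ Finset.Ioi l,
      (D.R (m + 1) (l' + 1) * phase (-ρ l'.succ) - D.R (m + 1) (l + 1) * phase (-ρ l.succ)) := by
  induction m with
  | zero =>
    have h := psiL_dotProduct_psiR hD le_rfl hm (ρ 0)
    simp only [Finset.univ_eq_empty, Finset.prod_empty, div_one, constC]
    rw [← h, overlap, dotProduct, sum_snoc]
    simp only [Finset.univ_unique, Finset.sum_singleton]
    rfl
  | succ m ih =>
    have hR (l : Fin m) : D.R (m + 1) (l + 1) ≠ 0 := R_ne hD hN (by omega) l.2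
    have hF0 := isFermat_zero hD hN hm
    have hFt := isFermat_tilde hD hN hm
    have hrec (σ₀ : ZMod N) (τ : Fin m → ZMod N) (q : ZMod N) :
        D.QL (Fin.cons σ₀ τ : Fin (m + 1) → ZMod N) q ρ
          * D.QR (Fin.cons σ₀ τ : Fin (m + 1) → ZMod N) q ρ
          * D.overlap (m + 1) (Fin.cons σ₀ τ)
        = D.y0 (m + 2) * D.yt1 (m + 2) * D.prodY m * D.constC N (m + 1)
          * (1 - phase (∑ k, ρ k - q) * D.xt1 (m + 2))⁻¹
          * ((1 - phase (ρ 0 - σ₀) * D.x0 (m + 2))⁻¹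
          * ((∏ l : Fin m, D.R (m + 1) (l + 1))
          * ((∏ l : Fin m, D.R (m + 1) (l + 1) * phase (-τ l))
            * (∏ l : Fin m, ∏ l' ∈ Finset.Ioi l,
              (D.R (m + 1) (l + 1) * phase (-τ l) - D.R (m + 1) (l' + 1) * phase (-τ l')))
            / ∏ l : Fin m, ∏ k : Fin (m + 1), (D.R (m + 1) (l + 1) * phase (-τ l)
              - D.R (m + 2) (k + 1) * phase (-ρ k.succ))))) := by
      -- The first entry `0` only completes `τ` to an index vector; `zeta` does not depend on it.
      have hinj : Function.Injective fun l : Fin m => D.R (m + 1) (l + 1) * phase (-τ l) := by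
        have := zeta_injective hD hN (m := m) (by omega) (ZMod.stdAddChar)
          (Fin.cons 0 τ : Fin (m + 1) → ZMod N)
        exact this
      rw [QL_mul_QR hD hN hm, ih (by omega)]
      simp only [Fin.cons_succ, Fin.cons_zero]
      rw [← summand_eq (R' := fun k : Fin (m + 1) => D.R (m + 2) (k + 1)) hR τ
        (fun k => ρ k.succ) hinj]
      ring
    rw [overlap_step hD hN hm, ← Equiv.sum_comp (Fin.consEquiv fun _ : Fin (m + 1) => ZMod N),
      Fintype.sum_prod_type]
    have hc (σ₀ : ZMod N) (τ : Fin m → ZMod N) :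
        (Fin.consEquiv fun _ : Fin (m + 1) => ZMod N) (σ₀, τ) = Fin.cons σ₀ τ := rfl
    simp only [hc, hrec]
    simp only [← Finset.sum_mul, ← Finset.mul_sum]
    rw [sum_inv_one_sub_phase_sub hFt.pow_ne, sum_inv_one_sub_phase_sub hF0.pow_ne, hFt.one_sub,
      hF0.one_sub, constC_succ]
    have hpow (k : Fin (m + 1)) : (D.R (m + 2) (k + 1) * phase (-ρ k.succ)) ^ N
        = D.R (m + 2) (k + 1) ^ N := by rw [mul_pow, phase_pow_card, mul_one]
    have hs := sum_prod_div_prod (N := N) (fun l : Fin m => D.R (m + 1) (l + 1))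
      (fun k : Fin (m + 1) => D.R (m + 2) (k + 1) * phase (-ρ k.succ)) hR
      (fun j k h => by
        simp only [hpow] at h
        by_contra hjk
        exact R_pow_ne hD hN hm hjk h)
      (fun l k => by
        rw [hpow]
        have hF := hD.fermat_up (m + 1) (l + 1) (k + 1) (by omega) (by omega)
          (by have := l.2; omega) (by omega) (by have := k.2; omega)
        have := hF.pow_ne
        rw [div_pow, Ne, div_eq_one_iff_eq (pow_ne_zero _ (hR l))] at this
        exact this ∘ Eq.symm)
    simp only [hpow] at hs
    rw [hs]
    have hy0 := hF0.2
    have hyt := hFt.2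
    simp only [pow_succ _ N,
      Finset.prod_mul_distrib (f := fun l : Fin m => D.R (m + 1) (l + 1) ^ N)]
    -- The geometric sums contribute `1 / y ^ N` and the kernels one factor `y`, which together give
    -- the power `N - 1` in the constants.
    rw [← mul_pow_sub_one (NeZero.ne N) (D.y0 (m + 2)),
      ← mul_pow_sub_one (NeZero.ne N) (D.yt1 (m + 2))]
    simp only [div_pow, mul_pow]
    exact normalization_eq hy0 hyt

end Data

end

end

end BBS

theorem theorem1 (N : ℕ) [NeZero N] (hN : 2 ≤ N) (n : ℕ) [NeZero n] (D : BBS.Data)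
    (hD : D.Admissible N n) :
    -- the recursively constructed vectors are right and left eigenvectors of `B_n(λ)`
    (∀ (ρ : Fin n → ZMod N) (lam : ℂ),
      D.bOp N n lam *ᵥ D.ket n ρ = D.eigB ρ lam • D.ket n ρ ∧
      D.bra n ρ ᵥ* D.bOp N n lam = D.eigB ρ lam • D.bra n ρ) ∧
    -- their overlap does not depend on `ρ_{n,0}`
    (∀ ρ ρ' : Fin n → ZMod N, (∀ k, k ≠ 0 → ρ k = ρ' k) → D.overlap n ρ = D.overlap n ρ') ∧
    -- the overlap in terms of the zeros `λ_{n,k}`, `1 ≤ k ≤ n - 1`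
    (∀ ρ : Fin n → ZMod N,
      D.overlap n ρ = D.constC N n /
        ∏ l ∈ Finset.univ.erase (0 : Fin n), ∏ m ∈ Finset.Ioi l, (D.zeroB ρ l - D.zeroB ρ m)) ∧
    (∀ ρ : Fin n → ZMod N,
      D.overlap n ρ = D.constC N n /
        ∏ l ∈ Finset.univ.erase (0 : Fin n), ∏ m ∈ Finset.Ioi l,
          (D.R n m * BBS.phase (-ρ m) - D.R n l * BBS.phase (-ρ l))) := by
  obtain ⟨m, rfl⟩ := Nat.exists_eq_succ_of_ne_zero (NeZero.ne n)
  have h (ρ : Fin (m + 1) → ZMod N) : D.overlap (m + 1) ρ = D.constC N (m + 1) /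
      ∏ l ∈ Finset.univ.erase (0 : Fin (m + 1)), ∏ m' ∈ Finset.Ioi l,
        (D.R (m + 1) m' * BBS.phase (-ρ m') - D.R (m + 1) l * BBS.phase (-ρ l)) := by
    rw [BBS.Data.overlap_eq hD hN le_rfl, BBS.prod_erase_zero]
    simp only [Fin.prod_Ioi_succ, Fin.val_succ]
  refine ⟨fun ρ lam => ⟨BBS.Data.bOp_mulVec_ket hD hN le_rfl ρ lam,
    BBS.Data.bra_vecMul_bOp hD hN le_rfl ρ lam⟩, fun ρ ρ' hρ => ?_, fun ρ => ?_, h⟩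
  · rw [BBS.Data.overlap_eq hD hN le_rfl, BBS.Data.overlap_eq hD hN le_rfl]
    simp only [hρ _ (Fin.succ_ne_zero _)]
  · refine (h ρ).trans (congrArg (D.constC N (m + 1) / ·) ?_)
    refine Finset.prod_congr rfl fun l _ => Finset.prod_congr rfl fun k _ => ?_
    rw [BBS.Data.zeroB, BBS.Data.zeroB]
    ring
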